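/- **Setting.** Fix integers $d\ge 1$ (local dimension), $k\ge 0$ (locality) and $\mathfrak d\ge 1$ (connectivity). Consider $n$ spins $V$ with Hilbert space $\mathcal H=\bigotimes_{v\in V}\mathbb C^d$, and a finite set $S$ of subsystems $X\subseteq V$. Let $$H=\sum_{X\in S}\lambda_X h_X,\qquad \lambda_X\in\mathbb R,\quad |\lambda_X|\le 1,$$ where each $h_X$ is Hermitian with $\|h_X\|=1$ (operator norm) and $\mathrm{supp}(h_X)=X$, the support of an operator being the smallest subsystem on which it acts nontrivially. Assume that $|X|\le k$ for all $X\in S$, and that the interaction graph (vertex set $S$; two distinct subsystems are adjacent iff they intersect) has maximum degree at most $\mathfrak d$. Let $A$ be an operator with $\mathrm{supp}(A)\in S$, let $\rho=\bigotimes_{v\in V}\rho_v$ be a product of one-spin density matrices, and put $$\langle A(t)\rangle=\mathrm{tr}\left(e^{iHt}Ae^{-iHt}\rho\right),\qquad t^*=\frac{1}{2e\,\mathfrak d}.$$ **Model of computation.** Algorithms are programs for a random access machine with exact arithmetic. A step is one addition or truncated subtraction of natural numbers, one of $+,-,\times,\div$ or a conjugation of complex numbers, one comparison of natural numbers or of real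 parts, or one memory or input access. Programs contain only natural, rational and $i$ as constants. The input can be read in random access and consists of $n$, $|S|$, the subsystems $X\in S$ (as lists of spins), their neighbours in the interaction graph, the $\lambda_X$, the matrix entries of $h_X$ on $X$, the index of $\mathrm{supp}(A)$ and the matrix entries of $A$ on it, the matrix entries of the $\rho_v$, and the real numbers $t$ and $\varepsilon$. **Theorem.** For all $d\ge1$, $k\ge0$, $\mathfrak d\ge 1$ there are an algorithm and a polynomial $p$, both depending only on $d,k,\mathfrak d$ (in particular not on the system size $n$), such that for all $n$, $H$, $A$, $\rho$ as above and all real $t>0$ and $\varepsilon>0$, the algorithm halts after at most $$p\left(\left(\frac1\varepsilon\, e^{\pi t/t^*}\right)^{\exp(\pi t/t^*)}\right)$$ steps and outputs a number $\hat f_A(t)$ with $$\left|\langle A(t)\rangle-\hat f_A(t)\right|\le\varepsilon\,\|A\| .$$ -/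

import Mathlib

/-! ## Operators on a system of `n` spins of local dimension `d`

The Hilbert space is `⨂_{v : Fin n} ℂ^d`, with the product basis indexed by the configurations
`Fin n → Fin d`; operators are matrices in this basis. -/

namespace SpinSim

open scoped ComplexOrder

/-- Operators on the full system of `n` spins. -/
abbrev Operator (n d : ℕ) : Type := Matrix (Fin n → Fin d) (Fin n → Fin d) ℂ

/-- Operators on the subsystem `X`. -/
abbrev LocalOperator {n : ℕ} (d : ℕ) (X : Finset (Fin n)) : Type := Matrix (X → Fin d) (X → Fin d) ℂ

/-- The operator `B ⊗ 1` on the full system, for an operator `B` on the subsystem `X`. -/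
def embed {n d : ℕ} (X : Finset (Fin n)) (B : LocalOperator d X) : Operator n d :=
  Matrix.of fun σ τ =>
    if ∀ v, v ∉ X → σ v = τ v then B (fun x => σ x) (fun x => τ x) else 0

/-- `M` acts nontrivially at most on `X`. -/
def ActsOn {n d : ℕ} (M : Operator n d) (X : Finset (Fin n)) : Prop :=
  ∃ B : LocalOperator d X, M = embed X B

/-- `supp M = X`: the set `X` is the smallest subsystem on which `M` acts. -/
def HasSupport {n d : ℕ} (M : Operator n d) (X : Finset (Fin n)) : Prop :=
  IsLeast {Y : Finset (Fin n) | ActsOn M Y} X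

/-- The operator norm of a matrix with respect to the Hilbert space norms. -/
noncomputable def opNorm {m : Type} [Fintype m] [DecidableEq m] (M : Matrix m m ℂ) : ℝ :=
  ‖Matrix.toEuclideanCLM (n := m) (𝕜 := ℂ) M‖

/-- A density matrix: positive semidefinite of trace one. -/
def IsDensity {m : Type} [Fintype m] (ρ : Matrix m m ℂ) : Prop :=
  ρ.PosSemidef ∧ ρ.trace = 1

/-- The product operator `⨂ v, ρ v`. -/
def productOperator {n d : ℕ} (ρ : Fin n → Matrix (Fin d) (Fin d) ℂ) : Operator n d :=
  Matrix.of fun σ τ => ∏ v, ρ v (σ v) (τ v)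

/-! ## Local Hamiltonians -/

/-- A Hamiltonian `H = ∑_{X ∈ S} λ_X h_X`. The set `S` of subsystems is listed without repetition
as `sub 0, …, sub (numTerms - 1)`. Each `h_X` is given as an operator on `X`. -/
structure LocalHamiltonian (n d : ℕ) where
  numTerms : ℕ
  sub : Fin numTerms → Finset (Fin n)
  sub_injective : Function.Injective sub
  coeff : Fin numTerms → ℝ
  abs_coeff_le_one : ∀ j, |coeff j| ≤ 1
  term : ∀ j, LocalOperator d (sub j)
  term_isHermitian : ∀ j, (term j).IsHermitian
  opNorm_term : ∀ j, opNorm (embed (sub j) (term j)) = 1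
  supp_term : ∀ j, HasSupport (embed (sub j) (term j)) (sub j)

namespace LocalHamiltonian

variable {n d : ℕ}

/-- The Hamiltonian as an operator on the full system. -/
noncomputable def toOperator (H : LocalHamiltonian n d) : Operator n d :=
  ∑ j, (H.coeff j : ℂ) • embed (H.sub j) (H.term j)

/-- Every term acts on at most `k` spins. -/
def IsLocal (H : LocalHamiltonian n d) (k : ℕ) : Prop :=
  ∀ j, (H.sub j).card ≤ k

/-- The interaction graph: its vertices are the subsystems in `S`, and two distinct subsystems are
adjacent if and only if they overlap. -/
def interactionGraph (H : LocalHamiltonian n d) : SimpleGraph (Fin H.numTerms) where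
  Adj i j := i ≠ j ∧ (H.sub i ∩ H.sub j).Nonempty
  symm := ⟨fun i j h => ⟨h.1.symm, Finset.inter_comm (H.sub i) (H.sub j) ▸ h.2⟩⟩
  loopless := ⟨fun _ h => h.1 rfl⟩

instance (H : LocalHamiltonian n d) : DecidableRel H.interactionGraph.Adj :=
  fun i j => inferInstanceAs (Decidable (i ≠ j ∧ (H.sub i ∩ H.sub j).Nonempty))

end LocalHamiltonian

/-- `⟨A(t)⟩ = tr (e^{iHt} A e^{-iHt} ρ)`. -/
noncomputable def evolvedExpectation {n d : ℕ} (H A ρ : Operator n d) (t : ℝ) : ℂ :=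
  (NormedSpace.exp ((Complex.I * t) • H) * A * NormedSpace.exp ((-(Complex.I * t)) • H) * ρ).trace

/-- `t^* = 1 / (2 e 𝔡)`. -/
noncomputable def tStar (deg : ℕ) : ℝ := 1 / (2 * Real.exp 1 * deg)

/-! ## The model of computation

A random access machine with exact arithmetic, programmed in a language of while-programs. It has
arrays of natural numbers (for labels, counters and addresses) and arrays of complex numbers; the
input consists of read-only arrays with random access. Natural numbers can be added, subtracted
(with truncation) and compared; on complex numbers there are the four arithmetic operations,
conjugation, and comparison of real parts. The constants in a program are natural numbers,
rational numbers and `i`. Every elementary operation, every memory or input access and every test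
takes one step. -/

/-- The read-only input: numbered tables of natural numbers with two indices, and numbered tables
of complex numbers with three indices. -/
structure Input where
  nat : ℕ → ℕ → ℕ → ℕ
  num : ℕ → ℕ → ℕ → ℕ → ℂ

/-- The memory: numbered two-dimensional arrays of natural and of complex numbers. -/
structure Memory where
  nat : ℕ → ℕ → ℕ → ℕ
  num : ℕ → ℕ → ℕ → ℂ

/-- The memory in which every cell holds zero. -/
def Memory.zero : Memory := ⟨fun _ _ _ => 0, fun _ _ _ => 0⟩

/-- The memory after the cell `(i, j)` of the array `a` of natural numbers is overwritten by `x`. -/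
def Memory.setNat (s : Memory) (a i j x : ℕ) : Memory :=
  { s with nat := fun a' i' j' => if a' = a ∧ i' = i ∧ j' = j then x else s.nat a' i' j' }

/-- The memory after the cell `(i, j)` of the array `a` of complex numbers is overwritten by `x`. -/
def Memory.setNum (s : Memory) (a i j : ℕ) (x : ℂ) : Memory :=
  { s with num := fun a' i' j' => if a' = a ∧ i' = i ∧ j' = j then x else s.num a' i' j' }

/-- Expressions for natural numbers. In `get a i j` and `input a i j` the name `a` of the array
is fixed in the program, and the indices `i`, `j` are computed. -/
inductive NatExpr where
  | const (c : ℕ)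
  | get (a : ℕ) (i j : NatExpr)
  | input (a : ℕ) (i j : NatExpr)
  | add (x y : NatExpr)
  | sub (x y : NatExpr)

/-- The value of an expression. -/
def NatExpr.eval (inp : Input) (s : Memory) : NatExpr → ℕ
  | const c => c
  | get a i j => s.nat a (i.eval inp s) (j.eval inp s)
  | input a i j => inp.nat a (i.eval inp s) (j.eval inp s)
  | add x y => x.eval inp s + y.eval inp s
  | sub x y => x.eval inp s - y.eval inp s

/-- The number of steps in which an expression is evaluated. -/
def NatExpr.cost : NatExpr → ℕ
  | const _ => 1
  | get _ i j => i.cost + j.cost + 1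
  | input _ i j => i.cost + j.cost + 1
  | add x y => x.cost + y.cost + 1
  | sub x y => x.cost + y.cost + 1

/-- Expressions for complex numbers. -/
inductive NumExpr where
  | const (q : ℚ)
  | imag
  | get (a : ℕ) (i j : NatExpr)
  | input (a : ℕ) (i j l : NatExpr)
  | add (x y : NumExpr)
  | sub (x y : NumExpr)
  | mul (x y : NumExpr)
  | div (x y : NumExpr)
  | conj (x : NumExpr)

/-- The value of an expression. -/
noncomputable def NumExpr.eval (inp : Input) (s : Memory) : NumExpr → ℂ
  | const q => (q : ℂ)
  | imag => Complex.I
  | get a i j => s.num a (i.eval inp s) (j.eval inp s)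
  | input a i j l => inp.num a (i.eval inp s) (j.eval inp s) (l.eval inp s)
  | add x y => x.eval inp s + y.eval inp s
  | sub x y => x.eval inp s - y.eval inp s
  | mul x y => x.eval inp s * y.eval inp s
  | div x y => x.eval inp s / y.eval inp s
  | conj x => (starRingEnd ℂ) (x.eval inp s)

/-- The number of steps in which an expression is evaluated. -/
def NumExpr.cost : NumExpr → ℕ
  | const _ => 1
  | imag => 1
  | get _ i j => i.cost + j.cost + 1
  | input _ i j l => i.cost + j.cost + l.cost + 1
  | add x y => x.cost + y.cost + 1
  | sub x y => x.cost + y.cost + 1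
  | mul x y => x.cost + y.cost + 1
  | div x y => x.cost + y.cost + 1
  | conj x => x.cost + 1

/-- Tests: comparison of natural numbers, comparison of the real parts of complex numbers, and
their Boolean combinations. -/
inductive Test where
  | natLE (x y : NatExpr)
  | numLE (x y : NumExpr)
  | not (b : Test)
  | and (b c : Test)

/-- The truth value of a test. -/
def Test.Holds (inp : Input) (s : Memory) : Test → Prop
  | natLE x y => x.eval inp s ≤ y.eval inp s
  | numLE x y => (x.eval inp s).re ≤ (y.eval inp s).re
  | not b => ¬ b.Holds inp s
  | and b c => b.Holds inp s ∧ c.Holds inp s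

/-- The number of steps in which a test is evaluated. -/
def Test.cost : Test → ℕ
  | natLE x y => x.cost + y.cost + 1
  | numLE x y => x.cost + y.cost + 1
  | not b => b.cost + 1
  | and b c => b.cost + c.cost + 1

/-- Programs. -/
inductive Program where
  | skip
  | setNat (a : ℕ) (i j x : NatExpr)
  | setNum (a : ℕ) (i j : NatExpr) (x : NumExpr)
  | seq (P Q : Program)
  | ite (b : Test) (P Q : Program)
  | while (b : Test) (P : Program)

/-- `Runs inp P s s' T`: on the input `inp` and started in the memory `s`, the program `P` halts
after exactly `T` steps in the memory `s'`. -/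
inductive Runs (inp : Input) : Program → Memory → Memory → ℕ → Prop where
  | skip (s : Memory) : Runs inp .skip s s 1
  | setNat (s : Memory) (a : ℕ) (i j x : NatExpr) :
      Runs inp (.setNat a i j x) s
        (s.setNat a (i.eval inp s) (j.eval inp s) (x.eval inp s)) (i.cost + j.cost + x.cost + 1)
  | setNum (s : Memory) (a : ℕ) (i j : NatExpr) (x : NumExpr) :
      Runs inp (.setNum a i j x) s
        (s.setNum a (i.eval inp s) (j.eval inp s) (x.eval inp s)) (i.cost + j.cost + x.cost + 1)
  | seq {P Q : Program} {s s' s'' : Memory} {T T' : ℕ} :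
      Runs inp P s s' T → Runs inp Q s' s'' T' → Runs inp (.seq P Q) s s'' (T + T')
  | ite_true {b : Test} {P Q : Program} {s s' : Memory} {T : ℕ} :
      b.Holds inp s → Runs inp P s s' T → Runs inp (.ite b P Q) s s' (b.cost + 1 + T)
  | ite_false {b : Test} {P Q : Program} {s s' : Memory} {T : ℕ} :
      ¬ b.Holds inp s → Runs inp Q s s' T → Runs inp (.ite b P Q) s s' (b.cost + 1 + T)
  | while_true {b : Test} {P : Program} {s s' s'' : Memory} {T T' : ℕ} :
      b.Holds inp s → Runs inp P s s' T → Runs inp (.while b P) s' s'' T' →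
        Runs inp (.while b P) s s'' (b.cost + 1 + T + T')
  | while_false {b : Test} {P : Program} {s : Memory} :
      ¬ b.Holds inp s → Runs inp (.while b P) s s (b.cost + 1)

/-- The result and the number of steps of a run are determined by the program, the input and the
initial memory. -/
theorem Runs.unique {inp : Input} {P : Program} {s s₁ s₂ : Memory} {T₁ T₂ : ℕ}
    (h₁ : Runs inp P s s₁ T₁) (h₂ : Runs inp P s s₂ T₂) : s₁ = s₂ ∧ T₁ = T₂ := by
  induction h₁ generalizing s₂ T₂ with
  | skip => cases h₂; exact ⟨rfl, rfl⟩
  | setNat => cases h₂; exact ⟨rfl, rfl⟩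
  | setNum => cases h₂; exact ⟨rfl, rfl⟩
  | seq _ _ ihP ihQ =>
    cases h₂ with
    | seq hP hQ =>
      obtain ⟨rfl, rfl⟩ := ihP hP
      obtain ⟨rfl, rfl⟩ := ihQ hQ
      exact ⟨rfl, rfl⟩
  | ite_true hb _ ih =>
    cases h₂ with
    | ite_true _ h => obtain ⟨rfl, rfl⟩ := ih h; exact ⟨rfl, rfl⟩
    | ite_false hb' _ => exact absurd hb hb'
  | ite_false hb _ ih =>
    cases h₂ with
    | ite_true hb' _ => exact absurd hb' hb
    | ite_false _ h => obtain ⟨rfl, rfl⟩ := ih h; exact ⟨rfl, rfl⟩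
  | while_true hb _ _ ihP ihQ =>
    cases h₂ with
    | while_true _ hP hQ =>
      obtain ⟨rfl, rfl⟩ := ihP hP
      obtain ⟨rfl, rfl⟩ := ihQ hQ
      exact ⟨rfl, rfl⟩
    | while_false hb' => exact absurd hb hb'
  | while_false hb =>
    cases h₂ with
    | while_true hb' _ _ => exact absurd hb' hb
    | while_false _ => exact ⟨rfl, rfl⟩

/-! ## How a simulation problem is presented to the machine -/

/-- The basis configuration of `X` with the number `a < d ^ |X|`: the spins of `X` in increasing
order carry the base-`d` digits of `a`, least significant digit first. -/
def configOf {n d : ℕ} [NeZero d] (X : Finset (Fin n)) (a : ℕ) : X → Fin d :=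
  fun x => Fin.ofNat d (a / d ^ (X.filter (· < (x : Fin n))).card)

/-- The matrix entry of a local operator in row number `a` and column number `b`. -/
def localEntry {n d : ℕ} [NeZero d] (X : Finset (Fin n)) (B : LocalOperator d X) (a b : ℕ) : ℂ :=
  B (configOf X a) (configOf X b)

/-- The input tables for the Hamiltonian `H`, an operator `A` on its subsystem number `r`, the
product state with factors `ρ v`, the time `t` and the error `ε`.

Natural numbers:
table 0: the number of spins, the number of terms, and `r`;
table 1: the size of the `i`-th subsystem;
table 2: the `j`-th spin, in increasing order, of the `i`-th subsystem;
table 3: the degree of the `i`-th subsystem in the interaction graph;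
table 4: its `j`-th neighbour, in increasing order.

Complex numbers:
table 0: `t` and `ε`;
table 1: the `i`-th coefficient of `H`;
table 2: the matrix entries of the `i`-th term of `H`;
table 3: the matrix entries of `A`;
table 4: the matrix entries of `ρ i`.

Entries out of range are zero, except that row and column numbers of local operators are read
through their last digits in base `d`. -/
noncomputable def encode {n d : ℕ} [NeZero d] (H : LocalHamiltonian n d) (r : Fin H.numTerms)
    (A : LocalOperator d (H.sub r)) (ρ : Fin n → Matrix (Fin d) (Fin d) ℂ) (t ε : ℝ) : Input where
  nat := fun table i j =>
    match table with
    | 0 => [n, H.numTerms, (r : ℕ)].getD i 0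
    | 1 => if h : i < H.numTerms then (H.sub ⟨i, h⟩).card else 0
    | 2 => if h : i < H.numTerms then
        (((H.sub ⟨i, h⟩).sort (· ≤ ·)).map Fin.val).getD j 0 else 0
    | 3 => if h : i < H.numTerms then H.interactionGraph.degree ⟨i, h⟩ else 0
    | 4 => if h : i < H.numTerms then
        (((H.interactionGraph.neighborFinset ⟨i, h⟩).sort (· ≤ ·)).map Fin.val).getD j 0 else 0
    | _ => 0
  num := fun table i a b =>
    match table with
    | 0 => [(t : ℂ), (ε : ℂ)].getD i 0
    | 1 => if h : i < H.numTerms then (H.coeff ⟨i, h⟩ : ℂ) else 0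
    | 2 => if h : i < H.numTerms then localEntry (H.sub ⟨i, h⟩) (H.term ⟨i, h⟩) a b else 0
    | 3 => localEntry (H.sub r) A a b
    | 4 => if h : i < n then ρ ⟨i, h⟩ (Fin.ofNat d a) (Fin.ofNat d b) else 0
    | _ => 0

end SpinSim

/-!
The algorithm evaluates a truncated power series of the expectation value. Three facts make the
truncation accurate, and two more make it cheap, independently of the number `n` of spins.

*The expectation is analytic and bounded in a strip.* The nested commutators `ad_H ^ m A` are
expanded into terms `ad_{h i₁} ⋯ ad_{h iₘ} A`. A term vanishes unless each new factor meets the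
subsystems used before, so that there are at most `m! (deg + 1) ^ m` of them, and
`‖ad_H ^ m A‖ ≤ m! (4 deg) ^ m ‖A‖` (`LocalHamiltonian.norm_ad_pow_le`). Hence the series of
`e^{iHz} A e^{-iHz}` is dominated by a geometric series on short imaginary times. Real times act
unitarily, which extends the bound `2 ‖A‖` to the strip `|Im z| ≤ 1 / (8 deg)`
(`norm_exp_mul_mul_exp_le`).

*The disk is mapped into the strip.* The function `-log (1 - w u)`, truncated to a polynomial and
rescaled such that it takes the value `t` at `u = 1`, maps a disk of radius `R > 1` into that strip
if `w = 1 - 2⁻ˢ` and `s` is a large enough multiple of `deg * t` (`exists_logPoly_scale`).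
Composition with it gives a function that is bounded on the disk, and by Cauchy's estimate its
Taylor polynomial at `0` of order `M = 2 ^ (s + 1) * (l + s + 3)` is accurate up to the factor
`2⁻ˡ ≤ ε` at `u = 1` (`norm_sub_truncation_le`,
`LocalHamiltonian.norm_evolvedExpectation_sub_le`). All of this uses only the first `M` nested
commutators, which enter with explicit weights.

*The order is small.* With `τ = π t / t^*` one has `M = O(e^τ (log (1 / ε) + τ) + 1)`
(`order_le`). What is exponential in `M` is therefore polynomial in
`(e^τ / ε) ^ exp τ` (`pow_order_le`).

*The nested commutators split into contributions of connected sets of at most `M + 1` subsystems.*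
Instead of enumerating these sets, the algorithm runs through all `3 ^ L` labellings of a
breadth-first exploration of the interaction graph that starts from the support of `A`, for
`L = deg * (M + 1) + 1`. The labels `0`, `1`, `2` stand for "not continued", "chosen" and "continued
with the opposite sign, but not chosen". If the Hamiltonian restricted to the chosen subsystems is
inserted, and the contributions are multiplied by the sign of the labelling, then everything cancels
except that every connected set is counted exactly once (`sum_sign_eq_one`,
`LocalHamiltonian.partialExpectation_eq_sum_label`).

*Each labelling concerns few spins.* Only the at most `k L` spins of the discovered subsystems
matter, because the state is a product of operators of trace one. The contribution is computed by
Horner's scheme with matrices of size at most `d ^ (k L)` (`localExpectation_encode`).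

The program is written out with explicit array numbers. Its parts are verified by a total
correctness calculus (`Halts`) in which a program uses its own arrays from some number `lo` on and
leaves all arrays with smaller numbers alone (`Frame`). The same calculus yields the running time:
if no loop is iterated more than `N` times, then the number of steps is polynomial in `N`
(`Program.exists_time_le`), and `N` is exponential in `M` (`iterationBound`).
-/

namespace SpinSim

/-! ### Reasoning about programs -/

/-- An upper bound for the number of steps of a program in which every loop is iterated at most
`N` times. -/
def Program.time (N : ℕ) : Program → ℕ
  | .skip => 1
  | .setNat _ i j x => i.cost + j.cost + x.cost + 1
  | .setNum _ i j x => i.cost + j.cost + x.cost + 1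
  | .seq P Q => P.time N + Q.time N
  | .ite b P Q => b.cost + 1 + (P.time N + Q.time N)
  | .while b P => (N + 1) * (b.cost + 1) + N * P.time N

/-- The bound is a polynomial in `N` whose degree is the nesting depth of the loops, so that running
times never have to be tracked in detail. -/
theorem Program.exists_time_le (P : Program) : ∃ C : ℕ, ∀ N, 1 ≤ N → P.time N ≤ C * N ^ C := by
  have key : ∀ (a b N : ℕ), 1 ≤ N → a ≤ b → a * N ^ a ≤ b * N ^ b := fun a b N hN h =>
    Nat.mul_le_mul h (Nat.pow_le_pow_right hN h)
  have const : ∀ (a N : ℕ), 1 ≤ N → a ≤ a * N ^ a := fun a N hN =>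
    Nat.le_mul_of_pos_right _ (Nat.pow_pos hN)
  induction P with
  | skip => exact ⟨1, fun N hN => by simpa [Program.time] using hN⟩
  | setNat a i j x => exact ⟨_, fun N hN => const _ N hN⟩
  | setNum a i j x => exact ⟨_, fun N hN => const _ N hN⟩
  | seq P Q hP hQ =>
    obtain ⟨C, hC⟩ := hP
    obtain ⟨D, hD⟩ := hQ
    refine ⟨C + D, fun N hN => (add_le_add (hC N hN) (hD N hN)).trans ?_⟩
    rw [add_mul]
    gcongr <;> omega
  | ite b P Q hP hQ =>
    obtain ⟨C, hC⟩ := hP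
    obtain ⟨D, hD⟩ := hQ
    refine ⟨(b.cost + 1) + (C + D), fun N hN =>
      (add_le_add (const _ N hN) (add_le_add (hC N hN) (hD N hN))).trans ?_⟩
    rw [add_mul (b.cost + 1), add_mul C D]
    have pow : ∀ m ≤ b.cost + 1 + (C + D), N ^ m ≤ N ^ (b.cost + 1 + (C + D)) :=
      fun m hm => Nat.pow_le_pow_right hN hm
    exact add_le_add (Nat.mul_le_mul_left _ (pow _ (by omega)))
      (add_le_add (Nat.mul_le_mul_left _ (pow _ (by omega)))
        (Nat.mul_le_mul_left _ (pow _ (by omega))))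
  | _ b P hP =>
    obtain ⟨C, hC⟩ := hP
    refine ⟨2 * (b.cost + 1) + C, fun N hN => ?_⟩
    have h1 : (N + 1) * (b.cost + 1) ≤ 2 * (b.cost + 1) * N ^ (2 * (b.cost + 1) + C) := by
      calc (N + 1) * (b.cost + 1) ≤ (2 * N) * (b.cost + 1) := by gcongr; omega
        _ = 2 * (b.cost + 1) * N ^ 1 := by ring
        _ ≤ _ := by gcongr; omega
    have h2 : N * P.time N ≤ C * N ^ (2 * (b.cost + 1) + C) := by
      calc N * P.time N ≤ N * (C * N ^ C) := Nat.mul_le_mul_left _ (hC N hN)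
        _ = C * N ^ (C + 1) := by ring
        _ ≤ _ := Nat.mul_le_mul_left _ (Nat.pow_le_pow_right hN (by omega))
    calc _ ≤ _ := add_le_add h1 h2
      _ = _ := by ring

/-- Total correctness with a time bound: started in `s`, the program halts within the steps that
`N` iterations of each of its loops take, and the final memory satisfies `Q`. -/
def Halts (inp : Input) (N : ℕ) (P : Program) (s : Memory) (Q : Memory → Prop) : Prop :=
  ∃ s' T, Runs inp P s s' T ∧ T ≤ P.time N ∧ Q s'

/-- Arrays with a number below `lo` are unchanged. Counters, scratch arrays and results of a
program carry larger numbers than everything that is still needed, so that this is the only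
condition needed for putting programs together. -/
def Frame (lo : ℕ) (s s' : Memory) : Prop :=
  ∀ a < lo, s'.nat a = s.nat a ∧ s'.num a = s.num a

variable {inp : Input} {N lo lo' a i j i' j' x : ℕ} {z : ℂ} {s s₁ s₂ : Memory} {P P' : Program}
  {Q Q' : Memory → Prop}

@[simp] theorem Memory.setNat_nat : (s.setNat a i j x).nat lo i' j' =
    if lo = a ∧ i' = i ∧ j' = j then x else s.nat lo i' j' := rfl

@[simp] theorem Memory.setNat_num : (s.setNat a i j x).num = s.num := rfl

@[simp] theorem Memory.setNum_num : (s.setNum a i j z).num lo i' j' =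
    if lo = a ∧ i' = i ∧ j' = j then z else s.num lo i' j' := rfl

@[simp] theorem Memory.setNum_nat : (s.setNum a i j z).nat = s.nat := rfl

theorem Frame.refl (lo : ℕ) (s : Memory) : Frame lo s s := fun _ _ => ⟨rfl, rfl⟩

theorem Frame.trans (h : Frame lo s s₁) (h' : Frame lo s₁ s₂) : Frame lo s s₂ :=
  fun a ha => ⟨(h' a ha).1.trans (h a ha).1, (h' a ha).2.trans (h a ha).2⟩

theorem Frame.mono (h : Frame lo s s₁) (hl : lo' ≤ lo) : Frame lo' s s₁ :=
  fun a ha => h a (ha.trans_le hl)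

theorem Frame.setNat (h : Frame lo s s₁) (ha : lo ≤ a) : Frame lo s (s₁.setNat a i j x) := by
  refine fun b hb => ⟨?_, (h b hb).2⟩
  rw [← (h b hb).1]
  funext i' j'
  simp [show b ≠ a by omega]

theorem Frame.setNum (h : Frame lo s s₁) (ha : lo ≤ a) : Frame lo s (s₁.setNum a i j z) := by
  refine fun b hb => ⟨(h b hb).1, ?_⟩
  rw [← (h b hb).2]
  funext i' j'
  simp [show b ≠ a by omega]

theorem Halts.mono (h : Halts inp N P s Q) (hQ : ∀ s', Q s' → Q' s') : Halts inp N P s Q' := by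
  obtain ⟨s', T, h1, h2, h3⟩ := h
  exact ⟨s', T, h1, h2, hQ s' h3⟩

theorem Halts.skip (h : Q s) : Halts inp N .skip s Q := ⟨s, 1, .skip s, le_rfl, h⟩

theorem Halts.setNat {e₁ e₂ e : NatExpr}
    (h : Q (s.setNat a (e₁.eval inp s) (e₂.eval inp s) (e.eval inp s))) :
    Halts inp N (.setNat a e₁ e₂ e) s Q := ⟨_, _, .setNat s a e₁ e₂ e, le_rfl, h⟩

theorem Halts.setNum {e₁ e₂ : NatExpr} {e : NumExpr}
    (h : Q (s.setNum a (e₁.eval inp s) (e₂.eval inp s) (e.eval inp s))) :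
    Halts inp N (.setNum a e₁ e₂ e) s Q := ⟨_, _, .setNum s a e₁ e₂ e, le_rfl, h⟩

theorem Halts.seq (h : Halts inp N P s fun s' => Halts inp N P' s' Q) :
    Halts inp N (.seq P P') s Q := by
  obtain ⟨s', T, h1, h2, s'', T', h3, h4, h5⟩ := h
  exact ⟨s'', T + T', .seq h1 h3, add_le_add h2 h4, h5⟩

theorem Halts.ite {b : Test} (h : b.Holds inp s → Halts inp N P s Q)
    (h' : ¬ b.Holds inp s → Halts inp N P' s Q) : Halts inp N (.ite b P P') s Q := by
  by_cases hb : b.Holds inp s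
  · obtain ⟨s', T, h1, h2, h3⟩ := h hb
    refine ⟨s', _, .ite_true hb h1, ?_, h3⟩
    simp only [Program.time]
    omega
  · obtain ⟨s', T, h1, h2, h3⟩ := h' hb
    refine ⟨s', _, .ite_false hb h1, ?_, h3⟩
    simp only [Program.time]
    omega

/-- The rule for a loop that is iterated exactly `n` times, where `J i` holds after `i`
iterations. -/
theorem Halts.while {b : Test} {n : ℕ} (hn : n ≤ N) (J : ℕ → Memory → Prop) (h0 : J 0 s)
    (hb : ∀ i s, i ≤ n → J i s → (b.Holds inp s ↔ i < n))
    (step : ∀ i s, i < n → J i s → Halts inp N P s (J (i + 1))) :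
    Halts inp N (.while b P) s (J n) := by
  have key : ∀ k i s, i + k = n → J i s → ∃ s' T, Runs inp (.while b P) s s' T ∧
      T ≤ (k + 1) * (b.cost + 1) + k * P.time N ∧ J n s' := by
    intro k
    induction k with
    | zero =>
      intro i s hi hJ
      obtain rfl : i = n := by omega
      exact ⟨s, _, .while_false (by simp [hb i s le_rfl hJ]), by simp, hJ⟩
    | succ k ih =>
      intro i s hi hJ
      obtain ⟨s', T, h1, h2, h3⟩ := step i s (by omega) hJ
      obtain ⟨s'', T', h4, h5, h6⟩ := ih (i + 1) s' (by omega) h3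
      refine ⟨s'', _, .while_true ((hb i s (by omega) hJ).2 (by omega)) h1 h4, ?_, h6⟩
      calc b.cost + 1 + T + T' ≤ b.cost + 1 + P.time N +
            ((k + 1) * (b.cost + 1) + k * P.time N) := by omega
        _ = _ := by ring
  obtain ⟨s', T, h1, h2, h3⟩ := key n 0 s (by omega) h0
  refine ⟨s', T, h1, h2.trans ?_, h3⟩
  simp only [Program.time]
  gcongr

/-- The number in the cell `(0, 0)` of an array. -/
def scalar (a : ℕ) : NatExpr := .get a (.const 0) (.const 0)

/-- The complex number in the cell `(0, 0)` of an array. -/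
def numScalar (a : ℕ) : NumExpr := .get a (.const 0) (.const 0)

@[simp] theorem scalar_eval : (scalar a).eval inp s = s.nat a 0 0 := rfl

@[simp] theorem numScalar_eval : (numScalar a).eval inp s = s.num a 0 0 := rfl

/-- Assignment to the cell `(0, 0)` of an array. -/
def assign (a : ℕ) (e : NatExpr) : Program := .setNat a (.const 0) (.const 0) e

/-- Assignment to the cell `(0, 0)` of an array of complex numbers. -/
def numAssign (a : ℕ) (e : NumExpr) : Program := .setNum a (.const 0) (.const 0) e

theorem Halts.assign {e : NatExpr} (h : Q (s.setNat a 0 0 (e.eval inp s))) :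
    Halts inp N (assign a e) s Q := Halts.setNat h

theorem Halts.numAssign {e : NumExpr} (h : Q (s.setNum a 0 0 (e.eval inp s))) :
    Halts inp N (numAssign a e) s Q := Halts.setNum h

/-- The loop `for c = 0, …, bound - 1 do P`. -/
def forLoop (c : ℕ) (bound : NatExpr) (P : Program) : Program :=
  .seq (assign c (.const 0)) (.while (.natLE (.add (scalar c) (.const 1)) bound)
    (.seq P (assign c (.add (scalar c) (.const 1)))))

/-- In a `for` loop the invariant `J` does not mention the counter, and the frame condition is
carried along automatically. -/
theorem Halts.forLoop {c n : ℕ} {bound : NatExpr} (hn : n ≤ N)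
    (hbound : ∀ s', Frame c s s' → bound.eval inp s' = n) (J : ℕ → Memory → Prop)
    (hJ : ∀ i s' x, J i s' → J i (s'.setNat c 0 0 x)) (h0 : J 0 s)
    (step : ∀ i s', i < n → Frame c s s' → s'.nat c 0 0 = i → J i s' →
      Halts inp N P s' fun s'' => Frame (c + 1) s' s'' ∧ J (i + 1) s'') :
    Halts inp N (forLoop c bound P) s fun s' => Frame c s s' ∧ J n s' := by
  refine .seq (.assign ((Halts.while hn (fun i s' => Frame c s s' ∧ s'.nat c 0 0 = i ∧ J i s')
    ⟨(Frame.refl c s).setNat le_rfl, by simp [NatExpr.eval], hJ _ _ _ h0⟩ ?_ ?_).mono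
      fun s' h => ⟨h.1, h.2.2⟩))
  · rintro i s' hi ⟨h1, h2, h3⟩
    simp [Test.Holds, NatExpr.eval, hbound s' h1, h2]
  · rintro i s' hi ⟨h1, h2, h3⟩
    refine .seq ((step i s' hi h1 h2 h3).mono ?_)
    rintro s'' ⟨h4, h5⟩
    have h6 : s''.nat c 0 0 = i := by rw [(h4 c (by omega)).1, h2]
    refine .assign ⟨(h1.trans (h4.mono (by omega))).setNat le_rfl, ?_, hJ _ _ _ h5⟩
    simp [NatExpr.eval, h6]

end SpinSim

namespace SpinSim

/-! ### Exploring the interaction graph -/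

/-- Appends `v` to a list unless it is there already. -/
def push (l : List ℕ) (v : ℕ) : List ℕ := if v ∈ l then l else l ++ [v]

theorem prefix_push (l : List ℕ) (v : ℕ) : l <+: push l v := by
  unfold push
  split_ifs
  · exact List.prefix_rfl
  · exact List.prefix_append _ _

theorem prefix_foldl_push (m l : List ℕ) : l <+: m.foldl push l := by
  induction m generalizing l with
  | nil => exact List.prefix_rfl
  | cons v m ih => exact (prefix_push l v).trans (ih _)

theorem nodup_push {l : List ℕ} (h : l.Nodup) (v : ℕ) : (push l v).Nodup := by
  unfold push
  split_ifs with hv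
  · exact h
  · exact List.nodup_append.2 ⟨h, List.nodup_singleton v, by
      intro a ha b hb
      rw [List.mem_singleton] at hb
      rintro rfl
      exact hv (hb ▸ ha)⟩

theorem nodup_foldl_push (m : List ℕ) {l : List ℕ} (h : l.Nodup) : (m.foldl push l).Nodup := by
  induction m generalizing l with
  | nil => exact h
  | cons v m ih => exact ih (nodup_push h v)

theorem mem_push {l : List ℕ} {v w : ℕ} : w ∈ push l v ↔ w ∈ l ∨ w = v := by
  unfold push
  split_ifs with hv
  · exact ⟨Or.inl, fun h => h.elim id fun h => h ▸ hv⟩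
  · simp

theorem mem_foldl_push {m l : List ℕ} {w : ℕ} : w ∈ m.foldl push l ↔ w ∈ l ∨ w ∈ m := by
  induction m generalizing l with
  | nil => simp
  | cons v m ih => simp [ih, mem_push, or_assoc]

theorem length_foldl_push_le (m l : List ℕ) : (m.foldl push l).length ≤ l.length + m.length := by
  induction m generalizing l with
  | nil => simp
  | cons v m ih =>
    refine (ih _).trans ?_
    have : (push l v).length ≤ l.length + 1 := by
      unfold push
      split_ifs <;> simp
    simp only [List.length_cons]
    omega

theorem getD_of_prefix {l l' : List ℕ} (h : l <+: l') {q : ℕ} (hq : q < l.length) :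
    l'.getD q 0 = l.getD q 0 := by
  obtain ⟨m, rfl⟩ := h
  simp [List.getElem?_append_left hq]

theorem getD_mem {l : List ℕ} {q : ℕ} (hq : q < l.length) : l.getD q 0 ∈ l := by
  rw [List.getD_eq_getElem _ _ hq]
  exact List.getElem_mem hq

theorem exists_getD_of_mem {l : List ℕ} {v : ℕ} (h : v ∈ l) : ∃ q < l.length, l.getD q 0 = v := by
  obtain ⟨q, hq, rfl⟩ := List.getElem_of_mem h
  exact ⟨q, hq, List.getD_eq_getElem _ _ hq⟩

theorem getD_inj {l : List ℕ} (h : l.Nodup) {q q' : ℕ} (hq : q < l.length) (hq' : q' < l.length)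
    (e : l.getD q 0 = l.getD q' 0) : q = q' := by
  rw [List.getD_eq_getElem _ _ hq, List.getD_eq_getElem _ _ hq'] at e
  exact (h.getElem_inj_iff).1 e

variable (nb : ℕ → List ℕ) (r : ℕ)

/-- Breadth-first exploration from `r` steered by labels: in step `p` the vertex number `p` in the
list of discovered vertices is taken up and, unless its label `D p` is zero, its neighbours are
appended. -/
def explore (D : ℕ → ℕ) : ℕ → List ℕ
  | 0 => [r]
  | p + 1 => if p < (explore D p).length ∧ D p ≠ 0 then
      (nb ((explore D p).getD p 0)).foldl push (explore D p) else explore D p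

variable {nb r} {D D' : ℕ → ℕ}

theorem explore_prefix_succ (p : ℕ) : explore nb r D p <+: explore nb r D (p + 1) := by
  rw [explore]
  split_ifs
  · exact prefix_foldl_push _ _
  · exact List.prefix_rfl

theorem explore_prefix {p q : ℕ} (h : p ≤ q) : explore nb r D p <+: explore nb r D q := by
  induction q, h using Nat.le_induction with
  | base => exact List.prefix_rfl
  | succ q _ ih => exact ih.trans (explore_prefix_succ q)

theorem nodup_explore (p : ℕ) : (explore nb r D p).Nodup := by
  induction p with
  | zero => simp [explore]
  | succ p ih =>
    rw [explore]
    split_ifs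
    · exact nodup_foldl_push _ ih
    · exact ih

theorem mem_explore_self (p : ℕ) : r ∈ explore nb r D p :=
  (explore_prefix (Nat.zero_le p)).subset (by simp [explore])

theorem explore_congr {p : ℕ} (h : ∀ q < p, (D q = 0 ↔ D' q = 0)) :
    explore nb r D p = explore nb r D' p := by
  induction p with
  | zero => rfl
  | succ p ih =>
    simp only [explore, ih fun q hq => h q (hq.trans p.lt_succ_self), ne_eq, h p p.lt_succ_self]

/-- Once all discovered vertices have been taken up, nothing changes any more. -/
theorem explore_eq_of_length_le {p q : ℕ} (h : (explore nb r D p).length ≤ p) (hpq : p ≤ q) :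
    explore nb r D q = explore nb r D p := by
  induction q, hpq using Nat.le_induction with
  | base => rfl
  | succ q hpq ih =>
    rw [explore, ih, if_neg]
    omega

theorem lt_length_explore {p q : ℕ} (hq : q < (explore nb r D p).length) (hqp : q ≤ p) :
    q < (explore nb r D q).length := by
  by_contra! h
  rw [explore_eq_of_length_le h hqp] at hq
  omega

theorem length_explore_le_mul {deg : ℕ} (hnb : ∀ v, (nb v).length ≤ deg) (p : ℕ) :
    (explore nb r D p).length ≤ 1 + deg * p := by
  induction p with
  | zero => simp [explore]
  | succ p ih =>
    rw [explore]
    split_ifs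
    · refine (length_foldl_push_le _ _).trans ?_
      have := hnb ((explore nb r D p).getD p 0)
      rw [mul_add]
      omega
    · rw [mul_add]
      omega

/-- Only positions of discovered vertices carry a nonzero label. -/
def Canonical (nb : ℕ → List ℕ) (r : ℕ) (D : ℕ → ℕ) (p : ℕ) : Prop :=
  ∀ q < p, D q ≠ 0 → q < (explore nb r D q).length

/-- The discovered vertices in `W` carry the label `1`. -/
def Keeps (nb : ℕ → List ℕ) (r : ℕ) (D : ℕ → ℕ) (W : Finset ℕ) (p : ℕ) : Prop :=
  ∀ q < p, q < (explore nb r D q).length → (explore nb r D q).getD q 0 ∈ W → D q = 1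

/-- The sign of a labelling: every label `2` contributes a factor `-1`. -/
def sign (D : ℕ → ℕ) (p : ℕ) : ℂ := ∏ q ∈ Finset.range p, if D q = 2 then -1 else 1

/-- The labelling given by the base-`3` digits of a number. -/
def label (c : ℕ) : ℕ → ℕ := fun q => c / 3 ^ q % 3

theorem label_add {p c e : ℕ} (hc : c < 3 ^ p) (he : e < 3) :
    label (c + 3 ^ p * e) = Function.update (label c) p e := by
  funext q
  unfold label
  rcases lt_trichotomy q p with h | rfl | h
  · rw [Function.update_of_ne h.ne]
    obtain ⟨k, rfl⟩ := Nat.exists_eq_add_of_lt h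
    rw [show c + 3 ^ (q + k + 1) * e = c + 3 ^ q * (3 * (3 ^ k * e)) by ring,
      Nat.add_mul_div_left _ _ (by positivity), Nat.add_mul_mod_self_left]
  · rw [Function.update_self, Nat.add_mul_div_left _ _ (by positivity), Nat.div_eq_of_lt hc,
      zero_add, Nat.mod_eq_of_lt he]
  · rw [Function.update_of_ne h.ne']
    have h1 : 3 ^ (p + 1) ≤ 3 ^ q := Nat.pow_le_pow_right (by norm_num) h
    have h2 : c + 3 ^ p * e < 3 ^ (p + 1) := by
      rw [pow_succ]
      nlinarith
    rw [Nat.div_eq_of_lt (h2.trans_le h1), Nat.div_eq_of_lt]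
    exact lt_of_le_of_lt (by omega) (h2.trans_le h1)

theorem sum_range_three_pow_succ (p : ℕ) (f : (ℕ → ℕ) → ℂ) :
    ∑ c ∈ Finset.range (3 ^ (p + 1)), f (label c) = ∑ c ∈ Finset.range (3 ^ p),
      (f (Function.update (label c) p 0) + f (Function.update (label c) p 1) +
        f (Function.update (label c) p 2)) := by
  rw [show 3 ^ (p + 1) = 3 ^ p + 3 ^ p + 3 ^ p by ring, Finset.sum_range_add,
    Finset.sum_range_add, ← Finset.sum_add_distrib, ← Finset.sum_add_distrib]
  refine Finset.sum_congr rfl fun c hc => ?_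
  have hc := Finset.mem_range.1 hc
  rw [← label_add hc (by norm_num : 0 < 3), ← label_add hc (by norm_num : 1 < 3),
    ← label_add hc (by norm_num : 2 < 3)]
  congr 3
  · rw [add_comm, mul_one]
  · ring

theorem explore_update (p e : ℕ) {q : ℕ} (h : q ≤ p) :
    explore nb r (Function.update D p e) q = explore nb r D q :=
  explore_congr fun x hx => by rw [Function.update_of_ne (by omega)]

theorem canonical_update_succ {p e : ℕ} : Canonical nb r (Function.update D p e) (p + 1) ↔
    Canonical nb r D p ∧ (e ≠ 0 → p < (explore nb r D p).length) := by
  unfold Canonical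
  simp only [Nat.lt_succ_iff_lt_or_eq, or_imp, forall_and, forall_eq, Function.update_self,
    explore_update p e le_rfl]
  refine and_congr_left' (forall₂_congr fun q hq => ?_)
  rw [Function.update_of_ne hq.ne, explore_update p e hq.le]

theorem keeps_update_succ {p e : ℕ} {W : Finset ℕ} :
    Keeps nb r (Function.update D p e) W (p + 1) ↔ Keeps nb r D W p ∧
      (p < (explore nb r D p).length → (explore nb r D p).getD p 0 ∈ W → e = 1) := by
  unfold Keeps
  simp only [Nat.lt_succ_iff_lt_or_eq, or_imp, forall_and, forall_eq, Function.update_self,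
    explore_update p e le_rfl]
  refine and_congr_left' (forall₂_congr fun q hq => ?_)
  rw [Function.update_of_ne hq.ne, explore_update p e hq.le]

theorem sign_update_succ (p e : ℕ) : sign (Function.update D p e) (p + 1) =
    sign D p * if e = 2 then -1 else 1 := by
  unfold sign
  rw [Finset.prod_range_succ, Function.update_self]
  congr 1
  refine Finset.prod_congr rfl fun q hq => ?_
  rw [Function.update_of_ne (Finset.mem_range.1 hq).ne]

open Classical in
/-- Summation over all labellings. The labels `1` and `2` of a vertex outside `W` steer the
exploration in the same way and have opposite signs. Hence a single labelling survives: it marks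
exactly the discovered elements of `W`. -/
theorem exists_sum_label_eq (nb : ℕ → List ℕ) (r : ℕ) (W : Finset ℕ) (p : ℕ) :
    ∃ D₀ : ℕ → ℕ, (∀ q < p, (D₀ q ≠ 0 ↔
        q < (explore nb r D₀ q).length ∧ (explore nb r D₀ q).getD q 0 ∈ W)) ∧
      ∀ F : (ℕ → ℕ) → ℂ, (∀ D D', (∀ q, (D q = 0 ↔ D' q = 0)) → F D = F D') →
        ∑ c ∈ Finset.range (3 ^ p), (if Canonical nb r (label c) p ∧ Keeps nb r (label c) W p
          then sign (label c) p * F (label c) else 0) = F D₀ := by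
  induction p with
  | zero =>
    refine ⟨label 0, by simp, fun F _ => ?_⟩
    simp [Canonical, Keeps, sign]
  | succ p ih =>
    obtain ⟨D₀, h₀, hF⟩ := ih
    -- the label that survives in step `p`, as a function of the earlier ones
    let e : (ℕ → ℕ) → ℕ := fun D => if p < (explore nb r D p).length ∧
      (explore nb r D p).getD p 0 ∈ W then 1 else 0
    refine ⟨Function.update D₀ p (e D₀), fun q hq => ?_, fun F hFc => ?_⟩
    · rcases Nat.lt_succ_iff_lt_or_eq.1 hq with h | rfl
      · rw [Function.update_of_ne h.ne, explore_update p _ h.le, h₀ q h]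
      · rw [Function.update_self, explore_update q _ le_rfl]
        simp [e]
    · rw [← hF (fun D => F (Function.update D p (e D))) fun D D' h => hFc _ _ fun q => ?_]
      · rw [sum_range_three_pow_succ p (fun D => if Canonical nb r D (p + 1) ∧
          Keeps nb r D W (p + 1) then sign D (p + 1) * F D else 0)]
        refine Finset.sum_congr rfl fun c _ => ?_
        simp only [canonical_update_succ, keeps_update_succ, sign_update_succ, e]
        have h12 : F (Function.update (label c) p 2) = F (Function.update (label c) p 1) :=
          hFc _ _ fun q => by
            rcases eq_or_ne q p with rfl | hq
            · simp
            · simp [Function.update_of_ne hq]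
        by_cases h1 : Canonical nb r (label c) p ∧ Keeps nb r (label c) W p
        · obtain ⟨h1, h2⟩ := h1
          by_cases h3 : p < (explore nb r (label c) p).length
          · by_cases h4 : (explore nb r (label c) p).getD p 0 ∈ W
            · simp only [h1, h2, h3, h4]
              simp
            · -- a discovered vertex outside `W`: the labels `1` and `2` cancel, `0` is left
              simp only [h1, h2, h3, h4, h12]
              simp
          · -- nothing is left to be taken up: only the label `0` is canonical
            simp only [h1, h2, h3]
            simp
        · rw [if_neg h1, if_neg (by tauto), if_neg (by tauto), if_neg (by tauto)]
          simp
      · rcases eq_or_ne q p with rfl | hq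
        · simp only [Function.update_self, e, explore_congr fun q _ => h q]
        · simp only [Function.update_of_ne hq, h q]

/-- `W` contains `r` and the subgraph induced by `W` is connected. -/
def ConnectedFrom (nb : ℕ → List ℕ) (r : ℕ) (W : Finset ℕ) : Prop :=
  r ∈ W ∧ ∀ Z : Set ℕ, r ∈ Z → (∀ u ∈ W, u ∈ Z → ∀ v ∈ nb u, v ∈ W → v ∈ Z) → ↑W ⊆ Z

theorem connectedFrom_singleton : ConnectedFrom nb r {r} :=
  ⟨by simp, fun Z hZ _ => by simpa using hZ⟩

theorem ConnectedFrom.insert {W : Finset ℕ} (h : ConnectedFrom nb r W) {i : ℕ}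
    (hi : i ∈ W ∨ ∃ u ∈ W, i ∈ nb u) : ConnectedFrom nb r (insert i W) := by
  refine ⟨Finset.mem_insert_of_mem h.1, fun Z hZ hcl => ?_⟩
  have hW : ↑W ⊆ Z := h.2 Z hZ fun u hu huZ v hv hvW =>
    hcl u (Finset.mem_insert_of_mem hu) huZ v hv (Finset.mem_insert_of_mem hvW)
  rw [Finset.coe_insert, Set.insert_subset_iff]
  refine ⟨?_, hW⟩
  rcases hi with hi | ⟨u, hu, hi⟩
  · exact hW hi
  · exact hcl u (Finset.mem_insert_of_mem hu) (hW hu) i hi (Finset.mem_insert_self _ _)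

/-- A labelling that describes a set of vertices: it is canonical, its root has the label `1`, and
all discovered vertices have been taken up after `L` steps. -/
def Valid (nb : ℕ → List ℕ) (r L : ℕ) (D : ℕ → ℕ) : Prop :=
  Canonical nb r D L ∧ (explore nb r D L).length ≤ L ∧ D 0 = 1

/-- The vertices with the label `1`. -/
def chosen (nb : ℕ → List ℕ) (r L : ℕ) (D : ℕ → ℕ) : Finset ℕ :=
  ((Finset.range (explore nb r D L).length).filter (D · = 1)).image
    fun q => (explore nb r D L).getD q 0

theorem subset_chosen_iff {L : ℕ} (hL : (explore nb r D L).length ≤ L) {W : Finset ℕ} :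
    W ⊆ chosen nb r L D ↔ Keeps nb r D W L ∧ ∀ w ∈ W, w ∈ explore nb r D L := by
  constructor
  · intro h
    refine ⟨fun q hq hlt hW => ?_, fun w hw => ?_⟩
    · obtain ⟨q', hq', e⟩ := Finset.mem_image.1 (h hW)
      obtain ⟨h1, h2⟩ := Finset.mem_filter.1 hq'
      have hp : explore nb r D q <+: explore nb r D L := explore_prefix hq.le
      rw [← getD_of_prefix hp hlt] at e
      rwa [getD_inj (nodup_explore L) (Finset.mem_range.1 h1) (hlt.trans_le hp.length_le) e] at h2
    · obtain ⟨q', hq', rfl⟩ := Finset.mem_image.1 (h hw)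
      exact getD_mem (Finset.mem_range.1 (Finset.mem_filter.1 hq').1)
  · rintro ⟨h1, h2⟩ w hw
    obtain ⟨q, hq, rfl⟩ := exists_getD_of_mem (h2 w hw)
    have hqL := hq.trans_le hL
    have hlt := lt_length_explore hq hqL.le
    refine Finset.mem_image_of_mem _ (Finset.mem_filter.2 ⟨Finset.mem_range.2 hq,
      h1 q hqL hlt ?_⟩)
    rwa [← getD_of_prefix (explore_prefix hqL.le) hlt]

/-- If only elements of `W` are continued, then at most `deg * W.card + 1` vertices are ever
discovered, however long the exploration runs. -/
theorem length_explore_le {deg : ℕ} {W : Finset ℕ} {p : ℕ} (hdeg : ∀ v ∈ W, (nb v).length ≤ deg)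
    (hD : ∀ q < p, D q ≠ 0 → q < (explore nb r D q).length → (explore nb r D q).getD q 0 ∈ W) :
    (explore nb r D p).length ≤ deg * W.card + 1 := by
  have key : (explore nb r D p).length ≤ deg * ((Finset.range p).filter fun q => D q ≠ 0 ∧
      q < (explore nb r D q).length).card + 1 := by
    induction p with
    | zero => simp [explore]
    | succ p ih =>
      have ih := ih fun q hq => hD q (hq.trans p.lt_succ_self)
      rw [Finset.range_add_one, Finset.filter_insert, explore]
      split_ifs with h1 h2 h2
      · rw [Finset.card_insert_of_notMem (by simp), mul_add]
        have := length_foldl_push_le (nb ((explore nb r D p).getD p 0)) (explore nb r D p)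
        have := hdeg _ (hD p p.lt_succ_self h1.2 h1.1)
        omega
      · exact absurd h1.symm h2
      · exact absurd h2.symm h1
      · exact ih
  refine key.trans (Nat.succ_le_succ (Nat.mul_le_mul_left _ ?_))
  refine Finset.card_le_card_of_injOn (fun q => (explore nb r D p).getD q 0) ?_ ?_
  · intro q hq
    obtain ⟨h1, h2, h3⟩ := Finset.mem_filter.1 hq
    have h1 := Finset.mem_range.1 h1
    simp only [getD_of_prefix (explore_prefix h1.le) h3]
    exact hD q h1 h2 h3
  · intro q hq q' hq' e
    obtain ⟨h1, -, h3⟩ := Finset.mem_filter.1 hq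
    obtain ⟨h1', -, h3'⟩ := Finset.mem_filter.1 hq'
    exact getD_inj (nodup_explore p)
      (h3.trans_le (explore_prefix (Finset.mem_range.1 h1).le).length_le)
      (h3'.trans_le (explore_prefix (Finset.mem_range.1 h1').le).length_le) e

open Classical in
/-- Every connected set is counted exactly once: the surviving labelling continues exactly the
discovered elements of `W`, so it discovers all of `W` and ends in time. -/
theorem sum_sign_eq_one {deg m : ℕ} {W : Finset ℕ} (hW : ConnectedFrom nb r W)
    (hcard : W.card ≤ m) (hdeg : ∀ v ∈ W, (nb v).length ≤ deg) :
    ∑ c ∈ Finset.range (3 ^ (deg * m + 1)), (if Valid nb r (deg * m + 1) (label c) ∧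
      W ⊆ chosen nb r (deg * m + 1) (label c) then sign (label c) (deg * m + 1) else 0) = 1 := by
  set L := deg * m + 1 with hL
  obtain ⟨D₀, h₀, hF⟩ := exists_sum_label_eq nb r W L
  have hlen : (explore nb r D₀ L).length ≤ L :=
    (length_explore_le hdeg fun q hq h1 _ => ((h₀ q hq).1 h1).2).trans
      (Nat.succ_le_succ (Nat.mul_le_mul_left _ hcard))
  have hsub : ∀ w ∈ W, w ∈ explore nb r D₀ L := by
    refine hW.2 {w | w ∈ explore nb r D₀ L} (mem_explore_self L) fun u hu huZ v hv _ => ?_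
    obtain ⟨q, hq, rfl⟩ := exists_getD_of_mem huZ
    have hqL := hq.trans_le hlen
    have hlt := lt_length_explore hq hqL.le
    rw [getD_of_prefix (explore_prefix hqL.le) hlt] at hv hu
    refine (explore_prefix (Nat.succ_le_of_lt hqL)).subset ?_
    rw [Nat.succ_eq_add_one, explore, if_pos ⟨hlt, (h₀ q hqL).2 ⟨hlt, hu⟩⟩, mem_foldl_push]
    exact Or.inr hv
  have := hF (fun D => if (explore nb r D L).length ≤ L ∧ ∀ w ∈ W, w ∈ explore nb r D L
    then 1 else 0) fun D D' h => by rw [explore_congr fun q _ => h q]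
  rw [if_pos ⟨hlen, hsub⟩] at this
  rw [← this]
  refine Finset.sum_congr rfl fun c _ => ?_
  by_cases h2 : (explore nb r (label c) L).length ≤ L
  · have h0 : Keeps nb r (label c) W L → label c 0 = 1 := fun h =>
      h 0 (by omega) (by simp [explore]) (by simpa [explore] using hW.1)
    simp only [Valid, subset_chosen_iff h2, h2, true_and]
    split_ifs <;> first | tauto | simp
  · simp only [Valid, h2]
    simp

open Classical in
/-- A function on sets of vertices that is a sum of contributions of small connected subsets is
the signed sum of its values on the sets that the labellings describe. -/
theorem sum_eq_sum_label {deg m : ℕ} {ι : Finset (Finset ℕ)} {G g : Finset ℕ → ℂ} {S : Finset ℕ}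
    (hG : ∀ U ⊆ S, r ∈ U → G U = ∑ W ∈ ι, if W ⊆ U then g W else 0) (hι : ∀ W ∈ ι, W ⊆ S)
    (hr : r ∈ S) (hnb : ∀ v ∈ S, ∀ w ∈ nb v, w ∈ S)
    (hg : ∀ W ∈ ι, g W ≠ 0 → ConnectedFrom nb r W ∧ W.card ≤ m)
    (hdeg : ∀ v, (nb v).length ≤ deg) :
    G S = ∑ c ∈ Finset.range (3 ^ (deg * m + 1)), if Valid nb r (deg * m + 1) (label c) then
      sign (label c) (deg * m + 1) * G (chosen nb r (deg * m + 1) (label c)) else 0 := by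
  set L := deg * m + 1
  have hQ : ∀ (D : ℕ → ℕ) p, ∀ v ∈ explore nb r D p, v ∈ S := by
    intro D p
    induction p with
    | zero => simpa [explore] using hr
    | succ p ih =>
      rw [explore]
      split_ifs with h
      · intro v hv
        rcases mem_foldl_push.1 hv with hv | hv
        · exact ih v hv
        · exact hnb _ (ih _ (getD_mem h.1)) v hv
      · exact ih
  have hU : ∀ D, chosen nb r L D ⊆ S := by
    intro D v hv
    obtain ⟨q, hq, rfl⟩ := Finset.mem_image.1 hv
    exact hQ D L _ (getD_mem (Finset.mem_range.1 (Finset.mem_filter.1 hq).1))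
  have hrU : ∀ D, Valid nb r L D → r ∈ chosen nb r L D := by
    intro D hD
    have h0 : (explore nb r D L).getD 0 0 = r := by
      rw [getD_of_prefix (explore_prefix (Nat.zero_le L)) (by simp [explore])]
      simp [explore]
    refine Finset.mem_image.2 ⟨0, Finset.mem_filter.2 ⟨?_, hD.2.2⟩, h0⟩
    exact Finset.mem_range.2 (List.length_pos_of_mem (mem_explore_self L))
  calc G S = ∑ W ∈ ι, g W * 1 := by
        rw [hG S subset_rfl hr]
        exact Finset.sum_congr rfl fun W hW => by rw [if_pos (hι W hW), mul_one]
    _ = ∑ W ∈ ι, g W * ∑ c ∈ Finset.range (3 ^ L), (if Valid nb r L (label c) ∧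
          W ⊆ chosen nb r L (label c) then sign (label c) L else 0) := by
        refine Finset.sum_congr rfl fun W hW => ?_
        by_cases h : g W = 0
        · simp [h]
        · rw [sum_sign_eq_one (hg W hW h).1 (hg W hW h).2 fun v _ => hdeg v]
    _ = _ := by
        simp_rw [Finset.mul_sum]
        rw [Finset.sum_comm]
        refine Finset.sum_congr rfl fun c _ => ?_
        split_ifs with h
        · rw [hG _ (hU _) (hrU _ h), Finset.mul_sum]
          refine Finset.sum_congr rfl fun W _ => ?_
          simp only [h, true_and]
          split_ifs <;> ring
        · simp [h]

end SpinSim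

namespace SpinSim

/-! ### Sums over connected sets of terms -/

section Cluster

variable {V : Type*} [NormedAddCommGroup V] [NormedSpace ℂ V] (S : Finset ℕ) (r : ℕ)
  (L : ℕ → V →ₗ[ℂ] V) (A : V)

/-- The part of `(∑ i ∈ S, L i) ^ m A` that comes from the products `L i₁ ⋯ L iₘ A` with
`{r, i₁, …, iₘ} = W`. -/
def clusterTerm : ℕ → Finset ℕ → V
  | 0, W => if W = {r} then A else 0
  | m + 1, W => ∑ i ∈ S, ∑ W' ∈ S.powerset, if insert i W' = W then L i (clusterTerm m W') else 0

variable {S r L A}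

/-- The cluster terms do not depend on `U`, which only selects those that contribute. -/
theorem sum_pow_apply_eq_sum_clusterTerm {U : Finset ℕ} (hU : U ⊆ S) (hr : r ∈ U) (m : ℕ) :
    ((∑ i ∈ U, L i) ^ m) A = ∑ W ∈ S.powerset, if W ⊆ U then clusterTerm S r L A m W else 0 := by
  induction m with
  | zero =>
    rw [Finset.sum_eq_single ({r} : Finset ℕ)]
    · simp [clusterTerm, hr]
    · intro W _ hW
      simp [clusterTerm, hW]
    · simp [hU hr]
  | succ m ih =>
    rw [pow_succ', Module.End.mul_apply, ih]
    simp only [clusterTerm, LinearMap.sum_apply, map_sum]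
    have h1 : ∀ W ∈ S.powerset, (if W ⊆ U then ∑ i ∈ S, ∑ W' ∈ S.powerset,
        (if insert i W' = W then L i (clusterTerm S r L A m W') else 0) else 0) =
        ∑ i ∈ S, ∑ W' ∈ S.powerset, if insert i W' = W then
          (if insert i W' ⊆ U then L i (clusterTerm S r L A m W') else 0) else 0 := by
      intro W _
      split_ifs with h
      · refine Finset.sum_congr rfl fun i _ => Finset.sum_congr rfl fun W' _ => ?_
        split_ifs with h1 h2 <;> first | rfl | exact absurd (h1 ▸ h) h2
      · symm
        refine Finset.sum_eq_zero fun i _ => Finset.sum_eq_zero fun W' _ => ?_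
        split_ifs with h1 h2 <;> first | rfl | exact absurd (h1 ▸ h2) h
    rw [Finset.sum_congr rfl h1, Finset.sum_comm (s := S.powerset) (t := S)]
    have h2 : ∀ i ∈ S, (∑ W ∈ S.powerset, ∑ W' ∈ S.powerset, if insert i W' = W then
          (if insert i W' ⊆ U then L i (clusterTerm S r L A m W') else 0) else 0) =
        if i ∈ U then ∑ W' ∈ S.powerset, L i (if W' ⊆ U then clusterTerm S r L A m W' else 0)
          else 0 := by
      intro i hi
      rw [Finset.sum_comm]
      have : ∀ W' ∈ S.powerset, (∑ W ∈ S.powerset, if insert i W' = W then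
          (if insert i W' ⊆ U then L i (clusterTerm S r L A m W') else 0) else 0) =
          if i ∈ U then L i (if W' ⊆ U then clusterTerm S r L A m W' else 0) else 0 := by
        intro W' hW'
        rw [Finset.sum_ite_eq, if_pos (Finset.mem_powerset.2
          (Finset.insert_subset hi (Finset.mem_powerset.1 hW')))]
        by_cases h1 : i ∈ U <;> by_cases h2 : W' ⊆ U <;> simp [Finset.insert_subset_iff, h1, h2]
      rw [Finset.sum_congr rfl this]
      split_ifs <;> simp
    rw [Finset.sum_congr rfl h2, ← Finset.sum_filter, Finset.filter_mem_eq_inter,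
      Finset.inter_eq_right.2 hU]
    exact Finset.sum_comm

variable {nb : ℕ → List ℕ} {Loc : Finset ℕ → Submodule ℂ V}

theorem clusterTerm_mem (hA : A ∈ Loc {r})
    (hL : ∀ W, ∀ v ∈ Loc W, ∀ i ∈ S, L i v ∈ Loc (insert i W)) (m : ℕ) (W : Finset ℕ) :
    clusterTerm S r L A m W ∈ Loc W := by
  induction m generalizing W with
  | zero =>
    rw [clusterTerm]
    split_ifs with h
    · exact h ▸ hA
    · exact zero_mem _
  | succ m ih =>
    rw [clusterTerm]
    refine sum_mem fun i hi => sum_mem fun W' _ => ?_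
    split_ifs with h
    · exact h ▸ hL W' _ (ih W') i hi
    · exact zero_mem _

/-- If `L i` annihilates what is localized away from `i`, only connected sets contribute. -/
theorem connectedFrom_of_clusterTerm_ne_zero (hA : A ∈ Loc {r})
    (hL : ∀ W, ∀ v ∈ Loc W, ∀ i ∈ S, L i v ∈ Loc (insert i W))
    (hL0 : ∀ W, ∀ v ∈ Loc W, ∀ i ∈ S, i ∉ W → (∀ u ∈ W, i ∉ nb u) → L i v = 0) {m : ℕ}
    {W : Finset ℕ} (h : clusterTerm S r L A m W ≠ 0) :
    ConnectedFrom nb r W ∧ W.card ≤ m + 1 := by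
  induction m generalizing W with
  | zero =>
    rw [clusterTerm] at h
    split_ifs at h with h1
    · exact h1 ▸ ⟨connectedFrom_singleton, by simp⟩
    · exact absurd rfl h
  | succ m ih =>
    rw [clusterTerm] at h
    obtain ⟨i, hi, hsum⟩ := Finset.exists_ne_zero_of_sum_ne_zero h
    obtain ⟨W', hW', hne⟩ := Finset.exists_ne_zero_of_sum_ne_zero hsum
    clear h hsum
    by_cases h1 : insert i W' = W
    · rw [if_pos h1] at hne
      subst h1
      have h2 : clusterTerm S r L A m W' ≠ 0 := fun h2 => hne (by rw [h2, map_zero])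
      obtain ⟨h3, h4⟩ := ih h2
      refine ⟨h3.insert ?_, (Finset.card_insert_le _ _).trans (by omega)⟩
      by_contra! h5
      exact hne (hL0 W' _ (clusterTerm_mem hA hL m W') i hi h5.1 h5.2)
    · exact absurd (if_neg h1) hne

/-- The number of terms grows by a factor `(deg + 1) * (m + 1)` with each commutator. This replaces
an estimate for the number of connected clusters. -/
theorem sum_norm_clusterTerm_le {deg : ℕ} (hA : A ∈ Loc {r})
    (hL : ∀ W, ∀ v ∈ Loc W, ∀ i ∈ S, L i v ∈ Loc (insert i W))
    (hL0 : ∀ W, ∀ v ∈ Loc W, ∀ i ∈ S, i ∉ W → (∀ u ∈ W, i ∉ nb u) → L i v = 0)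
    (hdeg : ∀ v, (nb v).length ≤ deg) (hnorm : ∀ i v, ‖L i v‖ ≤ 2 * ‖v‖) (m : ℕ) :
    ∑ W ∈ S.powerset, ‖clusterTerm S r L A m W‖ ≤ m.factorial * (2 * (deg + 1)) ^ m * ‖A‖ := by
  induction m with
  | zero =>
    simp only [clusterTerm, Nat.factorial_zero, Nat.cast_one, pow_zero, mul_one, one_mul]
    calc ∑ W ∈ S.powerset, ‖if W = {r} then A else 0‖
        = ∑ W ∈ S.powerset, if W = {r} then ‖A‖ else 0 :=
          Finset.sum_congr rfl fun W _ => by split_ifs <;> simp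
      _ ≤ ‖A‖ := by
          rw [Finset.sum_ite_eq']
          split_ifs <;> simp
  | succ m ih =>
    have h1 : ∀ W' ∈ S.powerset, ∑ i ∈ S, ‖L i (clusterTerm S r L A m W')‖ ≤
        ((deg + 1) * (m + 1)) * (2 * ‖clusterTerm S r L A m W'‖) := by
      intro W' _
      by_cases h0 : clusterTerm S r L A m W' = 0
      · simp [h0]
      have hcard := (connectedFrom_of_clusterTerm_ne_zero hA hL hL0 h0).2
      -- only the elements of `W'` and their neighbours contribute
      set N : Finset ℕ := W'.biUnion fun u => insert u (nb u).toFinset with hN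
      have hNcard : N.card ≤ (deg + 1) * (m + 1) := by
        calc N.card ≤ ∑ u ∈ W', (insert u (nb u).toFinset).card := Finset.card_biUnion_le
          _ ≤ ∑ u ∈ W', (deg + 1) := Finset.sum_le_sum fun u _ =>
              (Finset.card_insert_le _ _).trans
                (Nat.succ_le_succ ((List.toFinset_card_le _).trans (hdeg u)))
          _ = W'.card * (deg + 1) := by simp
          _ ≤ (deg + 1) * (m + 1) := by rw [mul_comm]; gcongr
      calc ∑ i ∈ S, ‖L i (clusterTerm S r L A m W')‖
          = ∑ i ∈ S ∩ N, ‖L i (clusterTerm S r L A m W')‖ := by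
            symm
            refine Finset.sum_subset Finset.inter_subset_left fun i hi hiN => ?_
            rw [hL0 W' _ (clusterTerm_mem hA hL m W') i hi, norm_zero]
            · intro h
              exact hiN (Finset.mem_inter.2 ⟨hi, Finset.mem_biUnion.2 ⟨i, h, by simp⟩⟩)
            · intro u hu h
              exact hiN (Finset.mem_inter.2 ⟨hi, Finset.mem_biUnion.2 ⟨u, hu, by simp [h]⟩⟩)
        _ ≤ ∑ i ∈ S ∩ N, 2 * ‖clusterTerm S r L A m W'‖ := Finset.sum_le_sum fun i _ => hnorm _ _
        _ = ((S ∩ N).card : ℝ) * (2 * ‖clusterTerm S r L A m W'‖) := by simp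
        _ ≤ ((deg + 1) * (m + 1)) * (2 * ‖clusterTerm S r L A m W'‖) := by
            gcongr
            exact_mod_cast (Finset.card_le_card Finset.inter_subset_right).trans hNcard
    calc ∑ W ∈ S.powerset, ‖clusterTerm S r L A (m + 1) W‖
        ≤ ∑ W ∈ S.powerset, ∑ i ∈ S, ∑ W' ∈ S.powerset,
            if insert i W' = W then ‖L i (clusterTerm S r L A m W')‖ else 0 := by
          refine Finset.sum_le_sum fun W _ => ?_
          rw [clusterTerm]
          refine (norm_sum_le _ _).trans (Finset.sum_le_sum fun i _ =>
            (norm_sum_le _ _).trans (Finset.sum_le_sum fun W' _ => ?_))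
          split_ifs <;> simp
      _ = ∑ W' ∈ S.powerset, ∑ i ∈ S, ‖L i (clusterTerm S r L A m W')‖ := by
          rw [Finset.sum_comm, Finset.sum_comm (s := S.powerset)]
          refine Finset.sum_congr rfl fun i hi => ?_
          rw [Finset.sum_comm]
          refine Finset.sum_congr rfl fun W' hW' => ?_
          rw [Finset.sum_ite_eq, if_pos (Finset.mem_powerset.2
            (Finset.insert_subset hi (Finset.mem_powerset.1 hW')))]
      _ ≤ ∑ W' ∈ S.powerset, ((deg + 1) * (m + 1)) * (2 * ‖clusterTerm S r L A m W'‖) :=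
          Finset.sum_le_sum h1
      _ = ((deg + 1) * (m + 1)) * 2 * ∑ W' ∈ S.powerset, ‖clusterTerm S r L A m W'‖ := by
          rw [Finset.mul_sum]
          exact Finset.sum_congr rfl fun _ _ => by ring
      _ ≤ ((deg + 1) * (m + 1)) * 2 * (m.factorial * (2 * (deg + 1)) ^ m * ‖A‖) := by gcongr
      _ = _ := by
          rw [Nat.factorial_succ]
          push_cast
          ring

end Cluster

/-! ### Operators on subsystems -/

section Lift

variable {κ μ ν : Type*} [Fintype κ] [Fintype μ] [Fintype ν] [DecidableEq ν]
  {d : ℕ}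

open Classical in
/-- The operator `B ⊗ 1`, for an operator `B` on a system `κ` that is part of a larger system `ν`
by means of a map `e`. -/
noncomputable def lift (e : κ → ν) (B : Matrix (κ → Fin d) (κ → Fin d) ℂ) :
    Matrix (ν → Fin d) (ν → Fin d) ℂ :=
  Matrix.of fun σ τ => if ∀ v, v ∉ Set.range e → σ v = τ v then B (σ ∘ e) (τ ∘ e) else 0

theorem embed_eq_lift {n : ℕ} (X : Finset (Fin n)) (B : LocalOperator d X) :
    embed X B = lift (Subtype.val : X → Fin n) B := by
  ext σ τ
  simp only [embed, lift, Matrix.of_apply, Subtype.range_coe_subtype, Set.mem_ofPred_eq]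
  congr

theorem lift_apply_of_agree {e : κ → ν} {B : Matrix (κ → Fin d) (κ → Fin d) ℂ} {σ τ : ν → Fin d}
    (h : ∀ v, v ∉ Set.range e → σ v = τ v) : lift e B σ τ = B (σ ∘ e) (τ ∘ e) := by
  simp only [lift, Matrix.of_apply]
  exact if_pos h

theorem lift_apply_of_not_agree {e : κ → ν} {B : Matrix (κ → Fin d) (κ → Fin d) ℂ}
    {σ τ : ν → Fin d} (h : ¬ ∀ v, v ∉ Set.range e → σ v = τ v) : lift e B σ τ = 0 := by
  simp only [lift, Matrix.of_apply]
  exact if_neg h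

theorem lift_add (e : κ → ν) (B C : Matrix (κ → Fin d) (κ → Fin d) ℂ) :
    lift e (B + C) = lift e B + lift e C := by
  ext σ τ
  by_cases h : ∀ v, v ∉ Set.range e → σ v = τ v
  · simp [lift_apply_of_agree h]
  · simp [lift_apply_of_not_agree h]

theorem lift_smul (e : κ → ν) (c : ℂ) (B : Matrix (κ → Fin d) (κ → Fin d) ℂ) :
    lift e (c • B) = c • lift e B := by
  ext σ τ
  by_cases h : ∀ v, v ∉ Set.range e → σ v = τ v
  · simp [lift_apply_of_agree h]
  · simp [lift_apply_of_not_agree h]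

theorem lift_sub (e : κ → ν) (B C : Matrix (κ → Fin d) (κ → Fin d) ℂ) :
    lift e (B - C) = lift e B - lift e C := by
  rw [sub_eq_add_neg, lift_add, ← neg_one_smul ℂ C, lift_smul, neg_one_smul, sub_eq_add_neg]

theorem lift_sum {ι : Type*} (e : κ → ν) (s : Finset ι)
    (B : ι → Matrix (κ → Fin d) (κ → Fin d) ℂ) : lift e (∑ i ∈ s, B i) = ∑ i ∈ s, lift e (B i) :=
  map_sum (AddMonoidHom.mk' (lift (d := d) e) (lift_add e)) B s

theorem sum_agree [DecidableEq κ] {e : κ → ν} (he : Function.Injective e) (σ : ν → Fin d)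
    (f : (κ → Fin d) → ℂ) (F : (ν → Fin d) → ℂ)
    (hF : ∀ ω, (∀ v, v ∉ Set.range e → σ v = ω v) → F ω = f (ω ∘ e))
    (hF0 : ∀ ω, (¬ ∀ v, v ∉ Set.range e → σ v = ω v) → F ω = 0) : ∑ ω, F ω = ∑ ω, f ω := by
  classical
  have hinj : Function.Injective fun ω : κ → Fin d => Function.extend e ω σ := by
    intro ω ω' h
    have := congrArg (· ∘ e) h
    simpa only [Function.extend_comp he] using this
  symm
  refine Finset.sum_of_injOn (fun ω => Function.extend e ω σ) hinj.injOn (by simp) ?_ ?_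
  · intro ω _ hω
    refine hF0 ω fun h => hω ⟨ω ∘ e, by simp, ?_⟩
    funext v
    by_cases hv : ∃ x, e x = v
    · obtain ⟨x, rfl⟩ := hv
      exact he.extend_apply _ _ _
    · exact (Function.extend_apply' _ _ _ hv).trans (h v hv)
  · intro ω _
    rw [hF _ fun v hv => (Function.extend_apply' _ _ _ hv).symm, Function.extend_comp he]

theorem lift_mul [DecidableEq κ] {e : κ → ν} (he : Function.Injective e)
    (B C : Matrix (κ → Fin d) (κ → Fin d) ℂ) : lift e (B * C) = lift e B * lift e C := by
  ext σ τ
  rw [Matrix.mul_apply]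
  by_cases h : ∀ v, v ∉ Set.range e → σ v = τ v
  · rw [lift_apply_of_agree h, Matrix.mul_apply]
    symm
    refine sum_agree he σ _ _ (fun ω hω => ?_) fun ω hω => ?_
    · rw [lift_apply_of_agree hω, lift_apply_of_agree fun v hv => (hω v hv).symm.trans (h v hv)]
    · rw [lift_apply_of_not_agree hω, zero_mul]
  · rw [lift_apply_of_not_agree h]
    symm
    refine Finset.sum_eq_zero fun ω _ => ?_
    by_cases h1 : ∀ v, v ∉ Set.range e → σ v = ω v
    · rw [lift_apply_of_not_agree (σ := ω), mul_zero]
      exact fun h2 => h fun v hv => (h1 v hv).trans (h2 v hv)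
    · rw [lift_apply_of_not_agree h1, zero_mul]

theorem lift_lift [DecidableEq κ] {e : κ → ν} (he : Function.Injective e) (f : μ → κ)
    (B : Matrix (μ → Fin d) (μ → Fin d) ℂ) : lift e (lift f B) = lift (e ∘ f) B := by
  ext σ τ
  by_cases h : ∀ v, v ∉ Set.range (e ∘ f) → σ v = τ v
  · rw [lift_apply_of_agree h, lift_apply_of_agree, lift_apply_of_agree]
    · rfl
    · intro x hx
      refine h _ ?_
      rintro ⟨y, hy⟩
      exact hx ⟨y, he hy⟩
    · intro v hv
      refine h _ ?_
      rintro ⟨y, rfl⟩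
      exact hv ⟨f y, rfl⟩
  · rw [lift_apply_of_not_agree h]
    by_cases h1 : ∀ v, v ∉ Set.range e → σ v = τ v
    · rw [lift_apply_of_agree h1, lift_apply_of_not_agree]
      intro h2
      refine h fun v hv => ?_
      by_cases h3 : v ∈ Set.range e
      · obtain ⟨x, rfl⟩ := h3
        refine h2 x ?_
        rintro ⟨y, rfl⟩
        exact hv ⟨y, rfl⟩
      · exact h1 v h3
    · rw [lift_apply_of_not_agree h1]

theorem lift_mul_lift_apply {e : κ → ν} {f : μ → ν} (he : Function.Injective e)
    (hd : Disjoint (Set.range e) (Set.range f)) (B : Matrix (κ → Fin d) (κ → Fin d) ℂ)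
    (C : Matrix (μ → Fin d) (μ → Fin d) ℂ) (σ τ : ν → Fin d)
    [Decidable (∀ v, v ∉ Set.range e → v ∉ Set.range f → σ v = τ v)] :
    (lift e B * lift f C) σ τ =
      if ∀ v, v ∉ Set.range e → v ∉ Set.range f → σ v = τ v then
        B (σ ∘ e) (τ ∘ e) * C (σ ∘ f) (τ ∘ f) else 0 := by
  rw [Matrix.mul_apply, Finset.sum_eq_single (Function.extend e (τ ∘ e) σ)]
  · have h1 : ∀ v, v ∉ Set.range e → σ v = Function.extend e (τ ∘ e) σ v := fun v hv =>
      (Function.extend_apply' _ _ _ hv).symm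
    have h2 : Function.extend e (τ ∘ e) σ ∘ f = σ ∘ f := by
      funext y
      exact (h1 _ fun h => Set.disjoint_left.1 hd h ⟨y, rfl⟩).symm
    rw [lift_apply_of_agree h1, Function.extend_comp he]
    split_ifs with h
    · rw [lift_apply_of_agree, h2]
      intro v hv
      by_cases h3 : v ∈ Set.range e
      · obtain ⟨x, rfl⟩ := h3
        exact he.extend_apply _ _ _
      · exact (h1 v h3).symm.trans (h v h3 hv)
    · rw [lift_apply_of_not_agree, mul_zero]
      exact fun h3 => h fun v hv hv' => (h1 v hv).trans (h3 v hv')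
  · intro ω _ hω
    by_cases h1 : ∀ v, v ∉ Set.range e → σ v = ω v
    · rw [lift_apply_of_not_agree (σ := ω), mul_zero]
      intro h2
      refine hω (funext fun v => ?_)
      by_cases h3 : v ∈ Set.range e
      · obtain ⟨x, rfl⟩ := h3
        rw [he.extend_apply]
        exact h2 _ fun h => Set.disjoint_left.1 hd ⟨x, rfl⟩ h
      · exact (h1 v h3).symm.trans (Function.extend_apply' _ _ _ h3).symm
    · rw [lift_apply_of_not_agree h1, zero_mul]
  · simp

/-- Operators on disjoint subsystems commute. -/
theorem commute_lift [DecidableEq κ] [DecidableEq μ] {e : κ → ν} {f : μ → ν}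
    (he : Function.Injective e) (hf : Function.Injective f)
    (hd : Disjoint (Set.range e) (Set.range f)) (B : Matrix (κ → Fin d) (κ → Fin d) ℂ)
    (C : Matrix (μ → Fin d) (μ → Fin d) ℂ) : Commute (lift e B) (lift f C) := by
  classical
  ext σ τ
  rw [lift_mul_lift_apply he hd, lift_mul_lift_apply hf hd.symm]
  have : (∀ v, v ∉ Set.range e → v ∉ Set.range f → σ v = τ v) ↔
      ∀ v, v ∉ Set.range f → v ∉ Set.range e → σ v = τ v := by tauto
  simp only [this, mul_comm]

theorem sum_comp_mul_prod [DecidableEq κ] {e : κ → ν} (he : Function.Injective e)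
    (f : (κ → Fin d) → ℂ) (g : ν → Fin d → ℂ)
    (hg : ∀ v, ∑ a, g v a = 1) [DecidablePred (· ∈ Set.range e)] :
    ∑ σ : ν → Fin d, f (σ ∘ e) * ∏ v, (if v ∈ Set.range e then 1 else g v (σ v)) =
      ∑ ω, f ω := by
  let E : (ν → Fin d) ≃ (κ → Fin d) × ({v // v ∉ Set.range e} → Fin d) :=
    (Equiv.piEquivPiSubtypeProd (· ∈ Set.range e) fun _ => Fin d).trans
      (Equiv.prodCongr ((Equiv.ofInjective e he).arrowCongr (Equiv.refl (Fin d))).symm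
        (Equiv.refl _))
  have h1 : ∀ σ : ν → Fin d, f (σ ∘ e) * ∏ v, (if v ∈ Set.range e then 1 else g v (σ v)) =
      f (E σ).1 * ∏ v : {v // v ∉ Set.range e}, g v ((E σ).2 v) := by
    intro σ
    congr 1
    rw [Finset.prod_ite, Finset.prod_const_one, one_mul,
      Finset.prod_subtype (p := fun v => v ∉ Set.range e) _ (by simp)]
    rfl
  rw [Fintype.sum_congr _ _ h1,
    E.sum_comp fun p => f p.1 * ∏ v : {v // v ∉ Set.range e}, g v (p.2 v), Fintype.sum_prod_type]
  refine Finset.sum_congr rfl fun ω _ => ?_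
  simp only
  rw [← Finset.mul_sum, ← Fintype.prod_sum fun (v : {v // v ∉ Set.range e}) a => g v a]
  simp [hg]

/-- The factors of a product state outside of a subsystem do not matter there. -/
theorem trace_lift_mul_prod [DecidableEq κ] {e : κ → ν} (he : Function.Injective e)
    (B : Matrix (κ → Fin d) (κ → Fin d) ℂ) (ρ : ν → Matrix (Fin d) (Fin d) ℂ)
    (hρ : ∀ v, (ρ v).trace = 1) :
    (lift e B * Matrix.of fun (σ τ : ν → Fin d) => ∏ v, ρ v (σ v) (τ v)).trace =
      (B * Matrix.of fun (σ τ : κ → Fin d) => ∏ x, ρ (e x) (σ x) (τ x)).trace := by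
  classical
  have h1 : ∀ σ, (lift e B * Matrix.of fun (σ τ : ν → Fin d) => ∏ v, ρ v (σ v) (τ v)) σ σ =
      (B * Matrix.of fun (σ τ : κ → Fin d) => ∏ x, ρ (e x) (σ x) (τ x)) (σ ∘ e) (σ ∘ e) *
        ∏ v, (if v ∈ Set.range e then 1 else ρ v (σ v) (σ v)) := by
    intro σ
    rw [Matrix.mul_apply, Matrix.mul_apply, Finset.sum_mul]
    refine sum_agree he σ _ _ (fun ω hω => ?_) fun ω hω => ?_
    · rw [lift_apply_of_agree hω, mul_assoc]
      congr 1
      have h2 : ∏ x, ρ (e x) (ω (e x)) (σ (e x)) =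
          ∏ v, if v ∈ Set.range e then ρ v (ω v) (σ v) else 1 := by
        rw [Finset.prod_ite, Finset.prod_const_one, mul_one]
        have : (Finset.univ.filter (· ∈ Set.range e)) = Finset.univ.image e := by
          ext v
          simp
        rw [this, Finset.prod_image he.injOn]
      simp only [Matrix.of_apply, Function.comp_apply]
      rw [h2, ← Finset.prod_mul_distrib]
      refine Finset.prod_congr rfl fun v _ => ?_
      split_ifs with h
      · rw [mul_one]
      · rw [one_mul, hω v h]
    · rw [lift_apply_of_not_agree hω, zero_mul]
  rw [Matrix.trace, Matrix.trace]
  simp only [Matrix.diag_apply, h1]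
  exact sum_comp_mul_prod he
    (fun ω => (B * Matrix.of fun (σ τ : κ → Fin d) => ∏ x, ρ (e x) (σ x) (τ x)) ω ω)
    (fun v a => ρ v a a) hρ

end Lift
end SpinSim

namespace SpinSim

/-! ### Conjugation by exponentials -/

section Conjugation

variable {𝔸 : Type*} [NormedRing 𝔸] [NormedAlgebra ℂ 𝔸]

/-- The commutator with `K`, as a linear map. -/
noncomputable def ad (K : 𝔸) : 𝔸 →ₗ[ℂ] 𝔸 := LinearMap.mulLeft ℂ K - LinearMap.mulRight ℂ K

theorem ad_apply (K X : 𝔸) : ad K X = K * X - X * K := rfl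

theorem ad_smul (c : ℂ) (K : 𝔸) : ad (c • K) = c • ad K := by
  ext X
  simp [ad_apply, smul_sub]

theorem norm_ad_apply_le (K X : 𝔸) : ‖ad K X‖ ≤ 2 * ‖K‖ * ‖X‖ := by
  rw [ad_apply]
  calc ‖K * X - X * K‖ ≤ ‖K‖ * ‖X‖ + ‖X‖ * ‖K‖ :=
        (norm_sub_le _ _).trans (add_le_add (norm_mul_le _ _) (norm_mul_le _ _))
    _ = _ := by ring

variable [CompleteSpace 𝔸]

/-- Left multiplication by `K` and right multiplication by `-K` commute, and their sum is `ad K`. -/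
theorem hasSum_exp_mul_mul_exp_neg (K X : 𝔸) :
    HasSum (fun m : ℕ => ((m.factorial : ℂ)⁻¹) • (ad K ^ m) X)
      (NormedSpace.exp K * X * NormedSpace.exp (-K)) := by
  let _ : NormedAlgebra ℚ (𝔸 →L[ℂ] 𝔸) := NormedAlgebra.restrictScalars ℚ ℂ _
  let Lm : 𝔸 →L[ℂ] 𝔸 := ContinuousLinearMap.mul ℂ 𝔸 K
  let Rm : 𝔸 →L[ℂ] 𝔸 := (ContinuousLinearMap.mul ℂ 𝔸).flip (-K)
  have hcomm : Commute Lm Rm := by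
    ext Y
    simp [Lm, Rm, mul_assoc]
  have hL : ∀ Y, NormedSpace.exp Lm Y = NormedSpace.exp K * Y := by
    intro Y
    have h1 := (NormedSpace.exp_series_hasSum_exp' (𝕂 := ℂ) Lm).mapL
      (ContinuousLinearMap.apply ℂ 𝔸 Y)
    have h2 := (NormedSpace.exp_series_hasSum_exp' (𝕂 := ℂ) K).mul_right Y
    have : ∀ m : ℕ, (Lm ^ m) Y = K ^ m * Y := by
      intro m
      induction m with
      | zero => simp
      | succ m ih => rw [pow_succ', mul_apply_eq_comp, ih, pow_succ', mul_assoc]; rfl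
    have h3 : HasSum (fun m : ℕ => (m.factorial : ℂ)⁻¹ • K ^ m * Y) (NormedSpace.exp Lm Y) := by
      simpa [this] using h1
    exact h3.unique h2
  have hR : ∀ Y, NormedSpace.exp Rm Y = Y * NormedSpace.exp (-K) := by
    intro Y
    have h1 := (NormedSpace.exp_series_hasSum_exp' (𝕂 := ℂ) Rm).mapL
      (ContinuousLinearMap.apply ℂ 𝔸 Y)
    have h2 := (NormedSpace.exp_series_hasSum_exp' (𝕂 := ℂ) (-K)).mul_left Y
    have : ∀ m : ℕ, (Rm ^ m) Y = Y * (-K) ^ m := by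
      intro m
      induction m with
      | zero => simp
      | succ m ih =>
        rw [pow_succ', mul_apply_eq_comp, ih, pow_succ (-K), ← mul_assoc]; rfl
    have h3 : HasSum (fun m : ℕ => Y * (m.factorial : ℂ)⁻¹ • (-K) ^ m) (NormedSpace.exp Rm Y) := by
      simpa [this] using h1
    exact h3.unique h2
  have h1 := (NormedSpace.exp_series_hasSum_exp' (𝕂 := ℂ) (Lm + Rm)).mapL
    (ContinuousLinearMap.apply ℂ 𝔸 X)
  rw [NormedSpace.exp_add_of_commute hcomm] at h1
  simp only [ContinuousLinearMap.apply_apply, mul_apply_eq_comp, hL, hR] at h1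
  rw [mul_assoc]
  have : ∀ m : ℕ, (ad K ^ m) X = ((Lm + Rm) ^ m) X := by
    intro m
    induction m with
    | zero => simp
    | succ m ih =>
      rw [pow_succ', Module.End.mul_apply, ih, pow_succ', mul_apply_eq_comp]
      simp [ad_apply, Lm, Rm, sub_eq_add_neg]
  simpa [this] using h1

theorem hasSum_exp_smul_mul_mul_exp_neg_smul (H X : 𝔸) (c : ℂ) :
    HasSum (fun m : ℕ => (c ^ m / (m.factorial : ℂ)) • (ad H ^ m) X)
      (NormedSpace.exp (c • H) * X * NormedSpace.exp ((-c) • H)) := by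
  have h := hasSum_exp_mul_mul_exp_neg (c • H) X
  rw [neg_smul]
  convert h using 2 with m
  rw [ad_smul, smul_pow, LinearMap.smul_apply, smul_smul, div_eq_inv_mul]

/-- In imaginary time an operator grows by at most a factor `2` on the strip where the series of
its nested commutators is dominated by `∑ m, 2⁻ᵐ`; evolution in real time is unitary. -/
theorem norm_exp_mul_mul_exp_le [StarRing 𝔸] [CStarRing 𝔸] [StarModule ℂ 𝔸] {H X : 𝔸}
    (hH : IsSelfAdjoint H) {c C : ℝ} (hc : 0 < c)
    (hX : ∀ m : ℕ, ‖(ad H ^ m) X‖ ≤ m.factorial * c ^ m * C) {z : ℂ} (hz : |z.im| ≤ 1 / (2 * c)) :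
    ‖NormedSpace.exp ((Complex.I * z) • H) * X * NormedSpace.exp ((-(Complex.I * z)) • H)‖
      ≤ 2 * C := by
  let _ : NormedAlgebra ℚ 𝔸 := NormedAlgebra.restrictScalars ℚ ℂ _
  have hsplit : ∀ w : ℂ, w.re = 0 → NormedSpace.exp (w • H) ∈ unitary 𝔸 := by
    intro w hw
    refine NormedSpace.exp_mem_unitary_of_mem_skewAdjoint ?_
    rw [skewAdjoint.mem_iff, star_smul, hH.star_eq, ← neg_smul]
    congr 1
    apply Complex.ext <;> simp [hw]
  set u : ℂ := Complex.I * z.re with hu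
  set y : ℂ := ((-z.im : ℝ) : ℂ) with hy
  have hIz : Complex.I * z = u + y := by
    rw [hu, hy]
    apply Complex.ext <;> simp
  have hcomm : ∀ v w : ℂ, Commute (v • H) (w • H) := fun v w =>
    ((Commute.refl H).smul_left v).smul_right w
  have h1 : NormedSpace.exp ((Complex.I * z) • H) =
      NormedSpace.exp (u • H) * NormedSpace.exp (y • H) := by
    rw [hIz, add_smul, NormedSpace.exp_add_of_commute (hcomm u y)]
  have h2 : NormedSpace.exp ((-(Complex.I * z)) • H) =
      NormedSpace.exp ((-y) • H) * NormedSpace.exp ((-u) • H) := by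
    rw [hIz, neg_add_rev, add_smul, NormedSpace.exp_add_of_commute (hcomm _ _)]
  have hinner : ‖NormedSpace.exp (y • H) * X * NormedSpace.exp ((-y) • H)‖ ≤ 2 * C := by
    have hs := hasSum_exp_smul_mul_mul_exp_neg_smul H X y
    have hg : HasSum (fun m : ℕ => C * (1 / 2 : ℝ) ^ m) (C * 2) :=
      hasSum_geometric_two.mul_left C
    rw [mul_comm 2 C]
    refine hs.norm_le_of_bounded hg fun m => ?_
    have hC : 0 ≤ C := by simpa using (norm_nonneg _).trans (hX 0)
    have hy' : ‖y‖ * c ≤ 1 / 2 := by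
      rw [hy, Complex.norm_real, Real.norm_eq_abs, abs_neg]
      calc |z.im| * c ≤ 1 / (2 * c) * c := by gcongr
        _ = 1 / 2 := by field_simp
    rw [norm_smul, norm_div, norm_pow, Complex.norm_natCast]
    have hm : (0 : ℝ) < m.factorial := by exact_mod_cast m.factorial_pos
    calc ‖y‖ ^ m / m.factorial * ‖(ad H ^ m) X‖
        ≤ ‖y‖ ^ m / m.factorial * (m.factorial * c ^ m * C) := by gcongr; exact hX m
      _ = C * (‖y‖ * c) ^ m := by rw [mul_pow]; field_simp
      _ ≤ C * (1 / 2) ^ m := by gcongr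
  rw [h1, h2]
  have h3 : NormedSpace.exp (u • H) * NormedSpace.exp (y • H) * X *
      (NormedSpace.exp ((-y) • H) * NormedSpace.exp ((-u) • H)) = NormedSpace.exp (u • H) *
        (NormedSpace.exp (y • H) * X * NormedSpace.exp ((-y) • H)) *
          NormedSpace.exp ((-u) • H) := by
    simp only [mul_assoc]
  rw [h3, CStarRing.norm_mul_mem_unitary _ (hsplit _ (by simp [hu])),
    CStarRing.norm_mem_unitary_mul _ (hsplit _ (by simp [hu]))]
  exact hinner

end Conjugation

/-! ### Truncation of a composed power series -/

theorem hasFPowerSeriesOnBall_of_hasSum {c : ℕ → ℂ} {g : ℂ → ℂ}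
    (h : ∀ u, HasSum (fun j => c j * u ^ j) (g u)) :
    HasFPowerSeriesOnBall g (FormalMultilinearSeries.ofScalars ℂ c) 0 ⊤ where
  r_le := by
    refine (FormalMultilinearSeries.radius_eq_top_of_summable_norm _ fun r => ?_).ge
    simp only [FormalMultilinearSeries.ofScalars_norm]
    have := (h (r : ℝ)).summable.norm
    simpa using this
  r_pos := by simp
  hasSum := by
    intro y _
    simpa [FormalMultilinearSeries.ofScalars_apply_eq, mul_comm] using h y

/-- Cauchy's estimate for the coefficients of an everywhere convergent power series. -/
theorem norm_coeff_le_of_hasSum {c : ℕ → ℂ} {g : ℂ → ℂ}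
    (h : ∀ u, HasSum (fun j => c j * u ^ j) (g u)) {R C : ℝ} (hR : 0 < R)
    (hC : ∀ u, ‖u‖ = R → ‖g u‖ ≤ C) (j : ℕ) : ‖c j‖ ≤ C / R ^ j := by
  have hp := hasFPowerSeriesOnBall_of_hasSum h
  have hd : Differentiable ℂ g := fun u => (hp.differentiableOn.differentiableAt (by simp))
  have h1 := Complex.norm_iteratedDeriv_le_of_forall_mem_sphere_norm_le (c := 0) j hR
    hd.diffContOnCl fun z hz => hC z (by simpa using hz)
  have h2 := hp.factorial_smul 1 j
  rw [← iteratedDeriv_eq_iteratedFDeriv] at h2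
  rw [← h2, nsmul_eq_mul, norm_mul, Complex.norm_natCast, mul_div_assoc] at h1
  have h3 : ‖c j‖ = ‖(FormalMultilinearSeries.ofScalars ℂ c j) fun _ => (1 : ℂ)‖ := by
    simp
  rw [h3]
  exact le_of_mul_le_mul_left h1 (by exact_mod_cast j.factorial_pos)

theorem coeff_pow_nonneg {φ : Polynomial ℝ} (hφ : ∀ j, 0 ≤ φ.coeff j) (m j : ℕ) :
    0 ≤ (φ ^ m).coeff j := by
  induction m generalizing j with
  | zero =>
    rw [pow_zero, Polynomial.coeff_one]
    split_ifs <;> simp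
  | succ m ih =>
    rw [pow_succ, Polynomial.coeff_mul]
    exact Finset.sum_nonneg fun p _ => mul_nonneg (ih _) (hφ _)

theorem coeff_pow_eq_zero_of_lt {φ : Polynomial ℝ} (h0 : φ.coeff 0 = 0) {m j : ℕ} (h : j < m) :
    (φ ^ m).coeff j = 0 := by
  obtain ⟨ψ, rfl⟩ := Polynomial.X_dvd_iff.2 h0
  rw [mul_pow, mul_comm, Polynomial.coeff_mul_X_pow', if_neg (by omega)]

/-- If `f` is entire and bounded by `C` on the image of the circle of radius `R > 1` under a
polynomial `φ` with `φ 0 = 0`, then `f (φ 1)` can be computed from the first Taylor coefficients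
of `f`: they determine those of `f ∘ φ`, which decay like `R⁻ʲ`. -/
theorem norm_sub_truncation_le {a : ℕ → ℂ} {f : ℂ → ℂ}
    (hf : ∀ z, HasSum (fun m => a m * z ^ m) (f z)) {φ : Polynomial ℝ} (h0 : φ.coeff 0 = 0)
    (hφ : ∀ j, 0 ≤ φ.coeff j) {R C : ℝ} (hR : 1 < R)
    (hC : ∀ u : ℂ, ‖u‖ = R → ‖f (Polynomial.aeval u φ)‖ ≤ C) (M : ℕ) :
    ‖f ((φ.eval 1 : ℝ) : ℂ) - ∑ m ∈ Finset.range (M + 1), a m *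
        ∑ j ∈ Finset.range (M + 1), (((φ ^ m).coeff j : ℝ) : ℂ)‖ ≤
      C * (R⁻¹ ^ (M + 1) * (1 - R⁻¹)⁻¹) := by
  have hsumj : ∀ (m : ℕ) (u : ℂ), HasSum (fun j => (((φ ^ m).coeff j : ℝ) : ℂ) * u ^ j)
      (Polynomial.aeval u φ ^ m) := by
    intro m u
    rw [← map_pow, Polynomial.aeval_eq_sum_range]
    have : ∀ j ∉ Finset.range ((φ ^ m).natDegree + 1),
        (((φ ^ m).coeff j : ℝ) : ℂ) * u ^ j = 0 := by
      intro j hj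
      rw [Polynomial.coeff_eq_zero_of_natDegree_lt (by simpa [Nat.lt_succ_iff] using hj)]
      simp
    have h1 := hasSum_sum_of_ne_finset_zero (L := .unconditional ℕ) this
    simpa [Algebra.smul_def] using h1
  -- the coefficients of `φ` are nonnegative, so the series with absolute values is the absolutely
  -- convergent series of `f` at the real point `φ ‖u‖`
  have hsummable : ∀ u : ℂ, Summable fun p : ℕ × ℕ =>
      a p.1 * ((((φ ^ p.1).coeff p.2 : ℝ) : ℂ) * u ^ p.2) := by
    intro u
    refine Summable.of_norm ?_
    have hnorm : ∀ p : ℕ × ℕ, ‖a p.1 * ((((φ ^ p.1).coeff p.2 : ℝ) : ℂ) * u ^ p.2)‖ =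
        ‖a p.1‖ * ‖(((φ ^ p.1).coeff p.2 : ℝ) : ℂ) * ((‖u‖ : ℝ) : ℂ) ^ p.2‖ := by
      intro p
      simp
    simp only [hnorm]
    have hnonneg : (0 : ℕ × ℕ → ℝ) ≤ fun p =>
        ‖a p.1‖ * ‖(((φ ^ p.1).coeff p.2 : ℝ) : ℂ) * ((‖u‖ : ℝ) : ℂ) ^ p.2‖ :=
      fun p => mul_nonneg (norm_nonneg _) (norm_nonneg _)
    have hrow : ∀ m, Summable fun j =>
        ‖a m‖ * ‖(((φ ^ m).coeff j : ℝ) : ℂ) * ((‖u‖ : ℝ) : ℂ) ^ j‖ := fun m =>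
      Summable.mul_left ‖a m‖ (hsumj m ((‖u‖ : ℝ) : ℂ)).summable.norm
    refine (summable_prod_of_nonneg hnonneg).2 ⟨hrow, ?_⟩
    have h1 : ∀ m, ∑' j, ‖a m‖ * ‖(((φ ^ m).coeff j : ℝ) : ℂ) * ((‖u‖ : ℝ) : ℂ) ^ j‖ =
        ‖a m * Polynomial.aeval ((‖u‖ : ℝ) : ℂ) φ ^ m‖ := by
      intro m
      rw [tsum_mul_left, norm_mul]
      congr 1
      have h2 := hsumj m ((‖u‖ : ℝ) : ℂ)
      have h3 : ∀ j, (((φ ^ m).coeff j : ℝ) : ℂ) * ((‖u‖ : ℝ) : ℂ) ^ j =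
          ((‖(((φ ^ m).coeff j : ℝ) : ℂ) * ((‖u‖ : ℝ) : ℂ) ^ j‖ : ℝ) : ℂ) := by
        intro j
        rw [norm_mul, norm_pow, Complex.norm_real, Complex.norm_real, norm_norm,
          Real.norm_of_nonneg (coeff_pow_nonneg hφ m j)]
        push_cast
        rfl
      have h4 := h2.tsum_eq
      rw [tsum_congr h3, ← Complex.ofReal_tsum] at h4
      rw [← h4, Complex.norm_real, Real.norm_of_nonneg (tsum_nonneg fun j => norm_nonneg _)]
    simp only [h1]
    exact (hf _).summable.norm
  -- the Taylor coefficients of `f ∘ φ`; only `m ≤ j` contributes because `φ 0 = 0`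
  let c : ℕ → ℂ := fun j => ∑ m ∈ Finset.range (j + 1), a m * (((φ ^ m).coeff j : ℝ) : ℂ)
  have hg : ∀ u : ℂ, HasSum (fun j => c j * u ^ j) (f (Polynomial.aeval u φ)) := by
    intro u
    have h1 : HasSum (fun p : ℕ × ℕ => a p.1 * ((((φ ^ p.1).coeff p.2 : ℝ) : ℂ) * u ^ p.2))
        (f (Polynomial.aeval u φ)) := by
      have h2 := (hsummable u).hasSum.prod_fiberwise fun m => (hsumj m u).mul_left (a m)
      rw [(hf _).unique h2]
      exact (hsummable u).hasSum
    have h3 := (Equiv.prodComm ℕ ℕ).hasSum_iff.2 h1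
    refine h3.prod_fiberwise fun j => ?_
    have h4 : ∀ m ∉ Finset.range (j + 1),
        a m * ((((φ ^ m).coeff j : ℝ) : ℂ) * u ^ j) = 0 := by
      intro m hm
      rw [coeff_pow_eq_zero_of_lt h0 (by simpa using hm)]
      simp
    have h5 : c j * u ^ j =
        ∑ m ∈ Finset.range (j + 1), a m * ((((φ ^ m).coeff j : ℝ) : ℂ) * u ^ j) := by
      rw [Finset.sum_mul]
      exact Finset.sum_congr rfl fun m _ => by ring
    rw [h5]
    exact hasSum_sum_of_ne_finset_zero (L := .unconditional ℕ) h4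
  have hc := norm_coeff_le_of_hasSum hg (by linarith : 0 < R) hC
  have htrunc : ∑ m ∈ Finset.range (M + 1), a m *
        ∑ j ∈ Finset.range (M + 1), (((φ ^ m).coeff j : ℝ) : ℂ) =
      ∑ j ∈ Finset.range (M + 1), c j := by
    simp_rw [Finset.mul_sum]
    rw [Finset.sum_comm]
    refine Finset.sum_congr rfl fun j hj => ?_
    have hj := Finset.mem_range.1 hj
    refine (Finset.sum_subset (Finset.range_subset_range.2 (by omega)) fun m _ hm => ?_).symm
    rw [coeff_pow_eq_zero_of_lt h0 (by simpa using hm)]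
    simp
  have h1 := hg 1
  simp only [one_pow, mul_one] at h1
  have haeval : Polynomial.aeval (1 : ℂ) φ = ((φ.eval 1 : ℝ) : ℂ) := by
    have := Polynomial.aeval_algebraMap_apply ℂ (1 : ℝ) φ
    simpa using this
  rw [haeval] at h1
  have htail := (hasSum_nat_add_iff' (M + 1)).2 h1
  rw [htrunc]
  have hgeom : HasSum (fun j : ℕ => C * (R⁻¹ ^ (M + 1) * R⁻¹ ^ j))
      (C * (R⁻¹ ^ (M + 1) * (1 - R⁻¹)⁻¹)) :=
    ((hasSum_geometric_of_lt_one (by positivity) (inv_lt_one_of_one_lt₀ hR)).mul_left _).mul_left _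
  refine htail.norm_le_of_bounded hgeom fun j => (hc _).trans (le_of_eq ?_)
  rw [div_eq_mul_inv, ← inv_pow, add_comm j, pow_add]

end SpinSim

namespace SpinSim

/-! ### A polynomial that maps a disk into a strip -/

/-- The first `M` terms of the power series of `-log (1 - w X)`. -/
noncomputable def logPoly (w : ℝ) (M : ℕ) : Polynomial ℝ :=
  ∑ j ∈ Finset.range M, Polynomial.monomial (j + 1) (w ^ (j + 1) / (j + 1))

theorem coeff_logPoly (w : ℝ) (M j : ℕ) : (logPoly w M).coeff j =
    if 1 ≤ j ∧ j ≤ M then w ^ j / j else 0 := by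
  rw [logPoly, Polynomial.finsetSum_coeff]
  simp only [Polynomial.coeff_monomial]
  cases j with
  | zero => simp
  | succ j =>
    simp only [add_left_inj, Finset.sum_ite_eq', Finset.mem_range]
    simp

theorem aeval_logPoly (w : ℝ) (M : ℕ) (u : ℂ) :
    Polynomial.aeval u (logPoly w M) = -Complex.logTaylor (M + 1) (-(w * u)) := by
  rw [logPoly, map_sum, Complex.logTaylor, Finset.sum_range_succ', neg_add,
    ← Finset.sum_neg_distrib]
  simp only [Polynomial.aeval_monomial]
  simp only [pow_zero, mul_one, Nat.cast_zero, div_zero, neg_zero, add_zero]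
  refine Finset.sum_congr rfl fun j _ => ?_
  have h : ((-1 : ℂ)) ^ (j + 1 + 1) * (-(w * u)) ^ (j + 1) = -((w * u) ^ (j + 1)) := by
    rw [neg_pow (w * u : ℂ), ← mul_assoc, ← pow_add]
    have : (-1 : ℂ) ^ (j + 1 + 1 + (j + 1)) = -1 := Odd.neg_one_pow ⟨j + 1, by ring⟩
    rw [this]
    ring
  rw [h, neg_div, neg_neg, mul_pow]
  simp only [Complex.coe_algebraMap]
  push_cast
  ring

theorem one_sub_inv_pow_le (K a : ℕ) (hK : 1 ≤ K) :
    (1 - 1 / (K : ℝ)) ^ (K * a) ≤ (1 / 2) ^ a := by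
  have hK' : (1 : ℝ) ≤ K := by exact_mod_cast hK
  have h0 : 0 ≤ 1 - 1 / (K : ℝ) := by
    rw [sub_nonneg, div_le_one (by linarith)]
    exact hK'
  rw [pow_mul]
  refine pow_le_pow_left₀ (pow_nonneg h0 _) ?_ a
  have h1 : 1 - 1 / (K : ℝ) ≤ Real.exp (-(1 / (K : ℝ))) := by
    have := Real.add_one_le_exp (-(1 / (K : ℝ)))
    linarith
  calc (1 - 1 / (K : ℝ)) ^ K ≤ Real.exp (-(1 / (K : ℝ))) ^ K := pow_le_pow_left₀ h0 h1 K
    _ = Real.exp (-1) := by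
        rw [← Real.exp_nat_mul]
        congr 1
        field_simp
    _ ≤ 1 / 2 := by
        rw [Real.exp_neg, one_div]
        exact inv_anti₀ (by norm_num) (by linarith [Real.add_one_le_exp 1])

/-- The rescaled logarithm takes the value `t` at `1`, and it maps a disk around `0` that contains
`1` into the strip `|Im z| ≤ b`. Before rescaling the imaginary part is about `π / 2` at most, and
the scale is about `t / (s log 2)` because `-log (1 - w) = s log 2` for `w = 1 - 2⁻ˢ`; the constant
`5 / 2` exceeds `π / (2 log 2)`. -/
theorem exists_logPoly_scale {t b : ℝ} (ht : 0 < t) {s l : ℕ} (hb : 0 < b)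
    (hs : 5 / 2 * (t / b) + 1 ≤ s) :
    let K := 2 ^ (s + 1)
    let M := K * (l + s + 3)
    let w : ℝ := 1 - (1 / 2) ^ s
    let P := logPoly w M
    0 < P.eval 1 ∧ ∃ R : ℝ, 1 < R ∧
      R⁻¹ ^ (M + 1) * (1 - R⁻¹)⁻¹ ≤ (1 / 2) ^ (l + 2) ∧
      ∀ u : ℂ, ‖u‖ = R →
        |(Polynomial.aeval u (Polynomial.C (t / P.eval 1) * P)).im| ≤ b := by
  intro K M w P
  have htb : 0 < t / b := by positivity
  have hs2 : 2 ≤ s := by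
    have : (1 : ℝ) < s := by linarith
    exact_mod_cast this
  -- `w = 1 - 2 x`, and the disk of radius `R = (1 - x) / w` is scaled by `w` to radius `1 - x`
  set x : ℝ := 1 / (K : ℝ) with hx
  have hK : (K : ℝ) = 2 ^ (s + 1) := by simp [K]
  have hK8 : (8 : ℝ) ≤ K := by
    rw [hK]
    calc (8 : ℝ) = 2 ^ 3 := by norm_num
      _ ≤ 2 ^ (s + 1) := pow_le_pow_right₀ (by norm_num) (by omega)
  have hx0 : 0 < x := by positivity
  have hx8 : x ≤ 1 / 8 := one_div_le_one_div_of_le (by norm_num) hK8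
  have hw : w = 1 - 2 * x := by
    simp only [w, hx, hK, pow_succ, one_div_pow]
    field_simp
  have hw0 : 0 < w := by rw [hw]; linarith
  have hpow : (1 - x) ^ M ≤ (1 / 2) ^ (l + s + 3) :=
    one_sub_inv_pow_le K (l + s + 3) Nat.one_le_two_pow
  have hMK : (K : ℝ) ≤ M := by
    have : K ≤ M := Nat.le_mul_of_pos_right _ (by omega)
    exact_mod_cast this
  -- the error of the truncated logarithm on the disk of radius `1 - x`
  have herr : ∀ z : ℂ, ‖z‖ ≤ 1 - x →
      ‖Complex.log (1 - z) - Complex.logTaylor (M + 1) (-z)‖ ≤ 1 / 32 := by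
    intro z hz
    have h1 := Complex.norm_log_sub_logTaylor_le M (z := -z) (by rw [norm_neg]; linarith)
    rw [norm_neg, ← sub_eq_add_neg] at h1
    refine h1.trans ?_
    have h2 : (1 - ‖z‖)⁻¹ ≤ K := by
      rw [inv_le_comm₀ (by linarith) (by linarith), ← one_div]
      linarith
    calc ‖z‖ ^ (M + 1) * (1 - ‖z‖)⁻¹ / (M + 1) ≤ (1 - x) ^ (M + 1) * K / (M + 1) := by
          gcongr
          · exact inv_nonneg.2 (by linarith)
          · exact pow_nonneg (by linarith) _
      _ ≤ (1 - x) ^ (M + 1) * 1 := by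
          rw [mul_div_assoc]
          refine mul_le_mul_of_nonneg_left ?_ (pow_nonneg (by linarith) _)
          rw [div_le_one (by positivity)]
          linarith
      _ ≤ (1 - x) ^ M := by
          rw [mul_one]
          exact pow_le_pow_of_le_one (by linarith) (by linarith) (Nat.le_succ M)
      _ ≤ (1 / 2) ^ (l + s + 3) := hpow
      _ ≤ (1 / 2) ^ 5 := pow_le_pow_of_le_one (by norm_num) (by norm_num) (by omega)
      _ = 1 / 32 := by norm_num
  have hP1 : Polynomial.aeval (1 : ℂ) P = ((P.eval 1 : ℝ) : ℂ) := by
    have := Polynomial.aeval_algebraMap_apply ℂ (1 : ℝ) P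
    simpa using this
  have hPlow : s * Real.log 2 - 1 / 32 ≤ P.eval 1 := by
    have h1 := aeval_logPoly w M 1
    rw [mul_one, hP1] at h1
    have h2 := herr (w : ℂ) (by rw [Complex.norm_real, Real.norm_of_nonneg hw0.le, hw]; linarith)
    have h3 : Complex.log (1 - w) = ((-(s * Real.log 2) : ℝ) : ℂ) := by
      have : (1 : ℂ) - w = (((1 / 2 : ℝ) ^ s : ℝ) : ℂ) := by
        simp [w]
      rw [this, ← Complex.ofReal_log (by positivity), Real.log_pow, one_div, Real.log_inv]
      push_cast
      ring
    rw [← neg_eq_iff_eq_neg] at h1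
    rw [h3, ← h1, sub_neg_eq_add, ← Complex.ofReal_add, Complex.norm_real] at h2
    have := (abs_le.1 h2).1
    linarith
  have hlog : 0.6931 < Real.log 2 := by linarith [Real.log_two_gt_d9]
  have hPt : 8 / 5 * (t / b) + 1 / 16 < P.eval 1 * (499 / 500) := by
    have : (5 / 2 * (t / b) + 1) * 0.6931 ≤ s * Real.log 2 := by gcongr
    linarith
  have hP0 : 0 < P.eval 1 := by linarith
  refine ⟨hP0, (1 - x) / w, ?_, ?_, ?_⟩
  · rw [one_lt_div hw0, hw]
    linarith
  · rw [inv_div]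
    have h1 : w / (1 - x) ≤ 1 - x := by
      rw [div_le_iff₀ (by linarith), hw]
      nlinarith
    have h2 : (1 - w / (1 - x))⁻¹ ≤ K := by
      rw [inv_le_comm₀ (by linarith) (by linarith), ← one_div]
      linarith
    calc (w / (1 - x)) ^ (M + 1) * (1 - w / (1 - x))⁻¹ ≤ (1 - x) ^ (M + 1) * K := by
          gcongr
          · exact inv_nonneg.2 (by linarith)
          · exact pow_nonneg (by linarith) _
          · exact div_nonneg hw0.le (by linarith)
      _ ≤ (1 - x) ^ M * K := by
          gcongr 1
          exact pow_le_pow_of_le_one (by linarith) (by linarith) (Nat.le_succ M)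
      _ ≤ (1 / 2) ^ (l + s + 3) * 2 ^ (s + 1) := by rw [← hK]; gcongr
      _ = (1 / 2) ^ (l + 2) := by
          rw [show l + s + 3 = (l + 2) + (s + 1) by ring, pow_add _ (l + 2), mul_assoc, ← mul_pow]
          norm_num
  · intro u hu
    have hwu : ‖(w : ℂ) * u‖ ≤ 1 - x := by
      rw [norm_mul, hu, Complex.norm_real, Real.norm_of_nonneg hw0.le]
      exact (mul_div_cancel₀ _ hw0.ne').le
    -- `1 - w u` has positive real part, so its argument is at most `π / 2`
    have h1 : |(Polynomial.aeval u P).im| ≤ Real.pi / 2 + 1 / 32 := by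
      have h2 := (Complex.abs_im_le_norm _).trans (herr _ hwu)
      rw [Complex.sub_im, Complex.log_im] at h2
      have h3 : |(1 - (w : ℂ) * u).arg| ≤ Real.pi / 2 := by
        rw [Complex.abs_arg_le_pi_div_two_iff, Complex.sub_re, Complex.one_re]
        have := (Complex.re_le_norm ((w : ℂ) * u)).trans hwu
        linarith
      rw [aeval_logPoly, Complex.neg_im, abs_neg]
      rw [abs_le] at h2 h3 ⊢
      constructor <;> linarith [h2.1, h2.2, h3.1, h3.2]
    rw [map_mul, Polynomial.aeval_C, Complex.coe_algebraMap, Complex.im_ofReal_mul, abs_mul,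
      abs_of_pos (by positivity)]
    have hpi := Real.pi_lt_d2
    calc t / P.eval 1 * |(Polynomial.aeval u P).im|
        ≤ t / P.eval 1 * (Real.pi / 2 + 1 / 32) := by gcongr
      _ ≤ b := by
        have h5 : t / b * (Real.pi / 2 + 1 / 32) ≤ P.eval 1 := by nlinarith
        rw [div_mul_eq_mul_div, div_le_iff₀ hP0]
        rw [div_mul_eq_mul_div, div_le_iff₀ hb] at h5
        linarith

end SpinSim

namespace SpinSim

/-! ### Expectations of local operators -/

open scoped Matrix.Norms.L2Operator ComplexOrder

theorem opNorm_eq_norm {m : Type} [Fintype m] [DecidableEq m] (M : Matrix m m ℂ) :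
    opNorm M = ‖M‖ := (Matrix.cstar_norm_def M).symm

/-- For `P = Cᴴ * C` the trace of `B * P` is a sum of quadratic forms of `B`, one for each row
of `C`. -/
theorem norm_trace_mul_le {m : Type} [Fintype m] [DecidableEq m] (B C : Matrix m m ℂ) :
    ‖(B * (C.conjTranspose * C)).trace‖ ≤ ‖B‖ * ‖(C.conjTranspose * C).trace‖ := by
  let v : m → EuclideanSpace ℂ m := fun i => WithLp.toLp 2 fun j => star (C i j)
  have h1 : (B * (C.conjTranspose * C)).trace =
      ∑ i, inner ℂ (v i) (WithLp.toLp 2 (B.mulVec (v i).ofLp)) := by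
    rw [← mul_assoc, Matrix.trace_mul_comm, ← mul_assoc]
    rw [Matrix.trace]
    refine Finset.sum_congr rfl fun i _ => ?_
    rw [Matrix.diag_apply, mul_assoc, Matrix.mul_apply, PiLp.inner_apply]
    refine Finset.sum_congr rfl fun j _ => ?_
    simp [v, Matrix.mul_apply, Matrix.mulVec, dotProduct, mul_comm]
  have h2 : ‖(C.conjTranspose * C).trace‖ = ∑ i, ‖v i‖ ^ 2 := by
    have : (C.conjTranspose * C).trace = ((∑ i, ‖v i‖ ^ 2 : ℝ) : ℂ) := by
      rw [Matrix.trace_mul_comm, Matrix.trace]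
      push_cast
      refine Finset.sum_congr rfl fun i _ => ?_
      rw [Matrix.diag_apply, Matrix.mul_apply, ← Complex.ofReal_pow, EuclideanSpace.norm_sq_eq]
      push_cast
      refine Finset.sum_congr rfl fun j _ => ?_
      simp [v, Complex.mul_conj']
    rw [this, Complex.norm_real, Real.norm_of_nonneg (by positivity)]
  rw [h1, h2, Finset.mul_sum]
  refine (norm_sum_le _ _).trans (Finset.sum_le_sum fun i _ => ?_)
  calc ‖inner ℂ (v i) (WithLp.toLp 2 (B.mulVec (v i).ofLp))‖
      ≤ ‖v i‖ * ‖WithLp.toLp 2 (B.mulVec (v i).ofLp)‖ := norm_inner_le_norm _ _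
    _ ≤ ‖v i‖ * (‖B‖ * ‖v i‖) := by
        gcongr
        exact Matrix.l2_opNorm_mulVec B (v i)
    _ = _ := by ring

theorem productOperator_mul {n d : ℕ} (ρ ρ' : Fin n → Matrix (Fin d) (Fin d) ℂ) :
    productOperator ρ * productOperator ρ' = productOperator fun v => ρ v * ρ' v := by
  ext σ τ
  simp only [Matrix.mul_apply, productOperator, Matrix.of_apply, ← Finset.prod_mul_distrib]
  rw [← Fintype.prod_sum fun v a => ρ v (σ v) a * ρ' v a (τ v)]

theorem trace_productOperator {n d : ℕ} (ρ : Fin n → Matrix (Fin d) (Fin d) ℂ) :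
    (productOperator ρ).trace = ∏ v, (ρ v).trace := by
  simp only [Matrix.trace, Matrix.diag_apply, productOperator, Matrix.of_apply]
  rw [← Fintype.prod_sum fun v a => ρ v a a]

/-- Expectations in a product of density matrices are bounded by the operator norm. -/
theorem norm_trace_mul_productOperator_le {n d : ℕ} {ρ : Fin n → Matrix (Fin d) (Fin d) ℂ}
    (hρ : ∀ v, IsDensity (ρ v)) (B : Operator n d) :
    ‖(B * productOperator ρ).trace‖ ≤ ‖B‖ := by
  have h : ∀ v, ∃ C : Matrix (Fin d) (Fin d) ℂ, ρ v = C.conjTranspose * C := fun v => by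
    open scoped MatrixOrder in
    obtain ⟨C, hC⟩ := CStarAlgebra.nonneg_iff_eq_star_mul_self.1 (hρ v).1.nonneg
    exact ⟨C, hC⟩
  choose C hC using h
  have h1 : productOperator ρ = (productOperator C).conjTranspose * productOperator C := by
    have : (productOperator C).conjTranspose = productOperator fun v => (C v).conjTranspose := by
      ext σ τ
      simp [productOperator]
    rw [this, productOperator_mul]
    exact congrArg _ (funext hC)
  have h2 := norm_trace_mul_le B (productOperator C)
  rw [← h1, trace_productOperator, Finset.prod_congr rfl fun v _ => (hρ v).2] at h2
  simpa using h2

namespace LocalHamiltonian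

variable {n d : ℕ} (H : LocalHamiltonian n d)

/-- The `i`-th subsystem, and the empty set for numbers out of range. -/
def subAt (i : ℕ) : Finset (Fin n) := if h : i < H.numTerms then H.sub ⟨i, h⟩ else ∅

/-- The `i`-th term of the Hamiltonian, and zero for numbers out of range. -/
noncomputable def termAt (i : ℕ) : Operator n d :=
  if h : i < H.numTerms then (H.coeff ⟨i, h⟩ : ℂ) • embed (H.sub ⟨i, h⟩) (H.term ⟨i, h⟩) else 0

/-- The neighbours of the `i`-th subsystem in increasing order. -/
def nbAt (i : ℕ) : List ℕ := if h : i < H.numTerms then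
  ((H.interactionGraph.neighborFinset ⟨i, h⟩).sort (· ≤ ·)).map Fin.val else []

theorem toOperator_eq_sum_range : H.toOperator = ∑ i ∈ Finset.range H.numTerms, H.termAt i := by
  rw [toOperator, Finset.sum_range]
  refine Finset.sum_congr rfl fun j _ => ?_
  simp [termAt]

theorem mem_nbAt {i v : ℕ} : v ∈ H.nbAt i ↔ ∃ (hi : i < H.numTerms) (hv : v < H.numTerms),
    H.interactionGraph.Adj ⟨i, hi⟩ ⟨v, hv⟩ := by
  unfold nbAt
  split_ifs with h
  · simp only [List.mem_map, Finset.mem_sort, SimpleGraph.mem_neighborFinset]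
    constructor
    · rintro ⟨w, hw, rfl⟩
      exact ⟨h, w.2, hw⟩
    · rintro ⟨_, hv, hw⟩
      exact ⟨_, hw, rfl⟩
  · simp [h]

theorem length_nbAt_le {deg : ℕ} (hdeg : H.interactionGraph.maxDegree ≤ deg) (i : ℕ) :
    (H.nbAt i).length ≤ deg := by
  unfold nbAt
  split_ifs with h
  · rw [List.length_map, Finset.length_sort, SimpleGraph.card_neighborFinset_eq_degree]
    exact (H.interactionGraph.degree_le_maxDegree _).trans hdeg
  · simp

theorem norm_termAt_le (i : ℕ) : ‖H.termAt i‖ ≤ 1 := by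
  unfold termAt
  split_ifs with h
  · rw [norm_smul, ← opNorm_eq_norm, H.opNorm_term, mul_one, Complex.norm_real]
    exact H.abs_coeff_le_one _
  · simp

theorem isHermitian_embed (X : Finset (Fin n)) {B : LocalOperator d X} (hB : B.IsHermitian) :
    (embed X B).IsHermitian := by
  ext σ τ
  rw [Matrix.conjTranspose_apply]
  simp only [embed, Matrix.of_apply]
  have h : (∀ v, v ∉ X → τ v = σ v) ↔ ∀ v, v ∉ X → σ v = τ v :=
    forall₂_congr fun v _ => eq_comm
  simp only [h]
  split_ifs
  · exact hB.apply _ _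
  · simp

theorem isSelfAdjoint_toOperator : IsSelfAdjoint H.toOperator := by
  rw [toOperator]
  refine isSelfAdjoint_sum _ fun j _ => ?_
  refine IsSelfAdjoint.smul ?_ ?_
  · simp [isSelfAdjoint_iff]
  · exact isHermitian_embed _ (H.term_isHermitian j)

/-- The operators that commute with everything outside of the subsystems in `W`. -/
def localized (W : Finset ℕ) : Submodule ℂ (Operator n d) where
  carrier := {M | ∀ X : Finset (Fin n), (∀ i ∈ W, Disjoint X (H.subAt i)) →
    ∀ B : LocalOperator d X, Commute (embed X B) M}
  add_mem' hM hM' X hX B := (hM X hX B).add_right (hM' X hX B)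
  zero_mem' _ _ _ := Commute.zero_right _
  smul_mem' c _ hM X hX B := (hM X hX B).smul_right c

theorem commute_embed {X Y : Finset (Fin n)} (h : Disjoint X Y) (B : LocalOperator d X)
    (C : LocalOperator d Y) : Commute (embed X B) (embed Y C) := by
  rw [embed_eq_lift, embed_eq_lift]
  refine commute_lift Subtype.val_injective Subtype.val_injective ?_ _ _
  simpa using h

theorem embed_mem_localized (r : Fin H.numTerms) (A : LocalOperator d (H.sub r)) :
    embed (H.sub r) A ∈ H.localized {(r : ℕ)} := by
  intro X hX B
  refine commute_embed ?_ _ _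
  simpa [subAt] using hX r (by simp)

theorem ad_termAt_mem_localized {W : Finset ℕ} {M : Operator n d} (hM : M ∈ H.localized W)
    (i : ℕ) : ad (H.termAt i) M ∈ H.localized (insert i W) := by
  intro X hX B
  have h1 : Commute (embed X B) (H.termAt i) := by
    unfold termAt
    split_ifs with h
    · refine (commute_embed ?_ _ _).smul_right _
      simpa [subAt, h] using hX i (Finset.mem_insert_self _ _)
    · exact Commute.zero_right _
  have h2 := hM X (fun j hj => hX j (Finset.mem_insert_of_mem hj)) B
  exact (h1.mul_right h2).sub_right (h2.mul_right h1)

theorem ad_termAt_eq_zero {W : Finset ℕ} {M : Operator n d} (hM : M ∈ H.localized W) {i : ℕ}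
    (hi : i ∉ W) (hnb : ∀ u ∈ W, i ∉ H.nbAt u) : ad (H.termAt i) M = 0 := by
  unfold termAt
  split_ifs with h
  · rw [ad_smul, LinearMap.smul_apply, ad_apply]
    rw [(hM (H.sub ⟨i, h⟩) ?_ (H.term ⟨i, h⟩)).eq, sub_self, smul_zero]
    intro u hu
    unfold subAt
    split_ifs with hu'
    · rw [Finset.disjoint_iff_inter_eq_empty]
      by_contra hne
      refine hnb u hu (H.mem_nbAt.2 ⟨hu', h, ?_, ?_⟩)
      · intro e
        exact hi (by have := congrArg Fin.val e; simp only at this; exact this ▸ hu)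
      · rw [Finset.inter_comm]
        exact Finset.nonempty_iff_ne_empty.2 hne
    · simp
  · simp [ad_apply]

theorem ad_sum (U : Finset ℕ) : ad (∑ i ∈ U, H.termAt i) = ∑ i ∈ U, ad (H.termAt i) := by
  refine LinearMap.ext fun M => ?_
  simp only [LinearMap.sum_apply, ad_apply, Finset.sum_mul, Finset.mul_sum,
    Finset.sum_sub_distrib]

/-- Nested commutators with the Hamiltonian are bounded independently of the size of the system. -/
theorem norm_ad_pow_le {deg : ℕ} (h1 : 1 ≤ deg) (hdeg : H.interactionGraph.maxDegree ≤ deg)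
    (r : Fin H.numTerms) (A : LocalOperator d (H.sub r)) (m : ℕ) :
    ‖(ad H.toOperator ^ m) (embed (H.sub r) A)‖ ≤
      m.factorial * (4 * deg : ℝ) ^ m * ‖embed (H.sub r) A‖ := by
  have hr : (r : ℕ) ∈ Finset.range H.numTerms := Finset.mem_range.2 r.2
  rw [toOperator_eq_sum_range, ad_sum, sum_pow_apply_eq_sum_clusterTerm subset_rfl hr]
  refine (norm_sum_le _ _).trans ?_
  have h2 := sum_norm_clusterTerm_le (S := Finset.range H.numTerms) (nb := H.nbAt)
    (L := fun i => ad (H.termAt i)) (H.embed_mem_localized r A)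
    (fun W M hM i _ => H.ad_termAt_mem_localized hM i)
    (fun W M hM i _ hi hnb => H.ad_termAt_eq_zero hM hi hnb) (H.length_nbAt_le hdeg)
    (fun i M => (norm_ad_apply_le _ _).trans (by
      have := H.norm_termAt_le i
      gcongr
      linarith)) m
  refine le_trans (Finset.sum_le_sum fun W hW => ?_) (h2.trans ?_)
  · rw [if_pos (Finset.mem_powerset.1 hW)]
  · have h3 : (1 : ℝ) ≤ deg := by exact_mod_cast h1
    have h4 : (2 * (deg + 1) : ℝ) ≤ 4 * deg := by linarith
    gcongr

/-- The polynomial in nested commutators with a partial Hamiltonian that approximates the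
time evolution. -/
noncomputable def partialExpectation (P A : Operator n d) (wt : ℕ → ℂ) (M : ℕ) (U : Finset ℕ) : ℂ :=
  ∑ m ∈ Finset.range (M + 1), wt m * ((ad (∑ i ∈ U, H.termAt i) ^ m) A * P).trace

open Classical in
/-- The value for the full Hamiltonian is a signed sum of values for the Hamiltonians restricted to
the sets chosen by the labellings, all of which have at most `deg * (M + 1) + 1` elements. -/
theorem partialExpectation_eq_sum_label {deg : ℕ} (hdeg : H.interactionGraph.maxDegree ≤ deg)
    (r : Fin H.numTerms) (A : LocalOperator d (H.sub r)) (P : Operator n d) (wt : ℕ → ℂ) (M : ℕ) :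
    H.partialExpectation P (embed (H.sub r) A) wt M (Finset.range H.numTerms) =
      ∑ c ∈ Finset.range (3 ^ (deg * (M + 1) + 1)),
        if Valid H.nbAt r (deg * (M + 1) + 1) (label c) then
          sign (label c) (deg * (M + 1) + 1) * H.partialExpectation P (embed (H.sub r) A) wt M
            (chosen H.nbAt r (deg * (M + 1) + 1) (label c)) else 0 := by
  let ct := clusterTerm (Finset.range H.numTerms) (r : ℕ) (fun i => ad (H.termAt i))
    (embed (H.sub r) A)
  refine sum_eq_sum_label (ι := (Finset.range H.numTerms).powerset)
    (g := fun W => ∑ m ∈ Finset.range (M + 1), wt m * (ct m W * P).trace)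
    (fun U hU hr => ?_) (fun W hW => Finset.mem_powerset.1 hW) (Finset.mem_range.2 r.2)
    (fun v _ w hw => ?_) (fun W _ hW => ?_) (H.length_nbAt_le hdeg)
  · have h : ∀ m ∈ Finset.range (M + 1),
        wt m * ((ad (∑ i ∈ U, H.termAt i) ^ m) (embed (H.sub r) A) * P).trace =
        ∑ W ∈ (Finset.range H.numTerms).powerset,
          if W ⊆ U then wt m * (ct m W * P).trace else 0 := by
      intro m _
      rw [ad_sum, sum_pow_apply_eq_sum_clusterTerm hU hr, Finset.sum_mul, Matrix.trace_sum,
        Finset.mul_sum]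
      refine Finset.sum_congr rfl fun W _ => ?_
      split_ifs <;> simp [ct]
    rw [partialExpectation, Finset.sum_congr rfl h, Finset.sum_comm]
    refine Finset.sum_congr rfl fun W _ => ?_
    split_ifs <;> simp
  · obtain ⟨_, hv, _⟩ := H.mem_nbAt.1 hw
    exact Finset.mem_range.2 hv
  · obtain ⟨m, hm, h⟩ := Finset.exists_ne_zero_of_sum_ne_zero hW
    have hne : ct m W ≠ 0 := fun h0 => h (by simp [h0])
    obtain ⟨h1, h2⟩ := connectedFrom_of_clusterTerm_ne_zero (H.embed_mem_localized r A)
      (fun W M hM i _ => H.ad_termAt_mem_localized hM i)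
      (fun W M hM i _ hi hnb => H.ad_termAt_eq_zero hM hi hnb) hne
    exact ⟨h1, h2.trans (by have := Finset.mem_range.1 hm; omega)⟩

/-- The weight of the `m`-th nested commutator: the Taylor coefficient `iᵐ / m!` times the part of
order at most `M` of `φᵐ`, evaluated at `1`, where `φ` is the rescaled logarithm. -/
noncomputable def _root_.SpinSim.weight (t w : ℝ) (M m : ℕ) : ℂ :=
  Complex.I ^ m / m.factorial * ∑ j ∈ Finset.range (M + 1),
    ((((Polynomial.C (t / (logPoly w M).eval 1) * logPoly w M) ^ m).coeff j : ℝ) : ℂ)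

/-- The truncation error. The expectation, as a function of complex time, is bounded by `2 ‖A‖` on
the strip, and the rescaled logarithm maps a disk into the strip if `s ≥ 20 deg t + 1`. -/
theorem norm_evolvedExpectation_sub_le {deg : ℕ} (h1 : 1 ≤ deg)
    (hdeg : H.interactionGraph.maxDegree ≤ deg) (r : Fin H.numTerms)
    (A : LocalOperator d (H.sub r)) {ρ : Fin n → Matrix (Fin d) (Fin d) ℂ}
    (hρ : ∀ v, IsDensity (ρ v)) {t ε : ℝ} (ht : 0 < t) {s l : ℕ}
    (hs : 20 * deg * t + 1 ≤ s) (hl : 1 ≤ 2 ^ l * ε) :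
    ‖evolvedExpectation H.toOperator (embed (H.sub r) A) (productOperator ρ) t -
      H.partialExpectation (productOperator ρ) (embed (H.sub r) A)
        (weight t (1 - (1 / 2) ^ s) (2 ^ (s + 1) * (l + s + 3)))
        (2 ^ (s + 1) * (l + s + 3)) (Finset.range H.numTerms)‖ ≤
      ε * opNorm (embed (H.sub r) A) := by
  set M := 2 ^ (s + 1) * (l + s + 3) with hM
  set w : ℝ := 1 - (1 / 2) ^ s with hw
  set A' := embed (H.sub r) A
  set P := productOperator ρ
  have hd0 : (0 : ℝ) < deg := by exact_mod_cast h1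
  have hb : (0 : ℝ) < 1 / (2 * (4 * deg)) := by positivity
  obtain ⟨hP, R, hR, hRM, hRb⟩ := exists_logPoly_scale (l := l) ht hb (s := s) (by
    rw [div_div_eq_mul_div, div_one]
    linarith)
  set φ := Polynomial.C (t / (logPoly w M).eval 1) * logPoly w M with hφ
  let f : ℂ → ℂ := fun z => (NormedSpace.exp ((Complex.I * z) • H.toOperator) * A' *
    NormedSpace.exp ((-(Complex.I * z)) • H.toOperator) * P).trace
  let a : ℕ → ℂ := fun m => Complex.I ^ m / m.factorial * ((ad H.toOperator ^ m) A' * P).trace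
  have hf : ∀ z, HasSum (fun m => a m * z ^ m) (f z) := by
    intro z
    have h2 := hasSum_exp_smul_mul_mul_exp_neg_smul H.toOperator A' (Complex.I * z)
    have h3 := h2.mapL (LinearMap.toContinuousLinearMap
      ((Matrix.traceLinearMap (Fin n → Fin d) ℂ ℂ).comp (LinearMap.mulRight ℂ P)))
    have h4 : ∀ m : ℕ, (LinearMap.toContinuousLinearMap
        ((Matrix.traceLinearMap (Fin n → Fin d) ℂ ℂ).comp (LinearMap.mulRight ℂ P)))
          (((Complex.I * z) ^ m / (m.factorial : ℂ)) • (ad H.toOperator ^ m) A') =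
        a m * z ^ m := by
      intro m
      simp [a, mul_pow]
      ring
    simp only [h4] at h3
    exact h3
  have hfb : ∀ z : ℂ, |z.im| ≤ 1 / (2 * (4 * deg)) → ‖f z‖ ≤ 2 * ‖A'‖ := fun z hz =>
    (norm_trace_mul_productOperator_le hρ _).trans
      (norm_exp_mul_mul_exp_le H.isSelfAdjoint_toOperator (by positivity)
        (H.norm_ad_pow_le h1 hdeg r A) hz)
  have h0 : φ.coeff 0 = 0 := by
    rw [hφ, Polynomial.coeff_C_mul, coeff_logPoly]
    simp
  have hφn : ∀ j, 0 ≤ φ.coeff j := by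
    intro j
    rw [hφ, Polynomial.coeff_C_mul, coeff_logPoly]
    have hw0 : 0 ≤ w := by
      rw [hw, sub_nonneg]
      exact pow_le_one₀ (by norm_num) (by norm_num)
    split_ifs
    · exact mul_nonneg (div_nonneg ht.le hP.le) (by positivity)
    · simp
  have key := norm_sub_truncation_le hf h0 hφn hR (fun u hu => hfb _ (hRb u hu)) M
  have h1' : φ.eval 1 = t := by
    rw [hφ, Polynomial.eval_mul, Polynomial.eval_C, div_mul_cancel₀ _ hP.ne']
  rw [h1'] at key
  have hsum : ∑ m ∈ Finset.range (M + 1), a m *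
      ∑ j ∈ Finset.range (M + 1), (((φ ^ m).coeff j : ℝ) : ℂ) =
      H.partialExpectation P A' (weight t w M) M (Finset.range H.numTerms) := by
    rw [partialExpectation, ← toOperator_eq_sum_range]
    refine Finset.sum_congr rfl fun m _ => ?_
    simp only [a, weight]
    ring
  rw [hsum] at key
  refine key.trans ?_
  rw [opNorm_eq_norm]
  have hl2 : (1 / 2 : ℝ) ^ l ≤ ε := by
    rw [one_div_pow, div_le_iff₀ (by positivity)]
    linarith
  calc 2 * ‖A'‖ * (R⁻¹ ^ (M + 1) * (1 - R⁻¹)⁻¹) ≤ 2 * ‖A'‖ * (1 / 2) ^ (l + 2) := by gcongr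
    _ = (1 / 2) ^ l * ‖A'‖ / 2 := by rw [pow_add]; ring
    _ ≤ (1 / 2) ^ l * ‖A'‖ := by
        have : 0 ≤ (1 / 2 : ℝ) ^ l * ‖A'‖ := by positivity
        linarith
    _ ≤ ε * ‖A'‖ := by gcongr

/-- Because of this bound, zero is a good approximation if `ε` is at least one. -/
theorem norm_evolvedExpectation_le (A : Operator n d) {ρ : Fin n → Matrix (Fin d) (Fin d) ℂ}
    (hρ : ∀ v, IsDensity (ρ v)) (t : ℝ) :
    ‖evolvedExpectation H.toOperator A (productOperator ρ) t‖ ≤ opNorm A := by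
  rw [opNorm_eq_norm]
  refine (norm_trace_mul_productOperator_le hρ _).trans ?_
  let _ : NormedAlgebra ℚ (Operator n d) := NormedAlgebra.restrictScalars ℚ ℂ _
  have hu : ∀ w : ℂ, w.re = 0 → NormedSpace.exp (w • H.toOperator) ∈ unitary (Operator n d) := by
    intro w hw
    refine NormedSpace.exp_mem_unitary_of_mem_skewAdjoint ?_
    rw [skewAdjoint.mem_iff, star_smul, H.isSelfAdjoint_toOperator.star_eq, ← neg_smul]
    congr 1
    apply Complex.ext <;> simp [hw]
  rw [CStarRing.norm_mul_mem_unitary _ (hu _ (by simp)),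
    CStarRing.norm_mem_unitary_mul _ (hu _ (by simp))]

end LocalHamiltonian
end SpinSim

namespace SpinSim

/-! ### Searching lists and computing digits -/

variable {inp : Input} {N lo : ℕ} {s s' : Memory}

/-- The entry of an array with the indices `i` and `0`. -/
def cell (a : ℕ) (i : NatExpr) : NatExpr := .get a i (.const 0)

@[simp] theorem cell_eval (a : ℕ) (i : NatExpr) :
    (cell a i).eval inp s = s.nat a (i.eval inp s) 0 := rfl

/-- Equality of natural numbers. -/
def Test.natEq (x y : NatExpr) : Test := .and (.natLE x y) (.natLE y x)

@[simp] theorem Test.natEq_holds (x y : NatExpr) :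
    (Test.natEq x y).Holds inp s ↔ x.eval inp s = y.eval inp s := by
  simp [Test.natEq, Test.Holds, le_antisymm_iff]

/-- The list `l` is stored in the array `a`, and its length in the array `a + 1`. -/
def IsList (s : Memory) (a : ℕ) (l : List ℕ) : Prop :=
  s.nat (a + 1) 0 0 = l.length ∧ ∀ i < l.length, s.nat a i 0 = l.getD i 0

theorem IsList.frame {a : ℕ} {l : List ℕ} (h : IsList s a l) (hs : Frame lo s s')
    (ha : a + 1 < lo) : IsList s' a l := by
  unfold IsList
  rw [(hs (a + 1) ha).1, (hs a (by omega)).1]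
  exact h

/-- Searches the list stored at `a` for the number `v`. The position, or the length of the list if
`v` is not found, is stored in the number `lo + 1`. -/
def findProg (a : ℕ) (lo : ℕ) (v : NatExpr) : Program :=
  .seq (assign (lo + 1) (scalar (a + 1)))
    (forLoop lo (scalar (a + 1))
      (.ite (.natEq (cell a (scalar lo)) v) (assign (lo + 1) (scalar lo)) .skip))

theorem halts_findProg {a : ℕ} {v : NatExpr} {x : ℕ} {l : List ℕ} (hl : IsList s a l)
    (hnodup : l.Nodup) (hN : l.length ≤ N) (ha : a + 1 < lo)
    (hv : ∀ s', Frame lo s s' → v.eval inp s' = x) :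
    Halts inp N (findProg a lo v) s fun s' => Frame lo s s' ∧ s'.nat (lo + 1) 0 0 = l.idxOf x := by
  have hf : Frame lo s (s.setNat (lo + 1) 0 0 l.length) := (Frame.refl lo s).setNat (by omega)
  refine .seq (.assign ?_)
  rw [scalar_eval, hl.1]
  refine (Halts.forLoop hN (fun s' h => ?_) (fun i s' => s'.nat (lo + 1) 0 0 =
    if l.idxOf x < i then l.idxOf x else l.length) (fun i s' y h => ?_) ?_ ?_).mono ?_
  · rw [scalar_eval, ((hf.trans h) (a + 1) ha).1, hl.1]
  · simpa using h
  · simp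
  · intro i s' hi h hc hJ
    have h' := hf.trans h
    have hcell : (cell a (scalar lo)).eval inp s' = l.getD i 0 := by
      rw [cell_eval, scalar_eval, hc, (h' a (by omega)).1, hl.2 i hi]
    have hidx : l.getD i 0 = x ↔ l.idxOf x = i := by
      constructor
      · intro h1
        rw [← h1, List.getD_eq_getElem _ _ hi]
        exact hnodup.idxOf_getElem i hi
      · rintro rfl
        rw [List.getD_eq_getElem _ _ hi]
        exact List.getElem_idxOf hi
    refine .ite (fun hb => .assign ⟨(Frame.refl _ _).setNat (by omega), ?_⟩)
      fun hb => .skip ⟨Frame.refl _ _, ?_⟩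
    · rw [Test.natEq_holds, hcell, hv s' h', hidx] at hb
      simp [hc, hb]
    · rw [Test.natEq_holds, hcell, hv s' h', hidx] at hb
      rw [hJ]
      have : l.idxOf x < i ↔ l.idxOf x < i + 1 := by omega
      simp only [this]
  · rintro s' ⟨h1, h2⟩
    refine ⟨hf.trans h1, h2.trans ?_⟩
    split_ifs with h3
    · rfl
    · have : l.idxOf x ≤ l.length := List.idxOf_le_length
      omega

/-- Appends the number `v` to the list stored at `a` unless it is there already. -/
def pushProg (a : ℕ) (v : NatExpr) : Program :=
  .seq (findProg a (a + 2) v) (.ite (.natLE (scalar (a + 1)) (scalar (a + 3)))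
    (.seq (.setNat a (scalar (a + 1)) (.const 0) v)
      (assign (a + 1) (.add (scalar (a + 1)) (.const 1)))) .skip)

theorem halts_pushProg {a : ℕ} {v : NatExpr} {x : ℕ} {l : List ℕ} (hl : IsList s a l)
    (hnodup : l.Nodup) (hN : l.length ≤ N) (hv : ∀ s', Frame a s s' → v.eval inp s' = x) :
    Halts inp N (pushProg a v) s fun s' => Frame a s s' ∧ IsList s' a (push l x) := by
  refine .seq ((halts_findProg hl hnodup hN (by omega) fun s' h => hv s' (h.mono (by omega))).mono
    ?_)
  rintro s' ⟨h1, h2⟩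
  have hl' := hl.frame h1 (by omega)
  have h1' : Frame a s s' := h1.mono (by omega)
  refine .ite (fun hb => ?_) fun hb => .skip ⟨h1', ?_⟩
  · simp only [Test.Holds, scalar_eval, h2, hl'.1] at hb
    have hx : x ∉ l := by
      rw [← List.idxOf_lt_length_iff]
      omega
    refine .seq (.setNat (.assign ⟨(h1'.setNat le_rfl).setNat (by omega), ?_, ?_⟩))
    · simp [push, hx, NatExpr.eval, hl'.1]
    · intro i hi
      rw [push, if_neg hx, List.length_append, List.length_singleton] at hi
      rw [push, if_neg hx, hv s' h1', scalar_eval, hl'.1]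
      rcases Nat.lt_succ_iff_lt_or_eq.1 hi with h | rfl
      · simp [NatExpr.eval, h.ne, hl'.2 i h, List.getElem?_append_left h]
      · simp [NatExpr.eval]
  · simp only [Test.Holds, scalar_eval, h2, hl'.1, not_le, List.idxOf_lt_length_iff] at hb
    rwa [push, if_pos hb]

/-- Stores the first base-`b` digits of a number in a row of the array `lo + 1`. The innermost loop
divides by `b` with remainder by counting. -/
def digitsProg (b lo : ℕ) (x len row : NatExpr) : Program :=
  .seq (assign (lo + 2) x) (forLoop lo len
    (.seq (assign (lo + 4) (.const 0)) (.seq (assign (lo + 5) (.const 0))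
      (.seq (forLoop (lo + 3) (scalar (lo + 2))
        (.seq (assign (lo + 4) (.add (scalar (lo + 4)) (.const 1)))
          (.ite (.natLE (.const b) (scalar (lo + 4)))
            (.seq (assign (lo + 4) (.const 0))
              (assign (lo + 5) (.add (scalar (lo + 5)) (.const 1)))) .skip)))
      (.seq (.setNat (lo + 1) row (scalar lo) (scalar (lo + 4)))
        (assign (lo + 2) (scalar (lo + 5))))))))

theorem halts_digitsProg {b : ℕ} (hb : 0 < b) {x len row : NatExpr} {X n r : ℕ}
    (hx : x.eval inp s = X) (hn : ∀ s', Frame lo s s' → len.eval inp s' = n)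
    (hr : ∀ s', Frame lo s s' → row.eval inp s' = r) (hX : X ≤ N) (hnN : n ≤ N) :
    Halts inp N (digitsProg b lo x len row) s fun s' => Frame lo s s' ∧
      (∀ q < n, s'.nat (lo + 1) r q = X / b ^ q % b) ∧
      ∀ i ≠ r, s'.nat (lo + 1) i = s.nat (lo + 1) i := by
  have hf : Frame lo s (s.setNat (lo + 2) 0 0 X) := (Frame.refl lo s).setNat (by omega)
  refine .seq (.assign ?_)
  rw [hx]
  refine (Halts.forLoop hnN (fun s' h => hn s' (hf.trans h)) (fun q s' =>
    s'.nat (lo + 2) 0 0 = X / b ^ q ∧ (∀ q' < q, s'.nat (lo + 1) r q' = X / b ^ q' % b) ∧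
      ∀ i ≠ r, s'.nat (lo + 1) i = s.nat (lo + 1) i) (fun i s' y h => ?_) ?_ ?_).mono ?_
  · refine ⟨by simpa using h.1, fun q hq => by simpa using h.2.1 q hq, fun i hi => ?_⟩
    funext j
    simpa using congrFun (h.2.2 i hi) j
  · refine ⟨by simp, fun q hq => absurd hq (Nat.not_lt_zero q), fun i hi => ?_⟩
    funext j
    simp
  · rintro q s₁ hq h hc ⟨h1, h2, h3⟩
    have h' := hf.trans h
    refine .seq (.assign (.seq (.assign (.seq ?_))))
    set s₂ := (s₁.setNat (lo + 4) 0 0 ((NatExpr.const 0).eval inp s₁)).setNat (lo + 5) 0 0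
      ((NatExpr.const 0).eval inp (s₁.setNat (lo + 4) 0 0 ((NatExpr.const 0).eval inp s₁)))
      with hs₂
    have hf₂ : Frame (lo + 3) s₁ s₂ :=
      ((Frame.refl _ _).setNat (by omega)).setNat (by omega)
    have hXq : X / b ^ q ≤ N := (Nat.div_le_self _ _).trans hX
    refine (Halts.forLoop hXq (fun s' h => ?_) (fun i s' => s'.nat (lo + 4) 0 0 = i % b ∧
      s'.nat (lo + 5) 0 0 = i / b) (fun i s' y h => ?_) ?_ ?_).mono ?_
    · rw [scalar_eval, ((hf₂.trans h) (lo + 2) (by omega)).1, h1]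
    · simpa using h
    · simp [hs₂, NatExpr.eval]
    · rintro i s₃ hi - hc₃ ⟨h4, h5⟩
      refine .seq (.assign (.ite (fun hb' => ?_) fun hb' => .skip
        ⟨(Frame.refl _ _).setNat (by omega), ?_⟩))
      · refine .seq (.assign (.assign ⟨(((Frame.refl _ _).setNat (by omega)).setNat
          (by omega)).setNat (by omega), ?_⟩))
        simp only [Test.Holds, NatExpr.eval, scalar_eval, Memory.setNat_nat, h4, and_self,
          if_true] at hb'
        have h6 : i % b + 1 = b := le_antisymm (Nat.mod_lt i hb) hb'
        have h7 : i + 1 = b * (i / b + 1) := by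
          have := Nat.div_add_mod i b
          rw [mul_add]
          omega
        rw [h7]
        simp [NatExpr.eval, h5, hb]
      · simp only [Test.Holds, NatExpr.eval, scalar_eval, Memory.setNat_nat, h4, and_self,
          if_true] at hb'
        have h6 : i + 1 = (i % b + 1) + b * (i / b) := by
          have := Nat.div_add_mod i b
          omega
        rw [h6, Nat.add_mul_mod_self_left, Nat.add_mul_div_left _ _ hb,
          Nat.mod_eq_of_lt (by omega), Nat.div_eq_of_lt (by omega)]
        simp [NatExpr.eval, h4, h5]
    · rintro s₄ ⟨h4, h5, h6⟩
      have hf₄ : Frame (lo + 3) s₁ s₄ := hf₂.trans h4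
      have hf' : Frame lo s s₄ := h'.trans (hf₄.mono (by omega))
      refine .seq (.setNat (.assign ⟨((hf₄.mono (by omega)).setNat (by omega)).setNat (by omega),
        ?_, ?_, ?_⟩))
      · simp [h6, Nat.div_div_eq_div_mul, pow_succ]
      · intro q' hq'
        rw [hr s₄ hf', scalar_eval, (hf₄ lo (by omega)).1, hc]
        rcases Nat.lt_succ_iff_lt_or_eq.1 hq' with h7 | rfl
        · simp [h7.ne, (hf₄ (lo + 1) (by omega)).1, h2 q' h7]
        · simp [h5]
      · intro i hi
        funext j
        rw [hr s₄ hf']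
        simp [hi, (hf₄ (lo + 1) (by omega)).1, h3 i hi]
  · rintro s' ⟨h1, h2, h3, h4⟩
    exact ⟨hf.trans h1, h3, h4⟩

end SpinSim

namespace SpinSim

/-! ### The tables for one labelling -/

variable {inp : Input} {N : ℕ} {s s' : Memory}

/-- The list of spins of the `i`-th subsystem. -/
def spins (inp : Input) (i : ℕ) : List ℕ := (List.range (inp.nat 1 i 0)).map (inp.nat 2 i)

/-- The list of neighbours of the `i`-th subsystem. -/
def nbs (inp : Input) (i : ℕ) : List ℕ := (List.range (inp.nat 3 i 0)).map (inp.nat 4 i)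

/-- Appends the entries `f 0, …, f (n - 1)` of a table to the list at `a`. -/
theorem halts_forLoop_pushProg {a n : ℕ} {bound v : NatExpr} {f : ℕ → ℕ} {l : List ℕ}
    (hl : IsList s (a + 1) l) (hnodup : l.Nodup)
    (hN : (((List.range n).map f).foldl push l).length ≤ N) (hnN : n ≤ N)
    (hbound : ∀ s', Frame a s s' → bound.eval inp s' = n)
    (hv : ∀ i < n, ∀ s', Frame a s s' → s'.nat a 0 0 = i → v.eval inp s' = f i) :
    Halts inp N (forLoop a bound (pushProg (a + 1) v)) s fun s' => Frame a s s' ∧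
      IsList s' (a + 1) (((List.range n).map f).foldl push l) := by
  refine Halts.forLoop hnN hbound (fun i s' => IsList s' (a + 1)
    (((List.range i).map f).foldl push l)) (fun i s' y h => ?_) (by simpa using hl) ?_
  · obtain ⟨h1, h2⟩ := h
    exact ⟨by simpa [show a + 1 + 1 ≠ a by omega] using h1, fun q hq => by simpa using h2 q hq⟩
  · intro i s' hi h hc hJ
    have hpre : ((List.range i).map f).foldl push l <+: ((List.range n).map f).foldl push l := by
      obtain ⟨k, rfl⟩ := Nat.exists_eq_add_of_le hi.le
      rw [List.range_add, List.map_append, List.foldl_append]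
      exact prefix_foldl_push _ _
    refine (halts_pushProg hJ (nodup_foldl_push _ hnodup) (hpre.length_le.trans hN)
      (x := f i) fun s'' h' => hv i hi s'' (h.trans (h'.mono (by omega))) ?_).mono ?_
    · rw [(h' a (by omega)).1, hc]
    · rintro s'' ⟨h1, h2⟩
      refine ⟨h1, ?_⟩
      rwa [List.range_succ, List.map_append, List.foldl_append]

/-- The exploration of the interaction graph from the subsystem of the observable. The labels are
in the array `43`, the discovered vertices are listed in the array `54`, and the number `51` is set
to one if the labels are canonical and the root has the label `1`. -/
def exploreProg : Program :=
  .seq (.setNat 54 (.const 0) (.const 0) (.input 0 (.const 2) (.const 0)))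
  (.seq (assign 55 (.const 1))
  (.seq (.ite (.natEq (.get 43 (.const 0) (.const 0)) (.const 1)) (assign 51 (.const 1))
    (assign 51 (.const 0)))
  (forLoop 50 (scalar 7)
    (.ite (.natLE (.const 1) (.get 43 (.const 0) (scalar 50)))
      (.ite (.natLE (.add (scalar 50) (.const 1)) (scalar 55))
        (.seq (assign 52 (cell 54 (scalar 50)))
          (forLoop 53 (.input 3 (scalar 52) (.const 0))
            (pushProg 54 (.input 4 (scalar 52) (scalar 53)))))
        (assign 51 (.const 0)))
      .skip))))

open Classical in
theorem halts_exploreProg {D : ℕ → ℕ} {L r : ℕ} (hL : s.nat 7 0 0 = L) (h0 : 0 < L)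
    (hD : ∀ q < L, s.nat 43 0 q = D q) (hr : inp.nat 0 2 0 = r) (hLN : L ≤ N)
    (hlen : ∀ p ≤ L, (explore (nbs inp) r D p).length ≤ N) (hdeg : ∀ i, inp.nat 3 i 0 ≤ N) :
    Halts inp N exploreProg s fun s' => Frame 50 s s' ∧
      IsList s' 54 (explore (nbs inp) r D L) ∧
      s'.nat 51 0 0 = if D 0 = 1 ∧ Canonical (nbs inp) r D L then 1 else 0 := by
  have hinit : Halts inp N (.ite (.natEq (.get 43 (.const 0) (.const 0)) (.const 1))
      (assign 51 (.const 1)) (assign 51 (.const 0)))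
      ((s.setNat 54 0 0 r).setNat 55 0 0 1) fun s' => Frame 50 s s' ∧
        IsList s' 54 [r] ∧ s'.nat 51 0 0 = if D 0 = 1 then 1 else 0 := by
    have hf : ∀ x, Frame 50 s (((s.setNat 54 0 0 r).setNat 55 0 0 1).setNat 51 0 0 x) := fun x =>
      (((Frame.refl _ _).setNat (by norm_num)).setNat (by norm_num)).setNat (by norm_num)
    refine .ite (fun hb => .assign ⟨hf _, ⟨by simp, ?_⟩, ?_⟩)
      fun hb => .assign ⟨hf _, ⟨by simp, ?_⟩, ?_⟩
    · intro i hi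
      obtain rfl : i = 0 := by simpa using hi
      simp
    · rw [Test.natEq_holds] at hb
      simp [NatExpr.eval, hD 0 h0] at hb ⊢
      exact hb
    · intro i hi
      obtain rfl : i = 0 := by simpa using hi
      simp
    · rw [Test.natEq_holds] at hb
      simp [NatExpr.eval, hD 0 h0] at hb ⊢
      exact hb
  refine .seq (.setNat (.seq (.assign (.seq ?_))))
  simp only [NatExpr.eval, hr]
  refine hinit.mono ?_
  rintro s₁ ⟨hf, hlist, hflag⟩
  refine (Halts.forLoop hLN (fun s' h => ?_) (fun p s' => IsList s' 54 (explore (nbs inp) r D p) ∧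
      s'.nat 51 0 0 = if D 0 = 1 ∧ Canonical (nbs inp) r D p then 1 else 0)
    (fun p s' y h => ?_) ?_ ?_).mono fun s' h => ⟨hf.trans h.1, h.2⟩
  · rw [scalar_eval, (h 7 (by norm_num)).1, (hf 7 (by norm_num)).1, hL]
  · refine ⟨⟨by simpa using h.1.1, fun q hq => by simpa using h.1.2 q hq⟩, by simpa using h.2⟩
  · refine ⟨hlist, ?_⟩
    rw [hflag]
    simp [Canonical]
  · rintro p s₂ hp h hc ⟨hJ1, hJ2⟩
    have hDp : (NatExpr.get 43 (.const 0) (scalar 50)).eval inp s₂ = D p := by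
      simp only [NatExpr.eval, scalar_eval, hc]
      rw [(h 43 (by norm_num)).1, (hf 43 (by norm_num)).1, hD p hp]
    have hcan : Canonical (nbs inp) r D (p + 1) ↔ Canonical (nbs inp) r D p ∧
        (D p ≠ 0 → p < (explore (nbs inp) r D p).length) := by
      rw [← canonical_update_succ (D := D) (e := D p), Function.update_eq_self]
    refine .ite (fun hb => .ite (fun hb' => ?_) fun hb' => ?_) fun hb => .skip
      ⟨Frame.refl _ _, ?_⟩
    · simp only [Test.Holds, hDp] at hb
      simp only [NatExpr.eval] at hb
      simp only [Test.Holds, NatExpr.eval, scalar_eval, hc, hJ1.1] at hb'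
      have hp' : p < (explore (nbs inp) r D p).length := hb'
      have hD0 : D p ≠ 0 := by omega
      refine .seq (.assign ?_)
      rw [cell_eval, scalar_eval, hc, hJ1.2 p hp']
      set u := (explore (nbs inp) r D p).getD p 0 with hu
      have hf₃ : Frame 51 s₂ (s₂.setNat 52 0 0 u) := (Frame.refl _ _).setNat (by norm_num)
      have hfold : ((List.range (inp.nat 3 u 0)).map (inp.nat 4 u)).foldl push
          (explore (nbs inp) r D p) = explore (nbs inp) r D (p + 1) := by
        rw [explore, if_pos ⟨hp', hD0⟩]
        rfl
      refine (halts_forLoop_pushProg (a := 53) (n := inp.nat 3 u 0) (f := inp.nat 4 u)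
        (l := explore (nbs inp) r D p) ?_ (nodup_explore p) ?_ (hdeg u) (fun s' h' => ?_)
        fun i _ s' h' hi => ?_).mono ?_
      · exact ⟨by simpa using hJ1.1, fun q hq => by simpa using hJ1.2 q hq⟩
      · rw [hfold]
        exact hlen _ hp
      · simp [NatExpr.eval, (h' 52 (by norm_num)).1]
      · simp [NatExpr.eval, (h' 52 (by norm_num)).1, hi]
      · rintro s₄ ⟨h4, h5⟩
        refine ⟨hf₃.trans (h4.mono (by norm_num)), ?_, ?_⟩
        · rwa [hfold] at h5
        · rw [(h4 51 (by norm_num)).1]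
          simp [hJ2, hcan, hp']
    · simp only [Test.Holds, hDp] at hb
      simp only [NatExpr.eval] at hb
      simp only [Test.Holds, NatExpr.eval, scalar_eval, hc, hJ1.1] at hb'
      have hD0 : D p ≠ 0 := by omega
      refine .assign ⟨(Frame.refl _ _).setNat (by norm_num), ?_, ?_⟩
      · rw [explore, if_neg (fun h => hb' h.1)]
        exact ⟨by simpa using hJ1.1, fun q hq => by simpa using hJ1.2 q hq⟩
      · have : ¬ Canonical (nbs inp) r D (p + 1) := fun h => hb' ((hcan.1 h).2 hD0)
        simp [NatExpr.eval, this]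
    · simp only [Test.Holds, hDp] at hb
      simp only [NatExpr.eval] at hb
      have hD0 : D p = 0 := by omega
      refine ⟨?_, ?_⟩
      · rw [explore, if_neg (fun h => h.2 hD0)]
        exact hJ1
      · rw [hJ2, hcan]
        simp [hD0]

/-- The spins of the subsystems in a list, in the order in which they occur. -/
def sites (inp : Input) (Q : List ℕ) : List ℕ := (Q.flatMap (spins inp)).foldl push []

/-- Lists in the array `63` the spins of all discovered subsystems. -/
def sitesProg : Program :=
  .seq (assign 64 (.const 0)) (forLoop 60 (scalar 55)
    (.seq (assign 61 (cell 54 (scalar 60)))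
      (forLoop 62 (.input 1 (scalar 61) (.const 0))
        (pushProg 63 (.input 2 (scalar 61) (scalar 62))))))

theorem getD_take_succ (Q : List ℕ) {i : ℕ} (hi : i < Q.length) :
    Q.take (i + 1) = Q.take i ++ [Q.getD i 0] := by
  rw [List.getD_eq_getElem _ _ hi]
  exact (List.take_concat_get' Q i hi).symm

theorem halts_sitesProg {Q : List ℕ} (hQ : IsList s 54 Q) (hQN : Q.length ≤ N)
    (hN : (sites inp Q).length ≤ N) (hsize : ∀ i, inp.nat 1 i 0 ≤ N) :
    Halts inp N sitesProg s fun s' => Frame 60 s s' ∧ IsList s' 63 (sites inp Q) := by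
  have hf : Frame 60 s (s.setNat 64 0 0 0) := (Frame.refl _ _).setNat (by norm_num)
  refine .seq (.assign ?_)
  refine (Halts.forLoop hQN (fun s' h => ?_) (fun i s' => IsList s' 63 (sites inp (Q.take i)))
    (fun i s' y h => ?_) ?_ ?_).mono ?_
  · rw [scalar_eval, ((hf.trans h) 55 (by norm_num)).1, hQ.1]
  · exact ⟨by simpa using h.1, fun q hq => by simpa using h.2 q hq⟩
  · exact ⟨by simp [sites, NatExpr.eval], fun q hq => by simp [sites] at hq⟩
  · intro i s₁ hi h hc hJ
    refine .seq (.assign ?_)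
    have h' := hf.trans h
    rw [cell_eval, scalar_eval, hc, (h' 54 (by norm_num)).1, hQ.2 i hi]
    set u := Q.getD i 0 with hu
    have hf₂ : Frame 61 s₁ (s₁.setNat 61 0 0 u) := (Frame.refl _ _).setNat (by norm_num)
    have hstep : sites inp (Q.take (i + 1)) =
        ((List.range (inp.nat 1 u 0)).map (inp.nat 2 u)).foldl push (sites inp (Q.take i)) := by
      rw [getD_take_succ Q hi, sites, List.flatMap_append, List.foldl_append]
      simp [sites, spins, hu]
    have hpre : sites inp (Q.take (i + 1)) <+: sites inp Q := by
      conv_rhs => rw [← List.take_append_drop (i + 1) Q]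
      rw [sites, sites, List.flatMap_append, List.foldl_append]
      exact prefix_foldl_push _ _
    refine (halts_forLoop_pushProg (a := 62) (n := inp.nat 1 u 0) (f := inp.nat 2 u)
      (l := sites inp (Q.take i)) ?_ (nodup_foldl_push _ List.nodup_nil) ?_ (hsize u)
      (fun s' h' => ?_) fun i _ s' h' hi => ?_).mono ?_
    · exact ⟨by simpa using hJ.1, fun q hq => by simpa using hJ.2 q hq⟩
    · rw [← hstep]
      exact hpre.length_le.trans hN
    · simp [NatExpr.eval, (h' 61 (by norm_num)).1]
    · simp [NatExpr.eval, (h' 61 (by norm_num)).1, hi]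
    · rintro s₃ ⟨h1, h2⟩
      rw [← hstep] at h2
      exact ⟨hf₂.trans (h1.mono (by norm_num)), h2⟩
  · rintro s' ⟨h1, h2⟩
    rw [List.take_length] at h2
    exact ⟨hf.trans h1, h2⟩

/-- Computes `d ^ y`, where `y` is the number of sites, in the number `71`, and the products
`e * d ^ q` for `e ≤ d` and `q < y` in the array `73`. -/
def powersProg (d : ℕ) : Program :=
  .seq (assign 71 (.const 1)) (forLoop 70 (scalar 64)
    (.seq (.setNat 73 (scalar 70) (.const 0) (.const 0))
      (.seq (forLoop 72 (.const d) (.setNat 73 (scalar 70) (.add (scalar 72) (.const 1))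
        (.add (.get 73 (scalar 70) (scalar 72)) (scalar 71))))
      (assign 71 (.get 73 (scalar 70) (.const d))))))

theorem halts_powersProg {d y : ℕ} (hy : s.nat 64 0 0 = y) (hyN : y ≤ N) (hdN : d ≤ N) :
    Halts inp N (powersProg d) s fun s' => Frame 70 s s' ∧ s'.nat 71 0 0 = d ^ y ∧
      ∀ q < y, ∀ e ≤ d, s'.nat 73 q e = e * d ^ q := by
  have hf : Frame 70 s (s.setNat 71 0 0 1) := (Frame.refl _ _).setNat (by norm_num)
  refine .seq (.assign ?_)
  refine (Halts.forLoop hyN (fun s' h => ?_) (fun i s' => s'.nat 71 0 0 = d ^ i ∧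
      ∀ q < i, ∀ e ≤ d, s'.nat 73 q e = e * d ^ q) (fun i s' y h => ?_) ?_ ?_).mono
    fun s' h => ⟨hf.trans h.1, h.2⟩
  · rw [scalar_eval, ((hf.trans h) 64 (by norm_num)).1, hy]
  · simpa using h
  · simp [NatExpr.eval]
  · rintro i s₁ hi h hc ⟨hJ1, hJ2⟩
    refine .seq (.setNat (.seq ?_))
    simp only [scalar_eval, NatExpr.eval, hc]
    have hf₂ : Frame 72 s₁ (s₁.setNat 73 i 0 0) := (Frame.refl _ _).setNat (by norm_num)
    refine (Halts.forLoop hdN (fun s' h => rfl) (fun j s' => (∀ e ≤ j, s'.nat 73 i e = e * d ^ i) ∧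
      ∀ q < i, ∀ e ≤ d, s'.nat 73 q e = e * d ^ q) (fun j s' y h => ?_) ?_ ?_).mono ?_
    · simpa using h
    · refine ⟨fun e he => ?_, fun q hq e he => ?_⟩
      · obtain rfl : e = 0 := by omega
        simp
      · simp [hq.ne, hJ2 q hq e he]
    · rintro j s₃ hj h' hc' ⟨h1, h2⟩
      have h3 : s₃.nat 70 0 0 = i := by rw [((hf₂.trans h') 70 (by norm_num)).1, hc]
      have h4 : s₃.nat 71 0 0 = d ^ i := by rw [((hf₂.trans h') 71 (by norm_num)).1, hJ1]
      refine .setNat ⟨(Frame.refl _ _).setNat (by norm_num), fun e he => ?_, fun q hq e he => ?_⟩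
      · rcases Nat.le_succ_iff.1 he with h5 | rfl
        · have : e ≠ j + 1 := by omega
          simp [NatExpr.eval, hc', h3, this, h1 e h5]
        · simp [NatExpr.eval, hc', h3, h4, h1 j le_rfl]
          ring
      · simp [NatExpr.eval, hc', h3, hq.ne, h2 q hq e he]
    · rintro s₃ ⟨h1, h2, h3⟩
      have h4 : s₃.nat 70 0 0 = i := by rw [((hf₂.trans h1) 70 (by norm_num)).1, hc]
      refine .assign ⟨((hf₂.trans h1).mono (by norm_num)).setNat (by norm_num), ?_,
        fun q hq e he => ?_⟩
      · simp [NatExpr.eval, h4, h2 d le_rfl, pow_succ, mul_comm]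
      · rcases Nat.lt_succ_iff_lt_or_eq.1 hq with h5 | rfl
        · simpa using h3 q h5 e he
        · simpa using h2 e he

/-- Stores in the array `79` the positions in the list of sites of the spins of the discovered
subsystems. -/
def positionsProg : Program :=
  forLoop 76 (scalar 55) (.seq (assign 77 (cell 54 (scalar 76)))
    (forLoop 78 (.input 1 (scalar 77) (.const 0))
      (.seq (findProg 63 80 (.input 2 (scalar 77) (scalar 78)))
        (.setNat 79 (scalar 76) (scalar 78) (scalar 81)))))

theorem halts_positionsProg {Q Y : List ℕ} (hQ : IsList s 54 Q) (hY : IsList s 63 Y)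
    (hYnodup : Y.Nodup) (hQN : Q.length ≤ N) (hYN : Y.length ≤ N)
    (hsize : ∀ i, inp.nat 1 i 0 ≤ N) :
    Halts inp N positionsProg s fun s' => Frame 76 s s' ∧ ∀ i < Q.length,
      ∀ j < inp.nat 1 (Q.getD i 0) 0, s'.nat 79 i j = Y.idxOf (inp.nat 2 (Q.getD i 0) j) := by
  refine Halts.forLoop hQN (fun s' h => ?_) (fun k s' => ∀ i < k,
    ∀ j < inp.nat 1 (Q.getD i 0) 0, s'.nat 79 i j = Y.idxOf (inp.nat 2 (Q.getD i 0) j))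
    (fun i s' y h => ?_) ?_ ?_
  · rw [scalar_eval, (h 55 (by norm_num)).1, hQ.1]
  · simpa using h
  · simp
  · intro k s₁ hk h hc hJ
    refine .seq (.assign ?_)
    rw [cell_eval, scalar_eval, hc, (h 54 (by norm_num)).1, hQ.2 k hk]
    have hf₂ : Frame 77 s₁ (s₁.setNat 77 0 0 (Q.getD k 0)) := (Frame.refl _ _).setNat (by norm_num)
    refine (Halts.forLoop (hsize (Q.getD k 0)) (fun s' h' => ?_) (fun m s' => (∀ i < k,
      ∀ j < inp.nat 1 (Q.getD i 0) 0, s'.nat 79 i j = Y.idxOf (inp.nat 2 (Q.getD i 0) j)) ∧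
      ∀ j < m, s'.nat 79 k j = Y.idxOf (inp.nat 2 (Q.getD k 0) j)) (fun i s' y h => ?_) ?_ ?_).mono
      ?_
    · simp [NatExpr.eval, (h' 77 (by norm_num)).1]
    · simpa using h
    · simpa using hJ
    · rintro m s₃ hm h' hc' ⟨h1, h2⟩
      have hY' : IsList s₃ 63 Y :=
        (hY.frame h (by norm_num)).frame ((hf₂.mono (by norm_num)).trans (h'.mono (by norm_num)))
          (lo := 76) (by norm_num)
      have h77 : s₃.nat 77 0 0 = Q.getD k 0 := by
        rw [(h' 77 (by norm_num)).1]
        simp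
      have h76 : s₃.nat 76 0 0 = k := by
        rw [((hf₂.trans (h'.mono (by norm_num))) 76 (by norm_num)).1, hc]
      refine .seq ((halts_findProg hY' hYnodup hYN (by norm_num)
        (x := inp.nat 2 (Q.getD k 0) m) fun s' h'' => ?_).mono ?_)
      · simp only [NatExpr.eval, scalar_eval]
        rw [(h'' 77 (by norm_num)).1, (h'' 78 (by norm_num)).1, h77, hc']
      · rintro s₄ ⟨h4, h5⟩
        have h78 : s₄.nat 78 0 0 = m := by rw [(h4 78 (by norm_num)).1, hc']
        have h76' : s₄.nat 76 0 0 = k := by rw [(h4 76 (by norm_num)).1, h76]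
        have h79 := (h4 79 (by norm_num)).1
        refine .setNat ⟨(h4.mono (by norm_num)).setNat (by norm_num), fun i hi j hj => ?_,
          fun j hj => ?_⟩
        · simp [h76', hi.ne, h79, h1 i hi j hj]
        · rcases Nat.lt_succ_iff_lt_or_eq.1 hj with h6 | rfl
          · simp [h76', h78, h6.ne, h79, h2 j h6]
          · simp [h76', h78, h5]
    · rintro s₃ ⟨h1, h2, h3⟩
      refine ⟨hf₂.trans (h1.mono (by norm_num)), fun i hi j hj => ?_⟩
      rcases Nat.lt_succ_iff_lt_or_eq.1 hi with h6 | rfl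
      · exact h2 i h6 j hj
      · exact h3 j hj

/-- Stores the base-`d` digits of all numbers below `d ^ y` in the array `86`. -/
def digitTableProg (d : ℕ) : Program :=
  forLoop 84 (scalar 71) (digitsProg d 85 (scalar 84) (scalar 64) (scalar 84))

theorem halts_digitTableProg {d y n : ℕ} (hd : 0 < d) (hn : s.nat 71 0 0 = n)
    (hy : s.nat 64 0 0 = y) (hnN : n ≤ N) (hyN : y ≤ N) :
    Halts inp N (digitTableProg d) s fun s' => Frame 84 s s' ∧
      ∀ a < n, ∀ q < y, s'.nat 86 a q = a / d ^ q % d := by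
  refine Halts.forLoop hnN (fun s' h => ?_) (fun k s' => ∀ a < k, ∀ q < y,
    s'.nat 86 a q = a / d ^ q % d) (fun i s' y h => by simpa using h) (by simp) ?_
  · rw [scalar_eval, (h 71 (by norm_num)).1, hn]
  · intro k s₁ hk h hc hJ
    refine (halts_digitsProg hd (X := k) (n := y) (r := k) (by simp [hc]) (fun s' h' => ?_)
      (fun s' h' => ?_) (hk.le.trans hnN) hyN).mono ?_
    · rw [scalar_eval, (h' 64 (by norm_num)).1, (h 64 (by norm_num)).1, hy]
    · rw [scalar_eval, (h' 84 (by norm_num)).1, hc]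
    · rintro s₂ ⟨h1, h2, h3⟩
      refine ⟨h1, fun a ha q hq => ?_⟩
      rcases Nat.lt_succ_iff_lt_or_eq.1 ha with h4 | rfl
      · rw [h3 a h4.ne]
        exact hJ a h4 q hq
      · exact h2 q hq

end SpinSim

namespace SpinSim

/-! ### The matrices of a partial Hamiltonian -/

variable {inp : Input} {N : ℕ} {s s' : Memory}

/-- Stores the value of `e` after the program `P` in the entries of the array `c + 2` whose indices
are the loop counters. -/
def fillProg (c : ℕ) (b₁ b₂ : NatExpr) (P : Program) (e : NumExpr) : Program :=
  forLoop c b₁ (forLoop (c + 1) b₂ (.seq P (.setNum (c + 2) (scalar c) (scalar (c + 1)) e)))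

/-- One array `keep` may be protected in addition to those that the frame condition covers. It is
needed when a matrix is copied back to an array with a smaller number. -/
theorem halts_fillProg {c m n keep : ℕ} {b₁ b₂ : NatExpr} {P : Program} {e : NumExpr}
    (F : ℕ → ℕ → ℂ) (hk : keep ≠ c + 2) (hm : m ≤ N) (hn : n ≤ N)
    (hb₁ : ∀ s', Frame c s s' → b₁.eval inp s' = m) (hb₂ : ∀ s', Frame c s s' → b₂.eval inp s' = n)
    (step : ∀ i < m, ∀ j < n, ∀ s', Frame c s s' → s'.num keep = s.num keep → s'.nat c 0 0 = i →
      s'.nat (c + 1) 0 0 = j → Halts inp N P s' fun s'' => Frame (c + 3) s' s'' ∧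
        s''.num keep = s'.num keep ∧ e.eval inp s'' = F i j) :
    Halts inp N (fillProg c b₁ b₂ P e) s fun s' => Frame c s s' ∧ s'.num keep = s.num keep ∧
      ∀ i < m, ∀ j < n, s'.num (c + 2) i j = F i j := by
  refine Halts.forLoop hm hb₁ (fun k s' => s'.num keep = s.num keep ∧
    ∀ i < k, ∀ j < n, s'.num (c + 2) i j = F i j) (fun i s' y h => h) (by simp) ?_
  rintro i s₁ hi h hc ⟨hJ1, hJ2⟩
  refine (Halts.forLoop hn (fun s' h' => hb₂ s' (h.trans (h'.mono (by omega)))) (fun k s' =>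
    s'.num keep = s.num keep ∧ (∀ i' < i, ∀ j < n, s'.num (c + 2) i' j = F i' j) ∧
      ∀ j < k, s'.num (c + 2) i j = F i j) (fun i s' y h => h) ⟨hJ1, hJ2, by simp⟩ ?_).mono ?_
  · rintro j s₂ hj h' hc' ⟨h1, h2, h3⟩
    have hc₂ : s₂.nat c 0 0 = i := by rw [(h' c (by omega)).1, hc]
    refine .seq ((step i hi j hj s₂ (h.trans (h'.mono (by omega))) h1 hc₂ hc').mono ?_)
    rintro s₃ ⟨h4, h5, h6⟩
    have h7 := (h4 (c + 2) (by omega)).2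
    have hc₃ : s₃.nat c 0 0 = i := by rw [(h4 c (by omega)).1, hc₂]
    have hc₃' : s₃.nat (c + 1) 0 0 = j := by rw [(h4 (c + 1) (by omega)).1, hc']
    refine .setNum ⟨(h4.mono (by omega)).setNum (by omega), ?_, fun i' hi' j' hj' => ?_,
      fun j' hj' => ?_⟩
    · rw [← h1, ← h5]
      funext i' j'
      simp [hk]
    · simp [hc₃, hi'.ne, h7, h2 i' hi' j' hj']
    · rcases Nat.lt_succ_iff_lt_or_eq.1 hj' with h8 | rfl
      · simp [hc₃', h8.ne, h7, h3 j' h8]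
      · simp [hc₃, hc₃', h6]
  · rintro s₃ ⟨h1, h2, h3, h4⟩
    refine ⟨h1, h2, fun i' hi' => ?_⟩
    rcases Nat.lt_succ_iff_lt_or_eq.1 hi' with h5 | rfl
    · exact h3 i' h5
    · exact h4

/-- Accumulates in the number `c + 1` the values of `e` for the values `0, …, bound - 1` of the
counter `c`. -/
def sumProg (c : ℕ) (bound : NatExpr) (e : NumExpr) : Program :=
  .seq (numAssign (c + 1) (.const 0))
    (forLoop c bound (numAssign (c + 1) (.add (numScalar (c + 1)) e)))

theorem halts_sumProg {c n : ℕ} {bound : NatExpr} {e : NumExpr} (f : ℕ → ℂ) (hn : n ≤ N)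
    (hbound : ∀ s', Frame c s s' → bound.eval inp s' = n)
    (he : ∀ i < n, ∀ s', Frame c s s' → s'.nat c 0 0 = i → e.eval inp s' = f i) :
    Halts inp N (sumProg c bound e) s fun s' => Frame c s s' ∧
      s'.num (c + 1) 0 0 = ∑ i ∈ Finset.range n, f i := by
  refine .seq (.numAssign ?_)
  have hf : ∀ x, Frame c s (s.setNum (c + 1) 0 0 x) := fun x =>
    (Frame.refl _ _).setNum (by omega)
  refine (Halts.forLoop hn (fun s' h => hbound s' ((hf _).trans h)) (fun k s' =>
    s'.num (c + 1) 0 0 = ∑ i ∈ Finset.range k, f i) (fun i s' y h => h)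
    (by simp [NumExpr.eval]) ?_).mono fun s' h => ⟨(hf _).trans h.1, h.2⟩
  intro i s' hi h hc hJ
  refine .numAssign ⟨(Frame.refl _ _).setNum (by omega), ?_⟩
  rw [Finset.sum_range_succ]
  simp [NumExpr.eval, hJ, he i hi s' ((hf _).trans h) hc]

/-- The number of the configuration of the `u`-th subsystem that results from the configuration
number `a` of the sites in the list `Y`. -/
def localNumber (inp : Input) (d : ℕ) (Y : List ℕ) (u a : ℕ) : ℕ :=
  ∑ j ∈ Finset.range (inp.nat 1 u 0), a / d ^ Y.idxOf (inp.nat 2 u j) % d * d ^ j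

/-- The number of the configuration in which the digits of `a` that belong to the `u`-th subsystem
are replaced by zeros. Two configurations agree outside of the subsystem if and only if these
numbers agree. The sum is at most `a`, so the subtraction does not truncate. -/
def restNumber (inp : Input) (d : ℕ) (Y : List ℕ) (u a : ℕ) : ℕ :=
  a - ∑ j ∈ Finset.range (inp.nat 1 u 0), a / d ^ Y.idxOf (inp.nat 2 u j) % d *
    d ^ Y.idxOf (inp.nat 2 u j)

/-- Stores the numbers of restricted configurations for all configurations and all discovered
subsystems in the arrays `95` and `96`. -/
def restrictProg : Program :=
  forLoop 92 (scalar 71) (forLoop 93 (scalar 55)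
    (.seq (assign 94 (cell 54 (scalar 93)))
    (.seq (assign 98 (.const 0))
    (.seq (assign 99 (scalar 92))
    (.seq (forLoop 97 (.input 1 (scalar 94) (.const 0))
      (.seq (assign 98 (.add (scalar 98) (.get 73 (scalar 97)
          (.get 86 (scalar 92) (.get 79 (scalar 93) (scalar 97))))))
        (assign 99 (.sub (scalar 99) (.get 73 (.get 79 (scalar 93) (scalar 97))
          (.get 86 (scalar 92) (.get 79 (scalar 93) (scalar 97))))))))
    (.seq (.setNat 95 (scalar 92) (scalar 93) (scalar 98))
      (.setNat 96 (scalar 92) (scalar 93) (scalar 99))))))))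

/-- The tables that the program computes from a labelling before it turns to matrices: the
discovered subsystems `Q`, the sites `Y`, powers of `d`, positions of spins in `Y`, and digits. -/
structure Tables (inp : Input) (s : Memory) (d : ℕ) (Q Y : List ℕ) : Prop where
  listQ : IsList s 54 Q
  listY : IsList s 63 Y
  card : s.nat 71 0 0 = d ^ Y.length
  power : ∀ q < Y.length, ∀ e ≤ d, s.nat 73 q e = e * d ^ q
  position : ∀ i < Q.length, ∀ j < inp.nat 1 (Q.getD i 0) 0,
    s.nat 79 i j = Y.idxOf (inp.nat 2 (Q.getD i 0) j)
  digit : ∀ a < d ^ Y.length, ∀ q < Y.length, s.nat 86 a q = a / d ^ q % d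

theorem Tables.frame {d : ℕ} {Q Y : List ℕ} (h : Tables inp s d Q Y) (hs : Frame 92 s s') :
    Tables inp s' d Q Y where
  listQ := h.listQ.frame hs (by norm_num)
  listY := h.listY.frame hs (by norm_num)
  card := by rw [(hs 71 (by norm_num)).1, h.card]
  power := by rw [(hs 73 (by norm_num)).1]; exact h.power
  position := by rw [(hs 79 (by norm_num)).1]; exact h.position
  digit := by rw [(hs 86 (by norm_num)).1]; exact h.digit

theorem halts_restrictProg {d : ℕ} {Q Y : List ℕ} (hd : 0 < d) (h : Tables inp s d Q Y)
    (hpos : ∀ i < Q.length, ∀ j < inp.nat 1 (Q.getD i 0) 0,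
      j < Y.length ∧ Y.idxOf (inp.nat 2 (Q.getD i 0) j) < Y.length)
    (hQN : Q.length ≤ N) (hYN : d ^ Y.length ≤ N) (hsize : ∀ i, inp.nat 1 i 0 ≤ N) :
    Halts inp N restrictProg s fun s' => Frame 92 s s' ∧ ∀ a < d ^ Y.length, ∀ i < Q.length,
      s'.nat 95 a i = localNumber inp d Y (Q.getD i 0) a ∧
      s'.nat 96 a i = restNumber inp d Y (Q.getD i 0) a := by
  refine Halts.forLoop hYN (fun s' h' => ?_) (fun k s' => ∀ a < k, ∀ i < Q.length,
      s'.nat 95 a i = localNumber inp d Y (Q.getD i 0) a ∧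
      s'.nat 96 a i = restNumber inp d Y (Q.getD i 0) a) (fun i s' y h => by simpa using h)
      (by simp) ?_
  · rw [scalar_eval, (h.frame h').card]
  intro a s₁ ha h1 hc hJ
  refine (Halts.forLoop hQN (fun s' h' => ?_) (fun k s' => (∀ a' < a, ∀ i < Q.length,
      s'.nat 95 a' i = localNumber inp d Y (Q.getD i 0) a' ∧
      s'.nat 96 a' i = restNumber inp d Y (Q.getD i 0) a') ∧ ∀ i < k,
      s'.nat 95 a i = localNumber inp d Y (Q.getD i 0) a ∧
      s'.nat 96 a i = restNumber inp d Y (Q.getD i 0) a) (fun i s' y h => by simpa using h)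
      (by simpa using hJ) ?_).mono ?_
  · rw [scalar_eval, (h.frame (h1.trans (h'.mono (by norm_num)))).listQ.1]
  · rintro i s₂ hi h2 hc' ⟨h3, h4⟩
    have hT := h.frame (h1.trans (h2.mono (by norm_num)))
    have hc₂ : s₂.nat 92 0 0 = a := by rw [(h2 92 (by norm_num)).1, hc]
    set u := Q.getD i 0 with hu
    refine .seq (.assign (.seq (.assign (.seq (.assign (.seq ?_))))))
    simp only [cell_eval, scalar_eval, NatExpr.eval, hc', hT.listQ.2 i hi, ← hu,
      Memory.setNat_nat, hc₂, show (92 : ℕ) ≠ 98 by norm_num, show (92 : ℕ) ≠ 94 by norm_num,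
      false_and, if_false]
    set s₃ := ((s₂.setNat 94 0 0 u).setNat 98 0 0 0).setNat 99 0 0 a with hs₃
    have hf : Frame 94 s₂ s₃ :=
      (((Frame.refl _ _).setNat (by norm_num)).setNat (by norm_num)).setNat (by norm_num)
    have h95 : s₃.nat 95 = s₂.nat 95 := by funext x y; simp [hs₃]
    have h96 : s₃.nat 96 = s₂.nat 96 := by funext x y; simp [hs₃]
    have h94 : s₃.nat 94 0 0 = u := by simp [hs₃]
    refine (Halts.forLoop (hsize u) (fun s' h' => ?_) (fun m s' =>
      s'.nat 98 0 0 = ∑ j ∈ Finset.range m, a / d ^ Y.idxOf (inp.nat 2 u j) % d * d ^ j ∧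
      s'.nat 99 0 0 = a - ∑ j ∈ Finset.range m, a / d ^ Y.idxOf (inp.nat 2 u j) % d *
        d ^ Y.idxOf (inp.nat 2 u j)) (fun i s' y h => by simpa using h) ?_ ?_).mono ?_
    · simp [NatExpr.eval, (h' 94 (by norm_num)).1, h94]
    · simp [hs₃]
    · rintro j s₄ hj h5 hc₄ ⟨h6, h7⟩
      have hf₄ : Frame 94 s₂ s₄ := hf.trans (h5.mono (by norm_num))
      have hT₄ := hT.frame (hf₄.mono (by norm_num))
      obtain ⟨hp1, hp2⟩ := hpos i hi j hj
      rw [← hu] at hp2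
      have h79 : s₄.nat 79 i j = Y.idxOf (inp.nat 2 u j) := hT₄.position i hi j hj
      have h86 : s₄.nat 86 a (Y.idxOf (inp.nat 2 u j)) = _ := hT₄.digit a ha _ hp2
      have hle : a / d ^ Y.idxOf (inp.nat 2 u j) % d ≤ d := (Nat.mod_lt _ hd).le
      have h92 : s₄.nat 92 0 0 = a := by rw [(hf₄ 92 (by norm_num)).1, hc₂]
      have h93 : s₄.nat 93 0 0 = i := by rw [(hf₄ 93 (by norm_num)).1, hc']
      refine .seq (.assign (.assign ⟨((Frame.refl _ _).setNat (by norm_num)).setNat (by norm_num),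
        ?_, ?_⟩))
      · simp only [NatExpr.eval, scalar_eval, Memory.setNat_nat, h92, h93, hc₄, h79, h86, h6, h7,
          hT₄.power j hp1 _ hle, Finset.sum_range_succ]
        simp
      · simp [NatExpr.eval, h92, h93, hc₄, h79, h86, h6, h7,
          hT₄.power _ hp2 _ hle, Finset.sum_range_succ, Nat.sub_sub]
    · rintro s₄ ⟨h5, h6, h7⟩
      have hf₄ : Frame 94 s₂ s₄ := hf.trans (h5.mono (by norm_num))
      have h92 : s₄.nat 92 0 0 = a := by rw [(hf₄ 92 (by norm_num)).1, hc₂]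
      have h93 : s₄.nat 93 0 0 = i := by rw [(hf₄ 93 (by norm_num)).1, hc']
      have h95' : s₄.nat 95 = s₂.nat 95 := by rw [(h5 95 (by norm_num)).1, h95]
      have h96' : s₄.nat 96 = s₂.nat 96 := by rw [(h5 96 (by norm_num)).1, h96]
      refine .seq (.setNat (.setNat ⟨(hf₄.setNat (by norm_num)).setNat (by norm_num),
        fun a' ha' i' hi' => ?_, fun i' hi' => ?_⟩))
      · simpa [h92, ha'.ne, h95', h96'] using h3 a' ha' i' hi'
      · rcases Nat.lt_succ_iff_lt_or_eq.1 hi' with h8 | rfl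
        · simpa [h92, h93, h8.ne, h95', h96'] using h4 i' h8
        · simp [h92, h93, h6, h7, localNumber, restNumber, hu]
  · rintro s₂ ⟨h2, h3, h4⟩
    refine ⟨h2, fun a' ha' => ?_⟩
    rcases Nat.lt_succ_iff_lt_or_eq.1 ha' with h8 | rfl
    · exact h3 a' h8
    · exact h4

/-- The matrix entries of a partial Hamiltonian, on configurations of the sites in `Y`. -/
noncomputable def hamiltonianEntry (inp : Input) (d : ℕ) (D : ℕ → ℕ) (Q Y : List ℕ) (a b : ℕ) : ℂ :=
  ∑ i ∈ Finset.range Q.length, if D i = 1 ∧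
      restNumber inp d Y (Q.getD i 0) a = restNumber inp d Y (Q.getD i 0) b then
    inp.num 1 (Q.getD i 0) 0 0 * inp.num 2 (Q.getD i 0) (localNumber inp d Y (Q.getD i 0) a)
      (localNumber inp d Y (Q.getD i 0) b) else 0

/-- The matrix entries of the observable, on configurations of the sites in `Y`. -/
noncomputable def observableEntry (inp : Input) (d : ℕ) (Q Y : List ℕ) (a b : ℕ) : ℂ :=
  if restNumber inp d Y (Q.getD 0 0) a = restNumber inp d Y (Q.getD 0 0) b then
    inp.num 3 0 (localNumber inp d Y (Q.getD 0 0) a) (localNumber inp d Y (Q.getD 0 0) b) else 0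

/-- The matrix entries of the product state, on configurations of the sites in `Y`. -/
noncomputable def stateEntry (inp : Input) (d : ℕ) (Y : List ℕ) (a b : ℕ) : ℂ :=
  ∏ q ∈ Finset.range Y.length, inp.num 4 (Y.getD q 0) (a / d ^ q % d) (b / d ^ q % d)

/-- Stores the partial Hamiltonian in the array `102`. -/
def hamiltonianProg : Program :=
  fillProg 100 (scalar 71) (scalar 71)
    (.seq (numAssign 104 (.const 0)) (forLoop 103 (scalar 55)
      (.ite (.and (.natEq (.get 43 (.const 0) (scalar 103)) (.const 1))
          (.natEq (.get 96 (scalar 100) (scalar 103)) (.get 96 (scalar 101) (scalar 103))))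
        (numAssign 104 (.add (numScalar 104) (.mul
          (.input 1 (cell 54 (scalar 103)) (.const 0) (.const 0))
          (.input 2 (cell 54 (scalar 103)) (.get 95 (scalar 100) (scalar 103))
            (.get 95 (scalar 101) (scalar 103)))))) .skip)))
    (numScalar 104)

/-- Stores the observable in the array `107`. -/
def observableProg : Program :=
  fillProg 105 (scalar 71) (scalar 71)
    (.ite (.natEq (.get 96 (scalar 105) (.const 0)) (.get 96 (scalar 106) (.const 0)))
      (numAssign 108 (.input 3 (.const 0) (.get 95 (scalar 105) (.const 0))
        (.get 95 (scalar 106) (.const 0))))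
      (numAssign 108 (.const 0)))
    (numScalar 108)

/-- Stores the product state in the array `112`. -/
def stateProg : Program :=
  fillProg 110 (scalar 71) (scalar 71)
    (.seq (numAssign 114 (.const 1)) (forLoop 113 (scalar 64)
      (numAssign 114 (.mul (numScalar 114) (.input 4 (cell 63 (scalar 113))
        (.get 86 (scalar 110) (scalar 113)) (.get 86 (scalar 111) (scalar 113)))))))
    (numScalar 114)

/-- The labels and the numbers of restricted configurations, in addition to the other tables. -/
structure FullTables (inp : Input) (s : Memory) (d : ℕ) (D : ℕ → ℕ) (Q Y : List ℕ) : Prop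
    extends Tables inp s d Q Y where
  label : ∀ q < Q.length, s.nat 43 0 q = D q
  restrict : ∀ a < d ^ Y.length, ∀ i < Q.length,
      s.nat 95 a i = localNumber inp d Y (Q.getD i 0) a ∧
      s.nat 96 a i = restNumber inp d Y (Q.getD i 0) a

theorem FullTables.frame {d : ℕ} {D : ℕ → ℕ} {Q Y : List ℕ} (h : FullTables inp s d D Q Y)
    (hs : Frame 100 s s') : FullTables inp s' d D Q Y where
  toTables := h.toTables.frame (hs.mono (by norm_num))
  label := by rw [(hs 43 (by norm_num)).1]; exact h.label
  restrict := by rw [(hs 95 (by norm_num)).1, (hs 96 (by norm_num)).1]; exact h.restrict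

variable {d : ℕ} {D : ℕ → ℕ} {Q Y : List ℕ}

theorem halts_hamiltonianProg (h : FullTables inp s d D Q Y) (hQN : Q.length ≤ N)
    (hYN : d ^ Y.length ≤ N) :
    Halts inp N hamiltonianProg s fun s' => Frame 100 s s' ∧ ∀ a < d ^ Y.length,
      ∀ b < d ^ Y.length, s'.num 102 a b = hamiltonianEntry inp d D Q Y a b := by
  refine (halts_fillProg (keep := 0) (hamiltonianEntry inp d D Q Y) (by norm_num) hYN hYN
    (fun s' h' => by exact (h.frame h').card) (fun s' h' => by exact (h.frame h').card) ?_).mono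
    fun s' h => ⟨h.1, h.2.2⟩
  rintro a ha b hb s₁ h1 - hca hcb
  refine .seq (.numAssign ?_)
  set s₂ := s₁.setNum 104 0 0 ((NumExpr.const 0).eval inp s₁) with hs₂
  have hf : Frame 103 s₁ s₂ := (Frame.refl _ _).setNum (by norm_num)
  have hT₂ := h.frame (h1.trans (hf.mono (by norm_num)))
  refine (Halts.forLoop hQN (fun s' h' => by exact (hT₂.frame (h'.mono (by norm_num))).listQ.1)
    (fun k s' => s'.num 104 0 0 = ∑ i ∈ Finset.range k, if D i = 1 ∧
      restNumber inp d Y (Q.getD i 0) a = restNumber inp d Y (Q.getD i 0) b then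
    inp.num 1 (Q.getD i 0) 0 0 * inp.num 2 (Q.getD i 0) (localNumber inp d Y (Q.getD i 0) a)
      (localNumber inp d Y (Q.getD i 0) b) else 0) (fun i s' y h => h)
    (by simp [hs₂, NumExpr.eval]) ?_).mono ?_
  · intro i s₃ hi h2 hc hJ
    have hT := hT₂.frame (h2.mono (by norm_num))
    have h3 := hf.trans h2
    have h100 : s₃.nat 100 0 0 = a := by rw [(h3 100 (by norm_num)).1, hca]
    have h101 : s₃.nat 101 0 0 = b := by rw [(h3 101 (by norm_num)).1, hcb]
    have hiff : Test.Holds inp s₃ (.and (.natEq (.get 43 (.const 0) (scalar 103)) (.const 1))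
          (.natEq (.get 96 (scalar 100) (scalar 103)) (.get 96 (scalar 101) (scalar 103)))) ↔
        (D i = 1 ∧ restNumber inp d Y (Q.getD i 0) a = restNumber inp d Y (Q.getD i 0) b) := by
      rw [Test.Holds, Test.natEq_holds, Test.natEq_holds]
      simp only [NatExpr.eval, scalar_eval, hc, h100, h101, hT.label i hi,
        (hT.restrict a ha i hi).2, (hT.restrict b hb i hi).2]
    refine .ite (fun hb' => .numAssign ⟨(Frame.refl _ _).setNum (by norm_num), ?_⟩)
      fun hb' => .skip ⟨Frame.refl _ _, ?_⟩
    · rw [Finset.sum_range_succ, if_pos (hiff.1 hb'), ← hJ]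
      simp only [NumExpr.eval, NatExpr.eval, cell_eval, scalar_eval, numScalar_eval, hc, h100, h101,
        (hT.restrict a ha i hi).1, (hT.restrict b hb i hi).1, hT.listQ.2 i hi]
      simp
    · rw [Finset.sum_range_succ, if_neg (fun h => hb' (hiff.2 h)), ← hJ, add_zero]
  · rintro s₃ ⟨h2, h3⟩
    exact ⟨hf.trans h2, ((hf.trans h2) 0 (by norm_num)).2, h3⟩

theorem halts_observableProg (h : FullTables inp s d D Q Y) (hQ : 0 < Q.length)
    (hYN : d ^ Y.length ≤ N) :
    Halts inp N observableProg s fun s' => Frame 105 s s' ∧ ∀ a < d ^ Y.length,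
      ∀ b < d ^ Y.length, s'.num 107 a b = observableEntry inp d Q Y a b := by
  refine (halts_fillProg (keep := 0) (observableEntry inp d Q Y) (by norm_num) hYN hYN
    (fun s' h' => by exact (h.frame (h'.mono (by norm_num))).card)
    (fun s' h' => by exact (h.frame (h'.mono (by norm_num))).card) ?_).mono
    fun s' h => ⟨h.1, h.2.2⟩
  rintro a ha b hb s₁ h1 - hca hcb
  have hT := h.frame (h1.mono (by norm_num))
  have hf : ∀ z, Frame (105 + 3) s₁ (s₁.setNum 108 0 0 z) := fun z =>
    (Frame.refl _ _).setNum (by norm_num)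
  have hiff : Test.Holds inp s₁
      (.natEq (.get 96 (scalar 105) (.const 0)) (.get 96 (scalar 106) (.const 0))) ↔
        restNumber inp d Y (Q.getD 0 0) a = restNumber inp d Y (Q.getD 0 0) b := by
    rw [Test.natEq_holds]
    simp only [NatExpr.eval, scalar_eval, hca, hcb, (hT.restrict a ha 0 hQ).2,
      (hT.restrict b hb 0 hQ).2]
  refine .ite (fun hb' => .numAssign ⟨hf _, ((hf _) 0 (by norm_num)).2, ?_⟩)
      fun hb' => .numAssign ⟨hf _, ((hf _) 0 (by norm_num)).2, ?_⟩
  · rw [observableEntry, if_pos (hiff.1 hb')]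
    simp only [NumExpr.eval, NatExpr.eval, scalar_eval, numScalar_eval, hca, hcb,
      (hT.restrict a ha 0 hQ).1, (hT.restrict b hb 0 hQ).1]
    simp
  · rw [observableEntry, if_neg (fun h => hb' (hiff.2 h))]
    simp [NumExpr.eval]

theorem halts_stateProg (h : FullTables inp s d D Q Y) (hyN : Y.length ≤ N)
    (hYN : d ^ Y.length ≤ N) :
    Halts inp N stateProg s fun s' => Frame 110 s s' ∧ ∀ a < d ^ Y.length,
      ∀ b < d ^ Y.length, s'.num 112 a b = stateEntry inp d Y a b := by
  refine (halts_fillProg (keep := 0) (stateEntry inp d Y) (by norm_num) hYN hYN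
    (fun s' h' => by exact (h.frame (h'.mono (by norm_num))).card)
    (fun s' h' => by exact (h.frame (h'.mono (by norm_num))).card) ?_).mono
    fun s' h => ⟨h.1, h.2.2⟩
  rintro a ha b hb s₁ h1 - hca hcb
  refine .seq (.numAssign ?_)
  set s₂ := s₁.setNum 114 0 0 ((NumExpr.const 1).eval inp s₁) with hs₂
  have hf : Frame 113 s₁ s₂ := (Frame.refl _ _).setNum (by norm_num)
  have hT₂ := h.frame ((h1.trans (hf.mono (by norm_num))).mono (by norm_num))
  refine (Halts.forLoop hyN (fun s' h' => by exact (hT₂.frame (h'.mono (by norm_num))).listY.1)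
    (fun k s' => s'.num 114 0 0 = ∏ q ∈ Finset.range k,
      inp.num 4 (Y.getD q 0) (a / d ^ q % d) (b / d ^ q % d)) (fun i s' y h => h)
    (by simp [hs₂, NumExpr.eval]) ?_).mono ?_
  · intro i s₃ hi h2 hc hJ
    have hT := hT₂.frame (h2.mono (by norm_num))
    have h3 := hf.trans h2
    have h110 : s₃.nat 110 0 0 = a := by rw [(h3 110 (by norm_num)).1, hca]
    have h111 : s₃.nat 111 0 0 = b := by rw [(h3 111 (by norm_num)).1, hcb]
    refine .numAssign ⟨(Frame.refl _ _).setNum (by norm_num), ?_⟩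
    rw [Finset.prod_range_succ, ← hJ]
    simp only [NumExpr.eval, NatExpr.eval, cell_eval, scalar_eval, numScalar_eval, hc, h110, h111,
      hT.listY.2 i hi, hT.digit a ha i hi, hT.digit b hb i hi]
    simp
  · rintro s₃ ⟨h2, h3⟩
    exact ⟨hf.trans h2, ((hf.trans h2) 0 (by norm_num)).2, h3⟩

end SpinSim

namespace SpinSim

/-! ### The value of one labelling -/

open scoped Matrix.Norms.L2Operator

variable {inp : Input} {N : ℕ} {s s' : Memory}

/-- The matrix with the entries of a table. -/
def tableMatrix (n : ℕ) (F : ℕ → ℕ → ℂ) : Matrix (Fin n) (Fin n) ℂ := Matrix.of fun a b => F a b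

/-- Horner's scheme for the polynomial with coefficients `wt 0, …, wt M` in the commutator with
`K`, applied to `A`: the first `m` steps. -/
noncomputable def horner {n : ℕ} (K A : Matrix (Fin n) (Fin n) ℂ) (wt : ℕ → ℂ) (M : ℕ) :
    ℕ → Matrix (Fin n) (Fin n) ℂ
  | 0 => 0
  | m + 1 => wt (M - m) • A + (K * horner K A wt M m - horner K A wt M m * K)

theorem horner_eq_sum {n : ℕ} (K A : Matrix (Fin n) (Fin n) ℂ) (wt : ℕ → ℂ) (M : ℕ) :
    horner K A wt M (M + 1) = ∑ m ∈ Finset.range (M + 1), wt m • (ad K ^ m) A := by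
  have key : ∀ m ≤ M + 1, horner K A wt M m =
      ∑ j ∈ Finset.range m, wt (M + 1 - m + j) • (ad K ^ j) A := by
    intro m
    induction m with
    | zero => simp [horner]
    | succ m ih =>
      intro hm
      rw [horner, ← ad_apply, ih (by omega), Finset.sum_range_succ', map_sum, add_comm]
      congr 1
      · refine Finset.sum_congr rfl fun j _ => ?_
        rw [map_smul, pow_succ', Module.End.mul_apply]
        congr 2
        omega
      · simp
  rw [key _ le_rfl]
  simp

/-- One step of Horner's scheme: the array `126` receives the new matrix, which is then copied to
the array `123`. -/
def hornerStepProg : Program :=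
  .seq (fillProg 124 (scalar 71) (scalar 71) (sumProg 127 (scalar 71)
      (.sub (.mul (.get 102 (scalar 124) (scalar 127)) (.get 123 (scalar 127) (scalar 125)))
        (.mul (.get 123 (scalar 124) (scalar 127)) (.get 102 (scalar 127) (scalar 125)))))
    (.add (.mul (.get 19 (.sub (scalar 6) (scalar 120)) (.const 0))
      (.get 107 (scalar 124) (scalar 125))) (numScalar 128)))
  (fillProg 121 (scalar 71) (scalar 71) .skip (.get 126 (scalar 121) (scalar 122)))

/-- Horner's scheme, with the result in the array `123`. -/
def hornerProg : Program :=
  .seq (fillProg 121 (scalar 71) (scalar 71) .skip (.const 0))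
    (forLoop 120 (.add (scalar 6) (.const 1)) hornerStepProg)

theorem halts_hornerProg {n M : ℕ} {K A : ℕ → ℕ → ℂ} {wt : ℕ → ℂ} (hn : s.nat 71 0 0 = n)
    (hM : s.nat 6 0 0 = M) (hwt : ∀ m ≤ M, s.num 19 m 0 = wt m)
    (hK : ∀ a < n, ∀ b < n, s.num 102 a b = K a b) (hA : ∀ a < n, ∀ b < n, s.num 107 a b = A a b)
    (hnN : n ≤ N) (hMN : M + 1 ≤ N) :
    Halts inp N hornerProg s fun s' => Frame 120 s s' ∧ ∀ a b : Fin n,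
      s'.num 123 a b = horner (tableMatrix n K) (tableMatrix n A) wt M (M + 1) a b := by
  have hn' : ∀ s', Frame 120 s s' → (scalar 71).eval inp s' = n := fun s' h => by
    rw [scalar_eval, (h 71 (by norm_num)).1, hn]
  refine .seq ((halts_fillProg (keep := 0) (fun _ _ => 0) (by norm_num) hnN hnN
    (fun s' h => hn' s' (h.mono (by norm_num))) (fun s' h => hn' s' (h.mono (by norm_num)))
    fun a ha b hb s₁ h1 h2 ha' hb' => .skip ⟨Frame.refl _ _, rfl, by simp [NumExpr.eval]⟩).mono ?_)
  rintro s₁ ⟨h1, -, h2⟩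
  have h1' : Frame 120 s s₁ := h1.mono (by norm_num)
  refine (Halts.forLoop hMN (fun s' h => ?_) (fun m s' => ∀ a b : Fin n,
      s'.num 123 a b = horner (tableMatrix n K) (tableMatrix n A) wt M m a b)
      (fun i s' y h => h) (fun a b => h2 a a.2 b b.2) ?_).mono fun s' h => ⟨h1'.trans h.1, h.2⟩
  · simp [NatExpr.eval, ((h1'.trans h) 6 (by norm_num)).1, hM]
  intro m s₂ hm h3 hc hJ
  have hf₂ := h1'.trans h3
  set Z := horner (tableMatrix n K) (tableMatrix n A) wt M m with hZ
  refine .seq ((halts_fillProg (keep := 0) (fun a b => wt (M - m) * A a b +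
    ∑ x ∈ Finset.range n, (K a x * s₂.num 123 x b - s₂.num 123 a x * K x b)) (by norm_num) hnN hnN
    (fun s' h => hn' s' (hf₂.trans (h.mono (by norm_num))))
    (fun s' h => hn' s' (hf₂.trans (h.mono (by norm_num)))) ?_).mono ?_)
  · intro a ha b hb s₃ h4 _ ha' hb'
    have hf₃ : Frame 120 s s₃ := hf₂.trans (h4.mono (by norm_num))
    refine (halts_sumProg (fun x => K a x * s₂.num 123 x b - s₂.num 123 a x * K x b) hnN
      (fun s' h => hn' s' (hf₃.trans (h.mono (by norm_num)))) fun x hx s' h hc' => ?_).mono ?_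
    · have hf' : Frame 120 s s' := hf₃.trans (h.mono (by norm_num))
      have e1 : s'.nat 124 0 0 = a := by rw [(h 124 (by norm_num)).1, ha']
      have e2 : s'.nat 125 0 0 = b := by rw [(h 125 (by norm_num)).1]; exact hb'
      have e3 : s'.num 123 = s₂.num 123 := by
        rw [(h 123 (by norm_num)).2, (h4 123 (by norm_num)).2]
      have e4 : s'.num 102 = s.num 102 := (hf' 102 (by norm_num)).2
      simp only [NumExpr.eval, scalar_eval, hc', e1, e2, e3, e4, hK a ha x hx, hK x hx b hb]
    · rintro s₄ ⟨h5, h6⟩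
      refine ⟨h5, (h5 0 (by norm_num)).2, ?_⟩
      have hf₄ : Frame 120 s s₄ := hf₃.trans (h5.mono (by norm_num))
      have e1 : s₄.nat 124 0 0 = a := by rw [(h5 124 (by norm_num)).1, ha']
      have e2 : s₄.nat 125 0 0 = b := by rw [(h5 125 (by norm_num)).1]; exact hb'
      have e3 : s₄.nat 120 0 0 = m := by
        rw [(h5 120 (by norm_num)).1, (h4 120 (by norm_num)).1, hc]
      simp only [NumExpr.eval, NatExpr.eval, scalar_eval, numScalar_eval, e1, e2, e3,
        (hf₄ 107 (by norm_num)).2, (hf₄ 6 (by norm_num)).1, (hf₄ 19 (by norm_num)).2, hM, h6,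
        hA a ha b hb, hwt (M - m) (by omega)]
  · rintro s₃ ⟨h4, -, h5⟩
    have hf₃ : Frame 120 s s₃ := hf₂.trans (h4.mono (by norm_num))
    refine (halts_fillProg (keep := 126) (fun a b => s₃.num 126 a b) (by norm_num) hnN hnN
      (fun s' h => hn' s' (hf₃.trans (h.mono (by norm_num))))
      (fun s' h => hn' s' (hf₃.trans (h.mono (by norm_num))))
      fun a ha b hb s₄ h6 h7 ha' hb' => .skip ⟨Frame.refl _ _, rfl, ?_⟩).mono ?_
    · simp only [NumExpr.eval, scalar_eval, h7, ha']
      rw [show s₄.nat 122 0 0 = b from hb']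
    · rintro s₄ ⟨h6, -, h7⟩
      refine ⟨(h4.mono (by norm_num)).trans h6, fun a b => ?_⟩
      rw [h7 a a.2 b b.2, h5 a a.2 b b.2, horner]
      simp only [Matrix.add_apply, Matrix.smul_apply, Matrix.sub_apply, Matrix.mul_apply,
        tableMatrix, Matrix.of_apply, smul_eq_mul, ← Finset.sum_sub_distrib, Finset.sum_range]
      simp only [hJ, hZ]
      rfl

/-- Stores in the number `132` the trace of the product of the matrices in the arrays `123`
and `112`. -/
def traceProg : Program :=
  .seq (numAssign 132 (.const 0)) (forLoop 130 (scalar 71) (forLoop 131 (scalar 71)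
    (numAssign 132 (.add (numScalar 132)
      (.mul (.get 123 (scalar 130) (scalar 131)) (.get 112 (scalar 131) (scalar 130)))))))

theorem halts_traceProg {n : ℕ} {Z R : Matrix (Fin n) (Fin n) ℂ} (hn : s.nat 71 0 0 = n)
    (hZ : ∀ a b : Fin n, s.num 123 a b = Z a b) (hR : ∀ a b : Fin n, s.num 112 a b = R a b)
    (hnN : n ≤ N) :
    Halts inp N traceProg s fun s' => Frame 130 s s' ∧ s'.num 132 0 0 = (Z * R).trace := by
  have hf : ∀ x, Frame 130 s (s.setNum 132 0 0 x) := fun x => (Frame.refl _ _).setNum (by norm_num)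
  refine .seq (.numAssign ?_)
  refine (Halts.forLoop hnN (fun s' h => ?_) (fun i s' => s'.num 132 0 0 =
    ∑ a ∈ Finset.range i, ∑ b ∈ Finset.range n, s.num 123 a b * s.num 112 b a)
    (fun i s' y h => h) (by simp [NumExpr.eval]) ?_).mono ?_
  · rw [scalar_eval, (((hf _).trans h) 71 (by norm_num)).1, hn]
  · intro a s₁ ha h hc hJ
    have hf₁ := (hf _).trans h
    refine (Halts.forLoop hnN (fun s' h => ?_) (fun i s' => s'.num 132 0 0 =
      ∑ a ∈ Finset.range a, ∑ b ∈ Finset.range n, s.num 123 a b * s.num 112 b a +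
        ∑ b ∈ Finset.range i, s.num 123 a b * s.num 112 b a)
      (fun i s' y h => h) (by simpa using hJ) ?_).mono ?_
    · rw [scalar_eval, ((hf₁.trans (h.mono (by norm_num))) 71 (by norm_num)).1, hn]
    · intro b s₂ hb h' hc' hJ'
      have hf₂ := hf₁.trans (h'.mono (by norm_num))
      refine .numAssign ⟨(Frame.refl _ _).setNum (by norm_num), ?_⟩
      rw [Finset.sum_range_succ, ← add_assoc, ← hJ']
      simp [NumExpr.eval, hc', (h' 130 (by norm_num)).1, hc, (hf₂ 123 (by norm_num)).2,
        (hf₂ 112 (by norm_num)).2]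
    · rintro s₂ ⟨h1, h2⟩
      refine ⟨h1, ?_⟩
      rw [h2, Finset.sum_range_succ]
  · rintro s' ⟨h1, h2⟩
    refine ⟨(hf _).trans h1, h2.trans ?_⟩
    simp only [Matrix.trace, Matrix.diag_apply, Matrix.mul_apply, Finset.sum_range, hZ, hR]

/-- Stores the sign of the labelling in the number `136`. -/
def signProg : Program :=
  .seq (numAssign 136 (.const 1)) (forLoop 135 (scalar 7)
    (.ite (.natEq (.get 43 (.const 0) (scalar 135)) (.const 2))
      (numAssign 136 (.sub (.const 0) (numScalar 136))) .skip))

theorem halts_signProg {L : ℕ} {D : ℕ → ℕ} (hL : s.nat 7 0 0 = L)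
    (hD : ∀ q < L, s.nat 43 0 q = D q) (hLN : L ≤ N) :
    Halts inp N signProg s fun s' => Frame 135 s s' ∧ s'.num 136 0 0 = sign D L := by
  have hf : ∀ x, Frame 135 s (s.setNum 136 0 0 x) := fun x => (Frame.refl _ _).setNum (by norm_num)
  refine .seq (.numAssign ?_)
  refine (Halts.forLoop hLN (fun s' h => ?_) (fun i s' => s'.num 136 0 0 = sign D i)
    (fun i s' y h => h) (by simp [NumExpr.eval, sign]) ?_).mono fun s' h => ⟨(hf _).trans h.1, h.2⟩
  · rw [scalar_eval, (((hf _).trans h) 7 (by norm_num)).1, hL]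
  · intro q s₁ hq h hc hJ
    have hiff : (Test.natEq (.get 43 (.const 0) (scalar 135)) (.const 2)).Holds inp s₁ ↔
        D q = 2 := by
      rw [Test.natEq_holds]
      simp only [NatExpr.eval, scalar_eval, hc, (((hf _).trans h) 43 (by norm_num)).1]
      rw [hD q hq]
    refine .ite (fun hb => .numAssign ⟨(Frame.refl _ _).setNum (by norm_num), ?_⟩)
      fun hb => .skip ⟨Frame.refl _ _, ?_⟩
    · rw [sign, Finset.prod_range_succ, if_pos (hiff.1 hb)]
      simp [NumExpr.eval, hJ, sign]
    · rw [sign, Finset.prod_range_succ, if_neg (fun h => hb (hiff.2 h)), mul_one, hJ, sign]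

/-- Adds the contribution of a valid labelling to the number `41`. -/
def contributionProg (d : ℕ) : Program :=
  .seq sitesProg (.seq (powersProg d) (.seq positionsProg (.seq (digitTableProg d)
  (.seq restrictProg (.seq hamiltonianProg (.seq observableProg (.seq stateProg
  (.seq hornerProg (.seq traceProg (.seq signProg
    (numAssign 41 (.add (numScalar 41) (.mul (numScalar 136) (numScalar 132))))))))))))))

/-- The expectation of the polynomial in nested commutators, computed on the sites of the
subsystems in `Q`, with the partial Hamiltonian given by the label `1`. -/
noncomputable def localExpectation (inp : Input) (d : ℕ) (wt : ℕ → ℂ) (M : ℕ) (D : ℕ → ℕ)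
    (Q : List ℕ) : ℂ :=
  (horner (tableMatrix (d ^ (sites inp Q).length) (hamiltonianEntry inp d D Q (sites inp Q)))
    (tableMatrix _ (observableEntry inp d Q (sites inp Q))) wt M (M + 1) *
    tableMatrix _ (stateEntry inp d (sites inp Q))).trace

variable {d M L : ℕ} {D : ℕ → ℕ} {Q : List ℕ} {wt : ℕ → ℂ}

theorem halts_contributionProg (hd : 0 < d) (hL : s.nat 7 0 0 = L) (hM : s.nat 6 0 0 = M)
    (hwt : ∀ m ≤ M, s.num 19 m 0 = wt m) (hD : ∀ q < L, s.nat 43 0 q = D q)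
    (hQ : IsList s 54 Q) (hQ0 : 0 < Q.length) (hQL : Q.length ≤ L)
    (hpos : ∀ i < Q.length, ∀ j < inp.nat 1 (Q.getD i 0) 0, j < (sites inp Q).length ∧
      (sites inp Q).idxOf (inp.nat 2 (Q.getD i 0) j) < (sites inp Q).length)
    (hLN : L ≤ N) (hMN : M + 1 ≤ N) (hdN : d ≤ N) (hyN : (sites inp Q).length ≤ N)
    (hYN : d ^ (sites inp Q).length ≤ N) (hsize : ∀ i, inp.nat 1 i 0 ≤ N) :
    Halts inp N (contributionProg d) s fun s' => Frame 41 s s' ∧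
      s'.num 41 0 0 = s.num 41 0 0 + sign D L * localExpectation inp d wt M D Q := by
  have hQN := hQL.trans hLN
  have hnodup : (sites inp Q).Nodup := nodup_foldl_push _ List.nodup_nil
  set Y := sites inp Q with hY
  refine .seq ((halts_sitesProg hQ hQN hyN hsize).mono ?_)
  rintro s₁ ⟨f₁, l₁⟩
  refine .seq ((halts_powersProg (d := d) l₁.1 hyN hdN).mono ?_)
  rintro s₂ ⟨f₂, c₂, p₂⟩
  have q₂ := (hQ.frame f₁ (by norm_num)).frame f₂ (by norm_num)
  refine .seq ((halts_positionsProg q₂ (l₁.frame f₂ (by norm_num)) hnodup hQN hyN hsize).mono ?_)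
  rintro s₃ ⟨f₃, p₃⟩
  have c₃ : s₃.nat 71 0 0 = d ^ Y.length := by rw [(f₃ 71 (by norm_num)).1, c₂]
  have l₃ := (l₁.frame f₂ (by norm_num)).frame f₃ (by norm_num)
  refine .seq ((halts_digitTableProg hd c₃ l₃.1 hYN hyN).mono ?_)
  rintro s₄ ⟨f₄, g₄⟩
  have T₄ : Tables inp s₄ d Q Y :=
    { listQ := (q₂.frame f₃ (by norm_num)).frame f₄ (by norm_num)
      listY := l₃.frame f₄ (by norm_num)
      card := by rw [(f₄ 71 (by norm_num)).1, c₃]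
      power := by rw [(f₄ 73 (by norm_num)).1, (f₃ 73 (by norm_num)).1]; exact p₂
      position := by rw [(f₄ 79 (by norm_num)).1]; exact p₃
      digit := g₄ }
  have F₄ : Frame 60 s s₄ := ((f₁.trans (f₂.mono (by norm_num))).trans (f₃.mono (by norm_num))).trans
    (f₄.mono (by norm_num))
  refine .seq ((halts_restrictProg hd T₄ hpos hQN hYN hsize).mono ?_)
  rintro s₅ ⟨f₅, r₅⟩
  have F₅ : Frame 60 s s₅ := F₄.trans (f₅.mono (by norm_num))
  have T₅ : FullTables inp s₅ d D Q Y :=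
    { toTables := T₄.frame f₅
      label := by
        intro q hq
        rw [(F₅ 43 (by norm_num)).1]
        exact hD q (hq.trans_le hQL)
      restrict := r₅ }
  refine .seq ((halts_hamiltonianProg T₅ hQN hYN).mono ?_)
  rintro s₆ ⟨f₆, h₆⟩
  refine .seq ((halts_observableProg (T₅.frame f₆) hQ0 hYN).mono ?_)
  rintro s₇ ⟨f₇, h₇⟩
  have F₇ := f₆.trans (f₇.mono (by norm_num))
  refine .seq ((halts_stateProg (T₅.frame F₇) hyN hYN).mono ?_)
  rintro s₈ ⟨f₈, h₈⟩
  have T₈ := T₅.frame (F₇.trans (f₈.mono (by norm_num)))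
  have F₈ : Frame 60 s s₈ := F₅.trans ((F₇.mono (by norm_num)).trans (f₈.mono (by norm_num)))
  refine .seq ((halts_hornerProg (M := M) (wt := wt)
    (K := hamiltonianEntry inp d D Q Y) (A := observableEntry inp d Q Y) T₈.card ?_
    (fun m hm => ?_) (fun a ha b hb => ?_)
    (fun a ha b hb => ?_) hYN hMN).mono ?_)
  · rw [(F₈ 6 (by norm_num)).1, hM]
  · rw [(F₈ 19 (by norm_num)).2, hwt m hm]
  · rw [(f₈ 102 (by norm_num)).2, (f₇ 102 (by norm_num)).2]
    exact h₆ a ha b hb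
  · rw [(f₈ 107 (by norm_num)).2]
    exact h₇ a ha b hb
  rintro s₉ ⟨f₉, h₉⟩
  have T₉ := T₈.frame (f₉.mono (by norm_num))
  have F₉ : Frame 60 s s₉ := F₈.trans (f₉.mono (by norm_num))
  refine .seq ((halts_traceProg T₉.card h₉ (R := tableMatrix _ (stateEntry inp d Y))
    (fun a b => ?_) hYN).mono ?_)
  · rw [(f₉ 112 (by norm_num)).2]
    exact h₈ a a.2 b b.2
  rintro s₁₀ ⟨f₁₀, h₁₀⟩
  have F₁₀ : Frame 60 s s₁₀ := F₉.trans (f₁₀.mono (by norm_num))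
  refine .seq ((halts_signProg (L := L) (D := D) ?_ (fun q hq => ?_) hLN).mono ?_)
  · rw [(F₁₀ 7 (by norm_num)).1, hL]
  · rw [(F₁₀ 43 (by norm_num)).1, hD q hq]
  rintro s₁₁ ⟨f₁₁, h₁₁⟩
  have F₁₁ : Frame 60 s s₁₁ := F₁₀.trans (f₁₁.mono (by norm_num))
  refine .numAssign ⟨(F₁₁.mono (by norm_num)).setNum (by norm_num), ?_⟩
  have e132 := congrFun (congrFun (f₁₁ 132 (by norm_num)).2 0) 0
  rw [h₁₀] at e132
  simp only [NumExpr.eval, numScalar_eval, Memory.setNum_num, and_self, if_true,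
    (F₁₁ 41 (by norm_num)).2, h₁₁, e132]
  rfl

/-- The sum over all labellings. -/
def labellingsProg (d : ℕ) : Program :=
  .seq (numAssign 41 (.const 0)) (forLoop 40 (scalar 9)
    (.seq (digitsProg 3 42 (scalar 40) (scalar 7) (.const 0))
    (.seq exploreProg
      (.ite (.and (.natEq (scalar 51) (.const 1)) (.natLE (scalar 55) (scalar 7)))
        (contributionProg d) .skip))))

open Classical in
theorem halts_labellingsProg {r : ℕ} (hd : 0 < d) (hL : s.nat 7 0 0 = L) (hL0 : 0 < L)
    (hM : s.nat 6 0 0 = M) (hE : s.nat 9 0 0 = 3 ^ L) (hwt : ∀ m ≤ M, s.num 19 m 0 = wt m)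
    (hr : inp.nat 0 2 0 = r)
    (hpos : ∀ D, Valid (nbs inp) r L D → ∀ i < (explore (nbs inp) r D L).length,
      ∀ j < inp.nat 1 ((explore (nbs inp) r D L).getD i 0) 0,
        j < (sites inp (explore (nbs inp) r D L)).length ∧
        (sites inp (explore (nbs inp) r D L)).idxOf
          (inp.nat 2 ((explore (nbs inp) r D L).getD i 0) j) <
        (sites inp (explore (nbs inp) r D L)).length)
    (hEN : 3 ^ L ≤ N) (hLN : L ≤ N) (hMN : M + 1 ≤ N) (hdN : d ≤ N)
    (hlen : ∀ D, ∀ p ≤ L, (explore (nbs inp) r D p).length ≤ N) (hdeg : ∀ i, inp.nat 3 i 0 ≤ N)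
    (hyN : ∀ D, Valid (nbs inp) r L D → (sites inp (explore (nbs inp) r D L)).length ≤ N)
    (hYN : ∀ D, Valid (nbs inp) r L D → d ^ (sites inp (explore (nbs inp) r D L)).length ≤ N)
    (hsize : ∀ i, inp.nat 1 i 0 ≤ N) :
    Halts inp N (labellingsProg d) s fun s' => s'.num 41 0 0 = ∑ c ∈ Finset.range (3 ^ L),
      if Valid (nbs inp) r L (label c) then sign (label c) L *
        localExpectation inp d wt M (label c) (explore (nbs inp) r (label c) L) else 0 := by
  have hf : ∀ x, Frame 40 s (s.setNum 41 0 0 x) := fun x => (Frame.refl _ _).setNum (by norm_num)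
  refine .seq (.numAssign ?_)
  refine (Halts.forLoop hEN (fun s' h => ?_) (fun i s' => s'.num 41 0 0 =
    ∑ c ∈ Finset.range i,
      if Valid (nbs inp) r L (label c) then sign (label c) L *
        localExpectation inp d wt M (label c) (explore (nbs inp) r (label c) L) else 0)
    (fun i s' y h => h) (by simp [NumExpr.eval]) ?_).mono fun s' h => h.2
  · rw [scalar_eval, (((hf _).trans h) 9 (by norm_num)).1, hE]
  intro c s₁ hc h hc₁ hJ
  have F₁ := (hf _).trans h
  have hL₁ : s₁.nat 7 0 0 = L := by rw [(F₁ 7 (by norm_num)).1, hL]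
  refine .seq ((halts_digitsProg (by norm_num) (X := c) (n := L) (r := 0) (by simp [hc₁])
    (fun s' h' => ?_) (fun s' h' => rfl) (hc.le.trans hEN) hLN).mono ?_)
  · rw [scalar_eval, (h' 7 (by norm_num)).1, hL₁]
  rintro s₂ ⟨f₂, hD₂, -⟩
  have hD₂' : ∀ q < L, s₂.nat 43 0 q = label c q := hD₂
  have hL₂ : s₂.nat 7 0 0 = L := by rw [(f₂ 7 (by norm_num)).1, hL₁]
  refine .seq ((halts_exploreProg hL₂ hL0 hD₂' hr hLN (hlen _) hdeg).mono ?_)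
  rintro s₃ ⟨f₃, hQ₃, hv₃⟩
  have F₃ : Frame 42 s₁ s₃ := f₂.trans (f₃.mono (by norm_num))
  have F₃' : Frame 40 s s₃ := F₁.trans (F₃.mono (by norm_num))
  have hL₃ : s₃.nat 7 0 0 = L := by rw [(F₃ 7 (by norm_num)).1, hL₁]
  have hiff : Test.Holds inp s₃ (.and (.natEq (scalar 51) (.const 1))
      (.natLE (scalar 55) (scalar 7))) ↔ Valid (nbs inp) r L (label c) := by
    rw [Test.Holds, Test.natEq_holds]
    simp only [Test.Holds, NatExpr.eval, scalar_eval, hv₃, hL₃,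
      show s₃.nat 55 0 0 = _ from hQ₃.1, Valid]
    constructor
    · rintro ⟨h1, h2⟩
      have h3 : label c 0 = 1 ∧ Canonical (nbs inp) r (label c) L := by
        by_contra h3
        rw [if_neg h3] at h1
        exact absurd h1 (by norm_num)
      tauto
    · rintro ⟨h1, h2, h3⟩
      exact ⟨if_pos (by tauto), by tauto⟩
  rw [Finset.sum_range_succ]
  refine .ite (fun hb => ?_) fun hb => .skip ⟨F₃.mono (by norm_num), ?_⟩
  · have hval := hiff.1 hb
    rw [if_pos hval]
    have hb' := hb.2
    simp only [Test.Holds, scalar_eval, hL₃, show s₃.nat 55 0 0 = _ from hQ₃.1] at hb'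
    refine (halts_contributionProg (M := M) (wt := wt) (D := label c)
      (Q := explore (nbs inp) r (label c) L) hd hL₃ ?_ (fun m hm => ?_) (fun q hq => ?_) hQ₃
      (List.length_pos_of_mem (mem_explore_self L)) hb' (hpos _ hval) hLN hMN hdN (hyN _ hval)
      (hYN _ hval) hsize).mono ?_
    · rw [(F₃' 6 (by norm_num)).1, hM]
    · rw [(F₃' 19 (by norm_num)).2, hwt m hm]
    · rw [(f₃ 43 (by norm_num)).1, hD₂' q hq]
    · rintro s₄ ⟨f₄, h₄⟩
      refine ⟨(F₃.mono (by norm_num)).trans f₄, ?_⟩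
      rw [h₄, (F₃ 41 (by norm_num)).2, hJ]
  · rw [if_neg fun h => hb (hiff.2 h), add_zero, (F₃ 41 (by norm_num)).2, hJ]

end SpinSim

namespace SpinSim

/-! ### Parameters and weights -/

variable {inp : Input} {N : ℕ} {s s' : Memory}

/-- Counts in the number `a` until the test `b` succeeds, and updates the complex number `a` by
the value of `e`. -/
def searchProg (a : ℕ) (b : Test) (z : ℚ) (e : NumExpr) : Program :=
  .seq (assign a (.const 0)) (.seq (numAssign a (.const z))
    (.while (.not b) (.seq (assign a (.add (scalar a) (.const 1))) (numAssign a e))))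

/-- The test is satisfied for the first time at `l`, and the complex number `a` runs through the
values of `g`. -/
theorem halts_searchProg {a l : ℕ} {b : Test} {z : ℚ} {e : NumExpr} {p : ℕ → Prop} (g : ℕ → ℂ)
    (hl : p l) (hmin : ∀ i < l, ¬ p i) (hlN : l ≤ N) (h0 : g 0 = z)
    (hb : ∀ i s', s'.nat a 0 0 = i → s'.num a 0 0 = g i → (b.Holds inp s' ↔ p i))
    (he : ∀ i s', s'.num a 0 0 = g i → e.eval inp s' = g (i + 1)) :
    Halts inp N (searchProg a b z e) s fun s' => Frame a s s' ∧ s'.nat a 0 0 = l ∧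
      s'.num a 0 0 = g l := by
  refine .seq (.assign (.seq (.numAssign (Halts.while hlN
    (fun i s' => Frame a s s' ∧ s'.nat a 0 0 = i ∧ s'.num a 0 0 = g i) ?_ ?_ ?_))))
  · exact ⟨((Frame.refl _ _).setNat le_rfl).setNum le_rfl, by simp [NatExpr.eval],
      by simp [NumExpr.eval, h0]⟩
  · rintro i s' hi ⟨-, h1, h2⟩
    rw [Test.Holds, hb i s' h1 h2]
    constructor
    · intro h
      exact lt_of_le_of_ne hi fun h' => h (h' ▸ hl)
    · exact hmin i
  · rintro i s' hi ⟨h, h1, h2⟩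
    refine .seq (.assign (.numAssign ⟨(h.setNat le_rfl).setNum le_rfl, ?_, ?_⟩))
    · simp [NatExpr.eval, h1]
    · simp [he i _ (show (s'.setNat a 0 0 _).num a 0 0 = g i from h2)]

/-- The expression for a constant multiple. -/
def NatExpr.times : ℕ → NatExpr → NatExpr
  | 0, _ => .const 0
  | k + 1, e => .add (NatExpr.times k e) e

@[simp] theorem NatExpr.eval_times (k : ℕ) (e : NatExpr) :
    (NatExpr.times k e).eval inp s = k * e.eval inp s := by
  induction k with
  | zero => simp [NatExpr.times, NatExpr.eval]
  | succ k ih => simp [NatExpr.times, NatExpr.eval, ih, add_mul]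

/-- The time. -/
def timeExpr : NumExpr := .input 0 (.const 0) (.const 0) (.const 0)

/-- The error bound. -/
def errorExpr : NumExpr := .input 0 (.const 1) (.const 0) (.const 0)

/-- Determines the parameters of the approximation: the order `M` in the number `6`, the number of
labels in `7`, the number of labellings in `9`, and the scale of the logarithm in the complex
number `10`. -/
def parametersProg (deg : ℕ) : Program :=
  .seq (searchProg 1 (.numLE (.const 1) (.mul (numScalar 1) errorExpr)) 1
    (.add (numScalar 1) (numScalar 1)))
  (.seq (searchProg 2 (.numLE (.add (.mul (.const (20 * deg)) timeExpr) (.const 1)) (numScalar 2)) 0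
    (.add (numScalar 2) (.const 1)))
  (.seq (assign 4 (.const 2)) (.seq (numAssign 4 (.const 1))
  (.seq (forLoop 3 (scalar 2) (.seq (assign 4 (.add (scalar 4) (scalar 4)))
    (numAssign 4 (.mul (numScalar 4) (.const (1 / 2))))))
  (.seq (assign 6 (.const 0))
  (.seq (forLoop 5 (.add (.add (scalar 1) (scalar 2)) (.const 3))
    (assign 6 (.add (scalar 6) (scalar 4))))
  (.seq (assign 7 (.add (.times deg (.add (scalar 6) (.const 1))) (.const 1)))
  (.seq (assign 9 (.const 1))
  (.seq (forLoop 8 (scalar 7) (assign 9 (.add (.add (scalar 9) (scalar 9)) (scalar 9))))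
    (numAssign 10 (.sub (.const 1) (numScalar 4))))))))))))

/-- Logarithms and roundings are not available to the program: `l` and `k` are found by counting,
and powers of two by doubling. -/
theorem halts_parametersProg {deg l k M L : ℕ} {t ε : ℝ} (ht : inp.num 0 0 0 0 = t)
    (hε : inp.num 0 1 0 0 = ε) (hl : 1 ≤ 2 ^ l * ε) (hl' : ∀ i < l, ¬ 1 ≤ 2 ^ i * ε)
    (hk : 20 * deg * t + 1 ≤ k) (hk' : ∀ i : ℕ, i < k → ¬ 20 * deg * t + 1 ≤ i)
    (hM : 2 ^ (k + 1) * (l + k + 3) = M) (hL : deg * (M + 1) + 1 = L)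
    (hlN : l + k + 3 ≤ N) (hLN : L ≤ N) :
    Halts inp N (parametersProg deg) s fun s' => s'.nat 6 0 0 = M ∧ s'.nat 7 0 0 = L ∧
      s'.nat 9 0 0 = 3 ^ L ∧ s'.num 10 0 0 = ((1 - (1 / 2) ^ k : ℝ) : ℂ) := by
  refine .seq ((halts_searchProg (l := l) (p := fun i => 1 ≤ 2 ^ i * ε) (fun i => 2 ^ i) hl hl'
    (by omega) (by simp) (fun i s' h1 h2 => ?_) fun i s' h => ?_).mono ?_)
  · simp only [Test.Holds, NumExpr.eval, NatExpr.eval, numScalar_eval, errorExpr, hε, h2]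
    have : ((2 : ℂ) ^ i * (ε : ℂ)) = ((2 ^ i * ε : ℝ) : ℂ) := by push_cast; ring
    rw [this, Complex.ofReal_re]
    simp
  · simp only [NumExpr.eval, numScalar_eval, h]
    ring
  rintro s₁ ⟨-, a₁, -⟩
  refine .seq ((halts_searchProg (l := k) (p := fun i => 20 * deg * t + 1 ≤ i) (fun i => i) hk hk'
    (by omega) (by simp) (fun i s' h1 h2 => ?_) fun i s' h => ?_).mono ?_)
  · simp only [Test.Holds, NumExpr.eval, NatExpr.eval, numScalar_eval, timeExpr, ht, h2]
    have : (((20 * deg : ℚ) : ℂ) * (t : ℂ) + ((1 : ℚ) : ℂ)) = ((20 * deg * t + 1 : ℝ) : ℂ) := by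
      push_cast; ring
    rw [this, Complex.ofReal_re, Complex.natCast_re]
  · simp [NumExpr.eval, h]
  rintro s₂ ⟨f₂, a₂, -⟩
  refine .seq (.assign (.seq (.numAssign ?_)))
  set s₃ := (s₂.setNat 4 0 0 ((NatExpr.const 2).eval inp s₂)).setNum 4 0 0
    ((NumExpr.const 1).eval inp (s₂.setNat 4 0 0 ((NatExpr.const 2).eval inp s₂))) with hs₃
  have f₃ : Frame 3 s₂ s₃ := ((Frame.refl _ _).setNat (by norm_num)).setNum (by norm_num)
  refine .seq ((Halts.forLoop (n := k) (by omega) (fun s' h => ?_)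
    (fun i s' => s'.nat 4 0 0 = 2 ^ (i + 1) ∧ s'.num 4 0 0 = ((1 / 2 : ℝ) ^ i : ℝ))
    (fun i s' y h => ⟨by simpa using h.1, h.2⟩) ?_ ?_).mono ?_)
  · rw [scalar_eval, ((f₃.trans h) 2 (by norm_num)).1, a₂]
  · simp [hs₃, NatExpr.eval, NumExpr.eval]
  · rintro i s' - - - ⟨h1, h2⟩
    refine .seq (.assign (.numAssign ⟨((Frame.refl _ _).setNat (by norm_num)).setNum (by norm_num),
      ?_, ?_⟩))
    · simp [NatExpr.eval, h1]
      ring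
    · simp [NumExpr.eval, h2, pow_succ]
  rintro s₄ ⟨f₄, a₄, b₄⟩
  refine .seq (.assign (.seq ?_))
  set s₅ := s₄.setNat 6 0 0 ((NatExpr.const 0).eval inp s₄) with hs₅
  have f₅ : Frame 5 s₄ s₅ := (Frame.refl _ _).setNat (by norm_num)
  have F₅ : Frame 3 s₂ s₅ := (f₃.trans f₄).trans (f₅.mono (by norm_num))
  refine (Halts.forLoop hlN (fun s' h => ?_) (fun i s' => s'.nat 6 0 0 = 2 ^ (k + 1) * i)
    (fun i s' y h => by simpa using h) ?_ ?_).mono ?_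
  · have F := F₅.trans (h.mono (by norm_num))
    simp [NatExpr.eval, (F 1 (by norm_num)).1, (F 2 (by norm_num)).1, (f₂ 1 (by norm_num)).1, a₁,
      a₂]
  · simp [hs₅, NatExpr.eval]
  · intro i s' _ h _ h1
    refine .assign ⟨(Frame.refl _ _).setNat (by norm_num), ?_⟩
    have : s'.nat 4 0 0 = 2 ^ (k + 1) := by rw [((f₅.trans h) 4 (by norm_num)).1, a₄]
    simp [NatExpr.eval, h1, this]
    ring
  rintro s₆ ⟨f₆, a₆⟩
  rw [hM] at a₆
  have b₆ : s₆.num 4 0 0 = ((1 / 2 : ℝ) ^ k : ℝ) := by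
    rw [((f₅.trans f₆) 4 (by norm_num)).2, b₄]
  refine .seq (.assign (.seq (.assign (.seq ?_))))
  simp only [NatExpr.eval, NatExpr.eval_times, scalar_eval, a₆, hL]
  set s₇ := (s₆.setNat 7 0 0 L).setNat 9 0 0 1 with hs₇
  refine (Halts.forLoop hLN (fun s' h => ?_) (fun i s' => s'.nat 9 0 0 = 3 ^ i)
    (fun i s' y h => by simpa using h) ?_ ?_).mono ?_
  · rw [scalar_eval, (h 7 (by norm_num)).1]
    simp [hs₇]
  · simp [hs₇]
  · intro i s' _ h _ h1
    refine .assign ⟨(Frame.refl _ _).setNat (by norm_num), ?_⟩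
    simp [NatExpr.eval, h1]
    ring
  rintro s₈ ⟨f₈, a₈⟩
  have b₈ : s₈.num 4 0 0 = ((1 / 2 : ℝ) ^ k : ℝ) := by
    rw [(f₈ 4 (by norm_num)).2]
    simpa [hs₇] using b₆
  refine .numAssign ⟨?_, ?_, ?_, ?_⟩
  · rw [Memory.setNum_nat, (f₈ 6 (by norm_num)).1]
    simpa [hs₇] using a₆
  · rw [Memory.setNum_nat, (f₈ 7 (by norm_num)).1]
    simp [hs₇]
  · simpa using a₈
  · simp [NumExpr.eval, b₈]

/-- The coefficients of the logarithm in the array `12`, and their sum in the number `15`. -/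
def logarithmProg : Program :=
  .seq (.setNum 12 (.const 0) (.const 0) (.const 0)) (.seq (numAssign 13 (.const 0))
  (.seq (numAssign 14 (.const 1)) (.seq (numAssign 15 (.const 0))
  (forLoop 11 (scalar 6) (.seq (numAssign 13 (.add (numScalar 13) (.const 1)))
    (.seq (numAssign 14 (.mul (numScalar 14) (numScalar 10)))
    (.seq (.setNum 12 (.add (scalar 11) (.const 1)) (.const 0) (.div (numScalar 14) (numScalar 13)))
      (numAssign 15 (.add (numScalar 15) (.div (numScalar 14) (numScalar 13)))))))))))

theorem eval_one_logPoly (w : ℝ) (M : ℕ) :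
    (logPoly w M).eval 1 = ∑ j ∈ Finset.range M, w ^ (j + 1) / (j + 1 : ℕ) := by
  rw [Polynomial.eval_eq_sum_range' (n := M + 1)]
  · rw [Finset.sum_range_succ']
    simp only [coeff_logPoly, one_pow, mul_one]
    rw [if_neg (by simp), add_zero]
    refine Finset.sum_congr rfl fun j hj => ?_
    rw [if_pos ⟨by omega, by have := Finset.mem_range.1 hj; omega⟩]
  · refine Nat.lt_succ_of_le (Polynomial.natDegree_le_iff_coeff_eq_zero.2 fun j hj => ?_)
    rw [coeff_logPoly, if_neg (by omega)]

theorem halts_logarithmProg {M : ℕ} {w : ℝ} (hM : s.nat 6 0 0 = M) (hw : s.num 10 0 0 = w)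
    (hMN : M ≤ N) :
    Halts inp N logarithmProg s fun s' => Frame 11 s s' ∧
      (∀ j ≤ M, s'.num 12 j 0 = (((logPoly w M).coeff j : ℝ) : ℂ)) ∧
      s'.num 15 0 0 = (((logPoly w M).eval 1 : ℝ) : ℂ) := by
  refine .seq (.setNum (.seq (.numAssign (.seq (.numAssign (.seq (.numAssign ?_)))))))
  simp only [NatExpr.eval, NumExpr.eval]
  set s₁ := (((s.setNum 12 0 0 ((0 : ℚ) : ℂ)).setNum 13 0 0 ((0 : ℚ) : ℂ)).setNum 14 0 0
    ((1 : ℚ) : ℂ)).setNum 15 0 0 ((0 : ℚ) : ℂ) with hs₁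
  have f₁ : Frame 11 s s₁ := ((((Frame.refl _ _).setNum (by norm_num)).setNum (by norm_num)).setNum
    (by norm_num)).setNum (by norm_num)
  refine (Halts.forLoop hMN (fun s' h => ?_) (fun i s' => s'.num 13 0 0 = i ∧
    s'.num 14 0 0 = w ^ i ∧ (∀ j ≤ i, s'.num 12 j 0 = if 1 ≤ j then (w : ℂ) ^ j / j else 0) ∧
    s'.num 15 0 0 = ∑ j ∈ Finset.range i, (w : ℂ) ^ (j + 1) / (j + 1 : ℕ))
    (fun i s' y h => h) ?_ ?_).mono ?_
  · rw [scalar_eval, ((f₁.trans h) 6 (by norm_num)).1, hM]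
  · simp [hs₁]
  · rintro i s' hi h hc ⟨h1, h2, h3, h4⟩
    have h10 : s'.num 10 0 0 = w := by rw [((f₁.trans h) 10 (by norm_num)).2, hw]
    refine .seq (.numAssign (.seq (.numAssign (.seq (.setNum (.numAssign
      ⟨(((((Frame.refl _ _).setNum (by norm_num)).setNum (by norm_num)).setNum
    (by norm_num)).setNum (by norm_num)), ?_, ?_, fun j hj => ?_, ?_⟩))))))
    · simp [NumExpr.eval, h1]
    · simp [NumExpr.eval, h2, h10, pow_succ]
    · rcases Nat.le_succ_iff.1 hj with h5 | rfl
      · have : j ≠ i + 1 := by omega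
        simp [NatExpr.eval, hc, this, h3 j h5]
      · simp [NumExpr.eval, NatExpr.eval, hc, h1, h2, h10, pow_succ]
    · rw [Finset.sum_range_succ]
      simp [NumExpr.eval, h1, h2, h4, h10, pow_succ]
  · rintro s' ⟨h, -, -, h3, h4⟩
    refine ⟨f₁.trans h, fun j hj => ?_, ?_⟩
    · rw [h3 j hj, coeff_logPoly]
      by_cases h5 : 1 ≤ j
      · rw [if_pos h5, if_pos ⟨h5, hj⟩]
        push_cast
        rfl
      · rw [if_neg h5, if_neg (fun h => h5 h.1)]
        simp
    · rw [h4, eval_one_logPoly]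
      push_cast
      rfl

/-- The coefficients of the powers of the rescaled logarithm, with the factor `iᵐ / m!`. -/
noncomputable def weightTerm (t w : ℝ) (M m j : ℕ) : ℂ :=
  Complex.I ^ m / m.factorial *
    (((Polynomial.C (t / (logPoly w M).eval 1) * logPoly w M) ^ m).coeff j : ℝ)

/-- The recursion by which the program computes the numbers: multiplication of a power of the
rescaled logarithm by one more factor. -/
theorem weightTerm_succ (t w : ℝ) (M m j : ℕ) : weightTerm t w M (m + 1) j =
    (∑ i ∈ Finset.range (j + 1), weightTerm t w M m i * (((logPoly w M).coeff (j - i) : ℝ) : ℂ)) *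
      (t / (((logPoly w M).eval 1 : ℝ) : ℂ)) * Complex.I / (m + 1) := by
  rw [weightTerm, pow_succ (Polynomial.C _ * _), Polynomial.coeff_mul,
    Finset.Nat.sum_antidiagonal_eq_sum_range_succ_mk, Nat.factorial_succ]
  simp only [weightTerm, Polynomial.coeff_C_mul]
  push_cast
  rw [Finset.mul_sum, Finset.sum_mul, Finset.sum_mul, Finset.sum_div]
  refine Finset.sum_congr rfl fun i _ => ?_
  have h1 : ((m : ℂ) + 1) ≠ 0 := by exact_mod_cast m.succ_ne_zero
  have h2 : (m.factorial : ℂ) ≠ 0 := by exact_mod_cast m.factorial_ne_zero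
  rw [pow_succ]
  field_simp

/-- The weights in the array `19`, for which row `m` of the array `21` holds the numbers
`weightTerm t w M m`. -/
def weightsProg : Program :=
  .seq logarithmProg (.seq (numAssign 16 (.div timeExpr (numScalar 15)))
  (.seq (forLoop 20 (.add (scalar 6) (.const 1))
    (.setNum 21 (.const 0) (scalar 20) (.const 0)))
  (.seq (.setNum 21 (.const 0) (.const 0) (.const 1)) (.seq (numAssign 18 (.const 0))
  (forLoop 17 (.add (scalar 6) (.const 1))
    (.seq (sumProg 24 (.add (scalar 6) (.const 1)) (.get 21 (scalar 17) (scalar 24)))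
    (.seq (.setNum 19 (scalar 17) (.const 0) (numScalar 25))
    (.seq (forLoop 20 (.add (scalar 6) (.const 1))
      (.seq (sumProg 22 (.add (scalar 20) (.const 1)) (.mul (.get 21 (scalar 17) (scalar 22))
        (.get 12 (.sub (scalar 20) (scalar 22)) (.const 0))))
      (.setNum 21 (.add (scalar 17) (.const 1)) (scalar 20) (.div (.mul (.mul (numScalar 23)
        (numScalar 16)) .imag) (.add (numScalar 18) (.const 1))))))
    (numAssign 18 (.add (numScalar 18) (.const 1)))))))))))

theorem halts_weightsProg {M : ℕ} {t w : ℝ} (ht : inp.num 0 0 0 0 = t) (hM : s.nat 6 0 0 = M)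
    (hw : s.num 10 0 0 = w) (hMN : M + 1 ≤ N) :
    Halts inp N weightsProg s fun s' => Frame 11 s s' ∧
      ∀ m ≤ M, s'.num 19 m 0 = weight t w M m := by
  have hM' : ∀ s', Frame 11 s s' →
      (NatExpr.add (scalar 6) (.const 1)).eval inp s' = M + 1 := fun s' h => by
    simp [NatExpr.eval, (h 6 (by norm_num)).1, hM]
  refine .seq ((halts_logarithmProg hM hw (by omega)).mono ?_)
  rintro s₁ ⟨f₁, h₁, h₁'⟩
  refine .seq (.numAssign (.seq ?_))
  simp only [NumExpr.eval, NatExpr.eval, timeExpr, numScalar_eval, ht, h₁']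
  set x : ℂ := (t : ℂ) / (((logPoly w M).eval 1 : ℝ) : ℂ) with hx
  set s₂ := s₁.setNum 16 0 0 x with hs₂
  have f₂ : Frame 16 s₁ s₂ := (Frame.refl _ _).setNum le_rfl
  have F₂ : Frame 11 s s₂ := f₁.trans (f₂.mono (by norm_num))
  have h16 : s₂.num 16 0 0 = x := by simp [hs₂]
  refine (Halts.forLoop hMN (fun s' h => hM' s' (F₂.trans (h.mono (by norm_num))))
    (fun k s' => ∀ j < k, s'.num 21 0 j = 0) (fun i s' y h => h) (by simp) ?_).mono ?_
  · intro i s' _ _ hc h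
    refine .setNum ⟨(Frame.refl _ _).setNum (by norm_num), fun j hj => ?_⟩
    rcases Nat.lt_succ_iff_lt_or_eq.1 hj with h5 | rfl
    · simp [NumExpr.eval, h j h5]
    · simp [NatExpr.eval, NumExpr.eval, hc]
  rintro s₃ ⟨f₃, h₃⟩
  refine .seq (.setNum (.seq (.numAssign ?_)))
  simp only [NatExpr.eval, NumExpr.eval]
  set s₄ := (s₃.setNum 21 0 0 ((1 : ℚ) : ℂ)).setNum 18 0 0 ((0 : ℚ) : ℂ) with hs₄
  have f₄ : Frame 17 s₂ s₄ :=
    ((f₃.mono (by norm_num)).setNum (by norm_num)).setNum (by norm_num)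
  have F₄ : Frame 11 s s₄ := F₂.trans (f₄.mono (by norm_num))
  refine (Halts.forLoop hMN (fun s' h => hM' s' (F₄.trans (h.mono (by norm_num))))
    (fun m s' => s'.num 18 0 0 = m ∧ (∀ m' < m, s'.num 19 m' 0 = weight t w M m') ∧
      ∀ j ≤ M, s'.num 21 m j = weightTerm t w M m j) (fun i s' y h => h) ?_ ?_).mono ?_
  · refine ⟨by simp [hs₄], by simp, fun j hj => ?_⟩
    by_cases hj0 : j = 0
    · simp [hs₄, hj0, weightTerm]
    · simp [hs₄, hj0, weightTerm, h₃ j (by omega), Polynomial.coeff_one]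
  · rintro m s₅ hm f₅ hc ⟨h5, h6, h7⟩
    have F₅ : Frame 17 s₂ s₅ := f₄.trans f₅
    have G₅ : Frame 11 s s₅ := F₂.trans (F₅.mono (by norm_num))
    refine .seq ((halts_sumProg (weightTerm t w M m) hMN
      (fun s' h => hM' s' (G₅.trans (h.mono (by norm_num)))) fun j hj s' h hj' => ?_).mono ?_)
    · simp only [NumExpr.eval, scalar_eval, hj', (h 17 (by norm_num)).1, hc,
        (h 21 (by norm_num)).2, h7 j (by omega)]
    rintro s₆ ⟨f₆, h₆⟩
    refine .seq (.setNum (.seq ?_))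
    have e17 : s₆.nat 17 0 0 = m := by rw [(f₆ 17 (by norm_num)).1, hc]
    simp only [NatExpr.eval, scalar_eval, e17, numScalar_eval, show s₆.num 25 0 0 = _ from h₆]
    set s₇ := s₆.setNum 19 m 0 (∑ j ∈ Finset.range (M + 1), weightTerm t w M m j) with hs₇
    have f₇ : Frame 18 s₅ s₇ := (f₆.mono (by norm_num)).setNum (by norm_num)
    have F₇ : Frame 17 s₂ s₇ := F₅.trans (f₇.mono (by norm_num))
    have G₇ : Frame 11 s s₇ := F₂.trans (F₇.mono (by norm_num))
    have e18 : s₇.num 18 0 0 = m := by simp [hs₇, (f₆ 18 (by norm_num)).2, h5]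
    have e19 : ∀ m' ≤ m, s₇.num 19 m' 0 = weight t w M m' := by
      intro m' hm'
      rcases Nat.lt_or_eq_of_le hm' with h | rfl
      · simp [hs₇, h.ne, (f₆ 19 (by norm_num)).2, h6 m' h]
      · simp [hs₇, weight, weightTerm, Finset.mul_sum]
    have e21 : ∀ j ≤ M, s₇.num 21 m j = weightTerm t w M m j := by
      intro j hj
      simp [hs₇, (f₆ 21 (by norm_num)).2, h7 j hj]
    refine (Halts.forLoop hMN (fun s' h => hM' s' (G₇.trans (h.mono (by norm_num))))
      (fun k s' => (∀ j ≤ M, s'.num 21 m j = weightTerm t w M m j) ∧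
        ∀ j < k, s'.num 21 (m + 1) j = weightTerm t w M (m + 1) j) (fun i s' y h => h)
      ⟨e21, by simp⟩ ?_).mono ?_
    · rintro j s₈ hj f₈ hj₈ ⟨h8, h9⟩
      have F₈ : Frame 17 s₂ s₈ := F₇.trans (f₈.mono (by norm_num))
      have e17₈ : s₈.nat 17 0 0 = m := by
        rw [((f₇.trans (f₈.mono (by norm_num))) 17 (by norm_num)).1, hc]
      have e12 : ∀ i ≤ M, s₈.num 12 i 0 = (((logPoly w M).coeff i : ℝ) : ℂ) := by
        intro i hi
        rw [(F₈ 12 (by norm_num)).2, (f₂ 12 (by norm_num)).2, h₁ i hi]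
      refine .seq ((halts_sumProg (n := j + 1) (fun i => weightTerm t w M m i *
        (((logPoly w M).coeff (j - i) : ℝ) : ℂ)) (by omega) (fun s' h => ?_)
        fun i hi s' h hi' => ?_).mono ?_)
      · simp [NatExpr.eval, (h 20 (by norm_num)).1, hj₈]
      · simp only [NumExpr.eval, NatExpr.eval, scalar_eval, hi', (h 17 (by norm_num)).1, e17₈,
          (h 20 (by norm_num)).1, hj₈, (h 21 (by norm_num)).2, (h 12 (by norm_num)).2,
          h8 i (by omega), e12 (j - i) (by omega)]
      rintro s₉ ⟨f₉, h₉⟩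
      have e17₉ : s₉.nat 17 0 0 = m := by rw [(f₉ 17 (by norm_num)).1, e17₈]
      have e20₉ : s₉.nat 20 0 0 = j := by rw [(f₉ 20 (by norm_num)).1, hj₈]
      have e18₉ : s₉.num 18 0 0 = m := by
        rw [(f₉ 18 (by norm_num)).2, (f₈ 18 (by norm_num)).2, e18]
      have e16₉ : s₉.num 16 0 0 = x := by
        rw [(f₉ 16 (by norm_num)).2, (F₈ 16 (by norm_num)).2, h16]
      have e21₉ := (f₉ 21 (by norm_num)).2
      have e23₉ : s₉.num 23 0 0 = _ := h₉
      refine .setNum ⟨(f₉.mono (by norm_num)).setNum (by norm_num), fun j' hj' => ?_,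
        fun j' hj' => ?_⟩
      · simp [NatExpr.eval, e17₉, e21₉, h8 j' hj']
      · rcases Nat.lt_succ_iff_lt_or_eq.1 hj' with h10 | rfl
        · simp [NatExpr.eval, e17₉, e20₉, e21₉, h10.ne, h9 j' h10]
        · simp [NatExpr.eval, NumExpr.eval, e17₉, e20₉, e23₉, e16₉, e18₉, weightTerm_succ, hx]
    · rintro s₈ ⟨f₈, h8, h9⟩
      have e18₈ : s₈.num 18 0 0 = m := by rw [(f₈ 18 (by norm_num)).2, e18]
      refine .numAssign ⟨(f₇.trans (f₈.mono (by norm_num))).setNum (by norm_num), ?_,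
        fun m' hm' => ?_, fun j hj => ?_⟩
      · simp [NumExpr.eval, e18₈]
      · simpa [(f₈ 19 (by norm_num)).2] using e19 m' (by omega)
      · simpa using h9 j (by omega)
  · rintro s₅ ⟨f₅, -, h6, -⟩
    exact ⟨F₄.trans (f₅.mono (by norm_num)), fun m hm => h6 m (by omega)⟩

/-- The program: the parameters and the weights are computed first, and then the contributions of
all labellings are added up. If `ε` is at least one, then zero is an admissible answer. -/
def simulationProg (d deg : ℕ) : Program :=
  .ite (.numLE (.const 1) errorExpr) .skip (.seq (parametersProg deg) (.seq weightsProg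
    (.seq (labellingsProg d) (numAssign 0 (numScalar 41)))))

end SpinSim

namespace SpinSim

/-! ### Correctness of the tables -/

open scoped Matrix.Norms.L2Operator

theorem sum_digits_div_mod {d k m : ℕ} {f : ℕ → ℕ} (hf : ∀ j, f j < d) (hm : m < k) :
    (∑ j ∈ Finset.range k, f j * d ^ j) / d ^ m % d = f m := by
  have h1 := finFunctionFinEquiv_symm_apply_val
    (finFunctionFinEquiv fun j : Fin k => (⟨f j, hf j⟩ : Fin d)) ⟨m, hm⟩
  rw [Equiv.symm_apply_apply, finFunctionFinEquiv_apply] at h1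
  rw [Finset.sum_range]
  exact h1.symm

theorem finFunctionFinEquiv_div_mod {d y : ℕ} (σ : Fin y → Fin d) (q : Fin y) :
    (finFunctionFinEquiv σ : ℕ) / d ^ (q : ℕ) % d = σ q := by
  rw [← finFunctionFinEquiv_symm_apply_val, Equiv.symm_apply_apply]

theorem card_filter_lt_orderEmbOfFin {n : ℕ} (X : Finset (Fin n)) (j : Fin X.card) :
    (X.filter (· < X.orderEmbOfFin rfl j)).card = j := by
  have : X.filter (· < X.orderEmbOfFin rfl j) =
      (Finset.Iio j).map (X.orderEmbOfFin rfl).toEmbedding := by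
    ext x
    simp only [Finset.mem_filter, Finset.mem_map, Finset.mem_Iio, RelEmbedding.coe_toEmbedding]
    constructor
    · rintro ⟨hx, h⟩
      obtain ⟨i, hi⟩ := (X.orderIsoOfFin rfl).surjective ⟨x, hx⟩
      have hi' : X.orderEmbOfFin rfl i = x := by
        rw [← Finset.coe_orderIsoOfFin_apply, hi]
      refine ⟨i, ?_, hi'⟩
      rw [← hi'] at h
      exact (X.orderEmbOfFin rfl).lt_iff_lt.1 h
    · rintro ⟨i, hi, rfl⟩
      exact ⟨Finset.orderEmbOfFin_mem _ _ _, (X.orderEmbOfFin rfl).lt_iff_lt.2 hi⟩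
  rw [this, Finset.card_map, Fin.card_Iio]

variable {n d : ℕ} {inp : Input} {u : ℕ} {X : Finset (Fin n)} {Y : List ℕ}

theorem size_eq_card (hX : spins inp u = (X.sort (· ≤ ·)).map Fin.val) :
    inp.nat 1 u 0 = X.card := by
  simpa [spins] using congrArg List.length hX

theorem spin_eq_orderEmbOfFin (hX : spins inp u = (X.sort (· ≤ ·)).map Fin.val) (j : Fin X.card) :
    inp.nat 2 u j = (X.orderEmbOfFin rfl j : Fin n) := by
  have hj : (j : ℕ) < inp.nat 1 u 0 := by rw [size_eq_card hX]; exact j.2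
  have h := congrArg (fun l => l.getD (j : ℕ) 0) hX
  simp only [spins] at h
  rw [List.getD_eq_getElem _ _ (by simpa using hj), List.getD_eq_getElem _ _ (by simp)] at h
  simpa [Finset.orderEmbOfFin_apply] using h

theorem sum_spins {M : Type*} [AddCommMonoid M] (hX : spins inp u = (X.sort (· ≤ ·)).map Fin.val)
    (g : ℕ → M) : ∑ j ∈ Finset.range (inp.nat 1 u 0), g (inp.nat 2 u j) = ∑ x ∈ X, g x := by
  have h1 : ∑ j ∈ Finset.range (inp.nat 1 u 0), g (inp.nat 2 u j) = ((spins inp u).map g).sum := by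
    rw [spins, List.map_map, ← List.sum_toFinset _ List.nodup_range]
    exact Finset.sum_congr (by ext; simp) fun _ _ => rfl
  rw [h1, hX, List.map_map, ← List.sum_toFinset _ (Finset.sort_nodup _ _), Finset.sort_toFinset]
  rfl

/-- The number of a restricted configuration is the one under which the input presents it. -/
theorem configOf_localNumber [NeZero d] (hX : spins inp u = (X.sort (· ≤ ·)).map Fin.val)
    {p : X → Fin Y.length} (hp : ∀ x : X, (p x : ℕ) = Y.idxOf ((x : Fin n) : ℕ))
    (σ : Fin Y.length → Fin d) :
    configOf X (localNumber inp d Y u (finFunctionFinEquiv σ)) = σ ∘ p := by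
  funext x
  obtain ⟨j, rfl⟩ := (X.orderIsoOfFin rfl).surjective x
  have hj : (j : ℕ) < inp.nat 1 u 0 := by rw [size_eq_card hX]; exact j.2
  apply Fin.ext
  rw [configOf, Fin.val_ofNat, Finset.coe_orderIsoOfFin_apply, card_filter_lt_orderEmbOfFin,
    localNumber, sum_digits_div_mod (fun _ => Nat.mod_lt _ (NeZero.pos d)) hj,
    spin_eq_orderEmbOfFin hX, Function.comp_apply, ← finFunctionFinEquiv_div_mod σ (p _), hp,
    Finset.coe_orderIsoOfFin_apply]

theorem restNumber_eq [NeZero d] (hX : spins inp u = (X.sort (· ≤ ·)).map Fin.val)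
    {p : X → Fin Y.length} (hp : ∀ x : X, (p x : ℕ) = Y.idxOf ((x : Fin n) : ℕ))
    (hinj : Function.Injective p) (σ : Fin Y.length → Fin d) [DecidablePred (· ∈ Set.range p)] :
    restNumber inp d Y u (finFunctionFinEquiv σ) =
      finFunctionFinEquiv fun q => if q ∈ Set.range p then 0 else σ q := by
  have h1 : ∑ j ∈ Finset.range (inp.nat 1 u 0), (finFunctionFinEquiv σ : ℕ) /
      d ^ Y.idxOf (inp.nat 2 u j) % d * d ^ Y.idxOf (inp.nat 2 u j) =
      ∑ q, if q ∈ Set.range p then (σ q : ℕ) * d ^ (q : ℕ) else 0 := by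
    rw [sum_spins hX fun v => (finFunctionFinEquiv σ : ℕ) / d ^ Y.idxOf v % d * d ^ Y.idxOf v,
      ← Finset.sum_coe_sort X, ← Finset.sum_filter]
    have : Finset.univ.filter (· ∈ Set.range p) = Finset.univ.image p := by
      ext q
      simp
    rw [this, Finset.sum_image hinj.injOn]
    refine Finset.sum_congr rfl fun x _ => ?_
    rw [← hp, finFunctionFinEquiv_div_mod]
  rw [restNumber, h1]
  simp only [finFunctionFinEquiv_apply]
  have h2 : ∑ q, (σ q : ℕ) * d ^ (q : ℕ) =
      ∑ q, ((if q ∈ Set.range p then 0 else σ q : Fin d) : ℕ) * d ^ (q : ℕ) +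
        ∑ q, if q ∈ Set.range p then (σ q : ℕ) * d ^ (q : ℕ) else 0 := by
    rw [← Finset.sum_add_distrib]
    refine Finset.sum_congr rfl fun q _ => ?_
    split_ifs <;> simp
  rw [h2, Nat.add_sub_cancel]

theorem restNumber_eq_restNumber_iff [NeZero d] (hX : spins inp u = (X.sort (· ≤ ·)).map Fin.val)
    {p : X → Fin Y.length} (hp : ∀ x : X, (p x : ℕ) = Y.idxOf ((x : Fin n) : ℕ))
    (hinj : Function.Injective p) (σ τ : Fin Y.length → Fin d) :
    restNumber inp d Y u (finFunctionFinEquiv σ) = restNumber inp d Y u (finFunctionFinEquiv τ) ↔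
      ∀ q, q ∉ Set.range p → σ q = τ q := by
  classical
  rw [restNumber_eq hX hp hinj, restNumber_eq hX hp hinj, Fin.val_inj,
    finFunctionFinEquiv.apply_eq_iff_eq]
  constructor
  · intro h q hq
    simpa [hq] using congrFun h q
  · intro h
    funext q
    split_ifs with hq
    · rfl
    · exact h q hq

/-- The entries of a local operator on configurations of the sites. -/
theorem ite_localEntry_eq_lift [NeZero d] (hX : spins inp u = (X.sort (· ≤ ·)).map Fin.val)
    {p : X → Fin Y.length} (hp : ∀ x : X, (p x : ℕ) = Y.idxOf ((x : Fin n) : ℕ))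
    (hinj : Function.Injective p) (B : LocalOperator d X) (σ τ : Fin Y.length → Fin d) :
    (if restNumber inp d Y u (finFunctionFinEquiv σ) = restNumber inp d Y u (finFunctionFinEquiv τ)
      then localEntry X B (localNumber inp d Y u (finFunctionFinEquiv σ))
        (localNumber inp d Y u (finFunctionFinEquiv τ)) else 0) = lift p B σ τ := by
  rw [localEntry, configOf_localNumber hX hp, configOf_localNumber hX hp]
  by_cases h : ∀ q, q ∉ Set.range p → σ q = τ q
  · rw [if_pos ((restNumber_eq_restNumber_iff hX hp hinj σ τ).2 h), lift_apply_of_agree h]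
  · rw [if_neg fun h' => h ((restNumber_eq_restNumber_iff hX hp hinj σ τ).1 h'),
      lift_apply_of_not_agree h]

theorem trace_submatrix_equiv {m m' : Type*} [Fintype m] [Fintype m'] (c : m ≃ m')
    (B : Matrix m' m' ℂ) : (B.submatrix c c).trace = B.trace := by
  simp only [Matrix.trace, Matrix.diag_apply, Matrix.submatrix_apply]
  exact c.sum_comp fun i => B i i

theorem submatrix_ad_pow {m m' : Type} [Fintype m] [Fintype m'] [DecidableEq m] [DecidableEq m']
    (c : m ≃ m') (K A : Matrix m' m' ℂ) (j : ℕ) :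
    ((ad K ^ j) A).submatrix c c = (ad (K.submatrix c c) ^ j) (A.submatrix c c) := by
  induction j with
  | zero => rfl
  | succ j ih =>
    rw [pow_succ', pow_succ', Module.End.mul_apply, Module.End.mul_apply, ← ih, ad_apply, ad_apply,
      Matrix.submatrix_mul_equiv, Matrix.submatrix_mul_equiv]
    rfl

theorem lift_ad_pow {κ ν : Type} [Fintype κ] [Fintype ν] [DecidableEq κ] [DecidableEq ν] {e : κ → ν}
    (he : Function.Injective e) (K A : Matrix (κ → Fin d) (κ → Fin d) ℂ) (j : ℕ) :
    lift e ((ad K ^ j) A) = (ad (lift e K) ^ j) (lift e A) := by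
  induction j with
  | zero => rfl
  | succ j ih =>
    rw [pow_succ', pow_succ', Module.End.mul_apply, Module.End.mul_apply, ← ih, ad_apply, ad_apply,
      lift_sub, lift_mul he, lift_mul he]

section Encode

variable [NeZero d] (H : LocalHamiltonian n d) (r : Fin H.numTerms)
  (A : LocalOperator d (H.sub r)) (ρ : Fin n → Matrix (Fin d) (Fin d) ℂ) (t ε : ℝ)

theorem map_range_getD (l : List ℕ) : (List.range l.length).map (fun j => l.getD j 0) = l := by
  refine List.ext_getElem (by simp) fun i h1 h2 => ?_
  simp [h2]

theorem spins_encode {i : ℕ} (hi : i < H.numTerms) :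
    spins (encode H r A ρ t ε) i = ((H.sub ⟨i, hi⟩).sort (· ≤ ·)).map Fin.val := by
  have h := map_range_getD (((H.sub ⟨i, hi⟩).sort (· ≤ ·)).map Fin.val)
  rw [List.length_map, Finset.length_sort] at h
  simp only [spins, encode, hi, dif_pos]
  exact h

theorem nbs_encode (i : ℕ) : nbs (encode H r A ρ t ε) i = H.nbAt i := by
  by_cases hi : i < H.numTerms
  · have h := map_range_getD (((H.interactionGraph.neighborFinset ⟨i, hi⟩).sort (· ≤ ·)).map
      Fin.val)
    rw [List.length_map, Finset.length_sort, SimpleGraph.card_neighborFinset_eq_degree] at h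
    simp only [nbs, encode, hi, dif_pos, LocalHamiltonian.nbAt]
    exact h
  · simp [nbs, encode, hi, LocalHamiltonian.nbAt]

theorem mem_sites {Q : List ℕ} {v : ℕ} : v ∈ sites inp Q ↔ ∃ u ∈ Q, v ∈ spins inp u := by
  rw [sites, mem_foldl_push]
  simp

variable {Q : List ℕ}

theorem lt_of_mem_sites (hQ : ∀ u ∈ Q, u < H.numTerms) {v : ℕ}
    (hv : v ∈ sites (encode H r A ρ t ε) Q) : v < n := by
  obtain ⟨u, hu, h⟩ := mem_sites.1 hv
  rw [spins_encode H r A ρ t ε (hQ u hu), List.mem_map] at h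
  obtain ⟨x, -, rfl⟩ := h
  exact x.2

theorem mem_sites_of_mem_sub (hQ : ∀ u ∈ Q, u < H.numTerms) {u : ℕ} (hu : u ∈ Q) {x : Fin n}
    (hx : x ∈ H.sub ⟨u, hQ u hu⟩) : (x : ℕ) ∈ sites (encode H r A ρ t ε) Q := by
  refine mem_sites.2 ⟨u, hu, ?_⟩
  rw [spins_encode H r A ρ t ε (hQ u hu)]
  exact List.mem_map.2 ⟨x, by simpa using hx, rfl⟩

/-- The spins with the numbers in a list. -/
def siteMap {Y : List ℕ} (hY : ∀ v ∈ Y, v < n) : Fin Y.length → Fin n :=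
  fun q => ⟨Y.getD q 0, hY _ (getD_mem q.2)⟩

theorem siteMap_injective {Y : List ℕ} (hY : ∀ v ∈ Y, v < n) (h : Y.Nodup) :
    Function.Injective (siteMap hY) := fun q q' e =>
  Fin.ext (getD_inj h q.2 q'.2 (congrArg Fin.val e))

/-- The position of a spin in a list of sites. -/
def sitePosition {Y : List ℕ} {X : Finset (Fin n)} (hX : ∀ x ∈ X, (x : ℕ) ∈ Y) :
    X → Fin Y.length := fun x => ⟨Y.idxOf ((x : Fin n) : ℕ), List.idxOf_lt_length_iff.2 (hX x x.2)⟩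

theorem siteMap_comp_sitePosition {Y : List ℕ} (hY : ∀ v ∈ Y, v < n) {X : Finset (Fin n)}
    (hX : ∀ x ∈ X, (x : ℕ) ∈ Y) : siteMap hY ∘ sitePosition hX = Subtype.val := by
  funext x
  apply Fin.ext
  simp only [siteMap, sitePosition, Function.comp_apply]
  rw [List.getD_eq_getElem _ _ (List.idxOf_lt_length_iff.2 (hX x x.2))]
  exact List.getElem_idxOf _

theorem sitePosition_injective {Y : List ℕ} (hY : ∀ v ∈ Y, v < n) {X : Finset (Fin n)}
    (hX : ∀ x ∈ X, (x : ℕ) ∈ Y) : Function.Injective (sitePosition hX) := by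
  have h := Subtype.val_injective (p := (· ∈ X))
  rw [← siteMap_comp_sitePosition hY hX] at h
  exact h.of_comp

/-- The observable is the operator on the sites that its table describes. The root of the
exploration comes first in the list of subsystems, hence the condition on `Q.getD 0 0`. -/
theorem lift_observableEntry (hQ : ∀ u ∈ Q, u < H.numTerms) (h0 : 0 < Q.length)
    (hr : Q.getD 0 0 = r) :
    lift (siteMap fun _ => lt_of_mem_sites H r A ρ t ε hQ)
      ((tableMatrix _ (observableEntry (encode H r A ρ t ε) d Q
        (sites (encode H r A ρ t ε) Q))).submatrix finFunctionFinEquiv finFunctionFinEquiv) =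
      embed (H.sub r) A := by
  have hrQ : (r : ℕ) ∈ Q := hr ▸ getD_mem h0
  have hX : ∀ x ∈ H.sub r, (x : ℕ) ∈ sites (encode H r A ρ t ε) Q := fun x hx =>
    mem_sites_of_mem_sub H r A ρ t ε hQ hrQ hx
  have hY := fun v => lt_of_mem_sites H r A ρ t ε hQ (v := v)
  rw [embed_eq_lift, ← siteMap_comp_sitePosition hY hX,
    ← lift_lift (siteMap_injective hY (nodup_foldl_push _ List.nodup_nil))]
  congr 1
  ext σ τ
  rw [← ite_localEntry_eq_lift (spins_encode H r A ρ t ε r.2) (fun x => rfl)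
    (sitePosition_injective hY hX)]
  simp only [tableMatrix, Matrix.submatrix_apply, Matrix.of_apply, observableEntry, hr]
  rfl

/-- The partial Hamiltonian is represented by its table. -/
theorem lift_hamiltonianEntry (hQ : ∀ u ∈ Q, u < H.numTerms) (hnodup : Q.Nodup) (D : ℕ → ℕ) :
    lift (siteMap fun _ => lt_of_mem_sites H r A ρ t ε hQ)
      ((tableMatrix _ (hamiltonianEntry (encode H r A ρ t ε) d D Q
        (sites (encode H r A ρ t ε) Q))).submatrix finFunctionFinEquiv finFunctionFinEquiv) =
      ∑ i ∈ ((Finset.range Q.length).filter (D · = 1)).image fun q => Q.getD q 0, H.termAt i := by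
  have hY := fun v => lt_of_mem_sites H r A ρ t ε hQ (v := v)
  have hterm : ∀ i < Q.length, H.termAt (Q.getD i 0) =
      lift (siteMap hY) ((Matrix.of fun a b : Fin (d ^ (sites (encode H r A ρ t ε) Q).length) =>
        if restNumber (encode H r A ρ t ε) d (sites (encode H r A ρ t ε) Q) (Q.getD i 0) a =
          restNumber (encode H r A ρ t ε) d (sites (encode H r A ρ t ε) Q) (Q.getD i 0) b then
        (encode H r A ρ t ε).num 1 (Q.getD i 0) 0 0 * (encode H r A ρ t ε).num 2 (Q.getD i 0)
          (localNumber (encode H r A ρ t ε) d (sites (encode H r A ρ t ε) Q) (Q.getD i 0) a)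
          (localNumber (encode H r A ρ t ε) d (sites (encode H r A ρ t ε) Q) (Q.getD i 0) b)
        else 0).submatrix finFunctionFinEquiv finFunctionFinEquiv) := by
    intro i hi
    have hu := getD_mem hi
    set u := Q.getD i 0
    have hX : ∀ x ∈ H.sub ⟨u, hQ u hu⟩, (x : ℕ) ∈ sites (encode H r A ρ t ε) Q := fun x hx =>
      mem_sites_of_mem_sub H r A ρ t ε hQ hu hx
    rw [LocalHamiltonian.termAt, dif_pos (hQ u hu), embed_eq_lift,
      ← siteMap_comp_sitePosition hY hX,
      ← lift_lift (siteMap_injective hY (nodup_foldl_push _ List.nodup_nil)), ← lift_smul]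
    congr 1
    ext σ τ
    rw [Matrix.smul_apply, ← ite_localEntry_eq_lift (spins_encode H r A ρ t ε (hQ u hu))
      (fun x => rfl) (sitePosition_injective hY hX), smul_eq_mul, mul_ite, mul_zero]
    simp only [Matrix.submatrix_apply, Matrix.of_apply]
    congr 1
    simp [encode, hQ u hu]
  rw [Finset.sum_image fun i hi j hj e => getD_inj hnodup
    (Finset.mem_range.1 (Finset.mem_filter.1 hi).1) (Finset.mem_range.1 (Finset.mem_filter.1 hj).1) e,
    Finset.sum_congr rfl fun i hi => hterm i (Finset.mem_range.1 (Finset.mem_filter.1 hi).1),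
    ← lift_sum]
  congr 1
  ext σ τ
  simp only [tableMatrix, Matrix.submatrix_apply, Matrix.of_apply, hamiltonianEntry,
    Matrix.sum_apply, Finset.sum_filter, ite_and]

theorem num_encode_state {v : ℕ} (hv : v < n) (a b : ℕ) :
    (encode H r A ρ t ε).num 4 v a b = ρ ⟨v, hv⟩ (Fin.ofNat d a) (Fin.ofNat d b) := by
  simp [encode, hv]

/-- The state is represented by its table. -/
theorem submatrix_stateEntry (hQ : ∀ u ∈ Q, u < H.numTerms) :
    (tableMatrix _ (stateEntry (encode H r A ρ t ε) d (sites (encode H r A ρ t ε) Q))).submatrix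
      finFunctionFinEquiv finFunctionFinEquiv =
    Matrix.of fun σ τ => ∏ q, ρ (siteMap (fun _ => lt_of_mem_sites H r A ρ t ε hQ) q) (σ q)
      (τ q) := by
  ext σ τ
  simp only [tableMatrix, Matrix.submatrix_apply, Matrix.of_apply, stateEntry, Finset.prod_range,
    finFunctionFinEquiv_div_mod]
  refine Finset.prod_congr rfl fun q _ => ?_
  rw [num_encode_state H r A ρ t ε (lt_of_mem_sites H r A ρ t ε hQ (getD_mem q.2)),
    Fin.ofNat_val_eq_self, Fin.ofNat_val_eq_self]
  rfl

/-- What the program computes on the sites is the expectation in the full system: commutators are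
compatible with embeddings, and the other factors of the state have trace one. -/
theorem localExpectation_encode (hρ : ∀ v, (ρ v).trace = 1) (hQ : ∀ u ∈ Q, u < H.numTerms)
    (hnodup : Q.Nodup) (h0 : 0 < Q.length) (hr : Q.getD 0 0 = r) (D : ℕ → ℕ) (wt : ℕ → ℂ) (M : ℕ) :
    localExpectation (encode H r A ρ t ε) d wt M D Q =
      H.partialExpectation (productOperator ρ) (embed (H.sub r) A) wt M
        (((Finset.range Q.length).filter (D · = 1)).image fun q => Q.getD q 0) := by
  have hY := fun v => lt_of_mem_sites H r A ρ t ε hQ (v := v)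
  have he := siteMap_injective hY (nodup_foldl_push _ List.nodup_nil)
  rw [localExpectation, LocalHamiltonian.partialExpectation, horner_eq_sum, Finset.sum_mul,
    Matrix.trace_sum]
  refine Finset.sum_congr rfl fun m _ => ?_
  rw [Matrix.smul_mul, Matrix.trace_smul, smul_eq_mul, ← trace_submatrix_equiv finFunctionFinEquiv,
    ← Matrix.submatrix_mul_equiv _ _ _ finFunctionFinEquiv, submatrix_ad_pow,
    submatrix_stateEntry H r A ρ t ε hQ, ← trace_lift_mul_prod he _ ρ hρ, lift_ad_pow he,
    lift_observableEntry H r A ρ t ε hQ h0 hr, lift_hamiltonianEntry H r A ρ t ε hQ hnodup D]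
  rfl

end Encode

end SpinSim

namespace SpinSim

/-! ### The running time -/

section Encode

variable {n d : ℕ} [NeZero d] (H : LocalHamiltonian n d) (r : Fin H.numTerms)
  (A : LocalOperator d (H.sub r)) (ρ : Fin n → Matrix (Fin d) (Fin d) ℂ) (t ε : ℝ)

omit [NeZero d] in
theorem lt_of_mem_explore {D : ℕ → ℕ} {p u : ℕ} (hu : u ∈ explore H.nbAt r D p) :
    u < H.numTerms := by
  induction p with
  | zero =>
    rw [explore, List.mem_singleton] at hu
    exact hu ▸ r.2
  | succ p ih =>
    rw [explore] at hu
    split_ifs at hu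
    · rcases mem_foldl_push.1 hu with h | h
      · exact ih h
      · obtain ⟨_, h', _⟩ := H.mem_nbAt.1 h
        exact h'
    · exact ih hu

theorem getD_explore_zero (nb : ℕ → List ℕ) (r : ℕ) (D : ℕ → ℕ) (p : ℕ) :
    (explore nb r D p).getD 0 0 = r := by
  rw [getD_of_prefix (explore_prefix (Nat.zero_le p)) (by simp [explore])]
  rfl

theorem length_sites_le {inp : Input} {k : ℕ} (h : ∀ i, inp.nat 1 i 0 ≤ k) (Q : List ℕ) :
    (sites inp Q).length ≤ k * Q.length := by
  refine (length_foldl_push_le _ _).trans ?_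
  rw [List.length_nil, zero_add, List.length_flatMap, mul_comm]
  refine (List.sum_le_card_nsmul _ k fun x hx => ?_).trans (by simp)
  obtain ⟨i, -, rfl⟩ := List.mem_map.1 hx
  simpa [spins] using h i

theorem nat_encode_one_le {k : ℕ} (hk : H.IsLocal k) (i : ℕ) :
    (encode H r A ρ t ε).nat 1 i 0 ≤ k := by
  by_cases hi : i < H.numTerms
  · simpa [encode, hi] using hk ⟨i, hi⟩
  · simp [encode, hi]

theorem nat_encode_three_le {deg : ℕ} (hdeg : H.interactionGraph.maxDegree ≤ deg) (i : ℕ) :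
    (encode H r A ρ t ε).nat 3 i 0 ≤ deg := by
  by_cases hi : i < H.numTerms
  · simpa [encode, hi] using (H.interactionGraph.degree_le_maxDegree ⟨i, hi⟩).trans hdeg
  · simp [encode, hi]

theorem position_lt {Q : List ℕ} (hQ : ∀ u ∈ Q, u < H.numTerms) {u j : ℕ} (hu : u ∈ Q)
    (hj : j < (encode H r A ρ t ε).nat 1 u 0) : j < (sites (encode H r A ρ t ε) Q).length ∧
      (sites (encode H r A ρ t ε) Q).idxOf ((encode H r A ρ t ε).nat 2 u j) <
        (sites (encode H r A ρ t ε) Q).length := by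
  constructor
  · rw [size_eq_card (spins_encode H r A ρ t ε (hQ u hu))] at hj
    refine hj.trans_le ?_
    have hX : ∀ x ∈ H.sub ⟨u, hQ u hu⟩, (x : ℕ) ∈ sites (encode H r A ρ t ε) Q := fun x hx =>
      mem_sites_of_mem_sub H r A ρ t ε hQ hu hx
    simpa using Fintype.card_le_of_injective _
      (sitePosition_injective (fun v => lt_of_mem_sites H r A ρ t ε hQ (v := v)) hX)
  · rw [List.idxOf_lt_length_iff]
    exact mem_sites.2 ⟨u, hu, List.mem_map.2 ⟨j, List.mem_range.2 hj, rfl⟩⟩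

/-- The bound for the number of iterations of every loop. The factor in the exponent covers the
dimension `d ^ (k L)` of the matrices and the number `3 ^ L` of labellings. -/
def iterationBound (d k deg M : ℕ) : ℕ := (d + 3) ^ ((k + deg + 1) * ((deg + 1) * (M + 1)))

/-- For `ε < 1` the program halts with the approximation in the output cell. The numbers `l` and `m`
are the least ones that the truncation error allows. -/
theorem halts_simulationProg {k deg : ℕ} (hk : H.IsLocal k)
    (hdeg : H.interactionGraph.maxDegree ≤ deg) (hρ : ∀ v, (ρ v).trace = 1) (hε : ε < 1)
    {l m M : ℕ} (hl : 1 ≤ 2 ^ l * ε) (hl' : ∀ i < l, ¬ 1 ≤ 2 ^ i * ε)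
    (hm : 20 * deg * t + 1 ≤ m) (hm' : ∀ i : ℕ, i < m → ¬ 20 * deg * t + 1 ≤ i)
    (hM : 2 ^ (m + 1) * (l + m + 3) = M) :
    Halts (encode H r A ρ t ε) (iterationBound d k deg M) (simulationProg d deg) Memory.zero
      fun s => s.num 0 0 0 = H.partialExpectation (productOperator ρ) (embed (H.sub r) A)
        (weight t (1 - (1 / 2) ^ m) M) M (Finset.range H.numTerms) := by
  classical
  set inp := encode H r A ρ t ε with hinp
  set L := deg * (M + 1) + 1 with hL
  set N := iterationBound d k deg M with hN
  have hnb : nbs inp = H.nbAt := funext fun i => nbs_encode H r A ρ t ε i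
  have hsize := nat_encode_one_le H r A ρ t ε hk
  have hdegree := nat_encode_three_le H r A ρ t ε hdeg
  have ht : inp.num 0 0 0 0 = t := by simp [hinp, encode]
  have hε' : inp.num 0 1 0 0 = ε := by simp [hinp, encode]
  have hr : inp.nat 0 2 0 = r := by simp [hinp, encode]
  set e := (k + deg + 1) * ((deg + 1) * (M + 1)) with he
  have hL' : L ≤ (deg + 1) * (M + 1) := by rw [hL]; ring_nf; omega
  have hpow : ∀ b x : ℕ, b ≤ d + 3 → x ≤ e → b ^ x ≤ N := fun b x hb hx => by
    rw [hN, iterationBound]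
    exact (Nat.pow_le_pow_left hb x).trans (Nat.pow_le_pow_right (by omega) hx)
  have hle : ∀ x : ℕ, x ≤ e → x ≤ N := fun x hx =>
    (Nat.lt_two_pow_self).le.trans (hpow 2 x (by omega) hx)
  have e1 : k * L + (deg * L + L) ≤ e := by
    rw [he]
    calc k * L + (deg * L + L) = (k + deg + 1) * L := by ring
      _ ≤ _ := Nat.mul_le_mul_left _ hL'
  have hL1 : 1 ≤ L := by omega
  have e2 : k ≤ k * L := Nat.le_mul_of_pos_right _ hL1
  have e3 : deg ≤ deg * L := Nat.le_mul_of_pos_right _ hL1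
  have e4 : M + 1 ≤ e := by
    rw [he]
    calc M + 1 ≤ (deg + 1) * (M + 1) := Nat.le_mul_of_pos_left _ (by omega)
      _ ≤ _ := Nat.le_mul_of_pos_left _ (by omega)
  have e5 : l + m + 3 ≤ M := by
    rw [← hM]
    exact Nat.le_mul_of_pos_left _ (by positivity)
  have hdN : d ≤ N := by simpa using hpow d 1 (by omega) (by omega)
  have hQL : ∀ D, Valid (nbs inp) r L D → (sites inp (explore (nbs inp) r D L)).length ≤ k * L :=
    fun D hD => (length_sites_le hsize _).trans (Nat.mul_le_mul_left _ hD.2.1)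
  have hQ : ∀ D, ∀ u ∈ explore (nbs inp) r D L, u < H.numTerms := by
    intro D u hu
    rw [hnb] at hu
    exact lt_of_mem_explore H r hu
  refine .ite (fun hb => ?_) fun _ => .seq ((halts_parametersProg ht hε' hl hl' hm hm' hM hL.symm
    (hle _ (by omega)) (hle _ (by omega))).mono ?_)
  · simp only [Test.Holds, NumExpr.eval, NatExpr.eval, errorExpr, hε'] at hb
    simp at hb
    linarith
  rintro s₁ ⟨h6, h7, h9, h10⟩
  refine .seq ((halts_weightsProg ht h6 h10 (hle _ e4)).mono ?_)
  rintro s₂ ⟨f₂, h19⟩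
  refine .seq ((halts_labellingsProg (L := L) (M := M) (wt := weight t (1 - (1 / 2) ^ m) M)
    (r := r) (NeZero.pos d) ?_ hL1 ?_ ?_ h19 hr
    (fun D hD i hi j hj => position_lt H r A ρ t ε (hQ D) (getD_mem hi) hj)
    (hpow 3 L (by omega) (by omega)) (hle _ (by omega)) (hle _ e4) hdN (fun D p hp => ?_)
    (fun i => (hdegree i).trans (hle _ (by omega)))
    (fun D hD => (hQL D hD).trans (hle _ (by omega)))
    (fun D hD => hpow d _ (by omega) ((hQL D hD).trans (by omega)))
    (fun i => (hsize i).trans (hle _ (by omega)))).mono ?_)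
  · rw [(f₂ 7 (by norm_num)).1, h7]
  · rw [(f₂ 6 (by norm_num)).1, h6]
  · rw [(f₂ 9 (by norm_num)).1, h9]
  · rw [hnb]
    refine (length_explore_le_mul (H.length_nbAt_le hdeg) p).trans (hle _ ?_)
    have := Nat.mul_le_mul_left deg hp
    omega
  rintro s₃ h41
  refine .numAssign ?_
  simp only [numScalar_eval, Memory.setNum_num, and_self, if_true, h41]
  rw [H.partialExpectation_eq_sum_label hdeg]
  refine Finset.sum_congr rfl fun c _ => ?_
  rw [← hL, ← hnb]
  split_ifs with hv
  · rw [localExpectation_encode H r A ρ t ε hρ (hQ _) (nodup_explore L)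
      (List.length_pos_of_mem (mem_explore_self L)) (getD_explore_zero _ _ _ _)]
    rfl
  · rfl

end Encode

/-- The truncation order is bounded in terms of `τ = π t / t^*`, which is `2 π e ≥ 17` times
`x = deg * t`. The factor `2 ^ m` is at most `4 exp (14 x)` because `20 log 2 < 14`, and it is
dominated by `exp τ`. -/
theorem order_le {deg l m : ℕ} {t ε : ℝ} (h1 : 1 ≤ deg) (ht : 0 < t) (hε : 0 < ε) (hε1 : ε < 1)
    (hl' : ∀ i < l, ¬ 1 ≤ 2 ^ i * ε) (hm' : ∀ i : ℕ, i < m → ¬ 20 * deg * t + 1 ≤ i) :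
    ((2 ^ (m + 1) * (l + m + 3) + 1 : ℕ) : ℝ) ≤ 56 * (Real.exp (Real.pi * t / tStar deg) *
      (Real.log (1 / ε) + Real.pi * t / tStar deg)) + 56 := by
  set x : ℝ := deg * t with hx
  set τ := Real.pi * t / tStar deg with hτ
  set Λ := Real.log (1 / ε) with hΛ
  have hd0 : (0 : ℝ) < deg := by exact_mod_cast h1
  have hx0 : 0 < x := by positivity
  have hτx : 17 * x ≤ τ := by
    have : τ = 2 * Real.pi * Real.exp 1 * x := by
      rw [hτ, tStar, hx]
      field_simp
    rw [this]
    have hpi := Real.pi_gt_d2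
    have he := Real.exp_one_gt_d9
    have : (17 : ℝ) ≤ 2 * Real.pi * Real.exp 1 := by nlinarith
    gcongr
  have hΛ0 : 0 ≤ Λ := Real.log_nonneg (by rw [le_div_iff₀ hε]; linarith)
  have hlog1 := Real.log_two_gt_d9
  have hlog2 := Real.log_two_lt_d9
  have hm : (m : ℝ) ≤ 20 * x + 2 := by
    rcases m with _ | m
    · push_cast
      positivity
    · have := hm' m (Nat.lt_succ_self m)
      push_cast
      rw [hx]
      linarith
  have hl : (l : ℝ) ≤ 1 + 2 * Λ := by
    rcases l with _ | l
    · push_cast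
      linarith
    · have h2 := not_le.1 (hl' l (Nat.lt_succ_self l))
      have h3 : (2 : ℝ) ^ l ≤ 1 / ε := by
        rw [le_div_iff₀ hε]
        exact h2.le
      have h4 := Real.log_le_log (by positivity) h3
      rw [Real.log_pow] at h4
      push_cast
      have : (l : ℝ) * (1 / 2) ≤ l * Real.log 2 := by
        gcongr
        linarith
      linarith
  set F := Real.exp (14 * x) with hF
  have hF0 : 0 < F := Real.exp_pos _
  have hFE : F ≤ Real.exp τ := Real.exp_le_exp.2 (by linarith)
  -- a summand `F` without a factor `Λ` or `x` is only allowed up to a constant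
  have hF1 : F ≤ 1 + 14 * x * F := by
    have h2 := Real.add_one_le_exp (-(14 * x))
    have h3 : Real.exp (-(14 * x)) * F = 1 := by rw [hF, ← Real.exp_add]; simp
    nlinarith
  have h8 : (2 : ℝ) ^ (m + 1) ≤ 8 * F := by
    have h2 : (2 : ℝ) ^ (m + 1) = Real.exp ((m + 1) * Real.log 2) := by
      rw [mul_comm, Real.exp_mul, Real.exp_log (by norm_num)]
      norm_cast
    have h3 : (8 : ℝ) = Real.exp (3 * Real.log 2) := by
      rw [mul_comm, Real.exp_mul, Real.exp_log (by norm_num)]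
      norm_num
    rw [h2, h3, ← Real.exp_add]
    refine Real.exp_le_exp.2 ?_
    nlinarith
  have h9 : (1 : ℝ) ≤ 2 ^ (m + 1) := one_le_pow₀ (by norm_num)
  push_cast
  calc (2 : ℝ) ^ (m + 1) * (l + m + 3) + 1 ≤ 2 ^ (m + 1) * (l + m + 4) := by linarith
    _ ≤ 8 * F * (2 * Λ + 20 * x + 7) :=
        mul_le_mul h8 (by linarith) (by positivity) (by positivity)
    _ = 16 * (F * Λ) + 160 * (x * F) + 56 * F := by ring
    _ ≤ 16 * (F * Λ) + 160 * (x * F) + 56 * (1 + 14 * x * F) := by gcongr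
    _ = 16 * (F * Λ) + 944 * x * F + 56 := by ring
    _ ≤ 56 * (F * Λ) + 56 * τ * F + 56 := by
        have h2 : 0 ≤ F * Λ := by positivity
        have h3 : 944 * x * F ≤ 56 * τ * F :=
          mul_le_mul_of_nonneg_right (by linarith) hF0.le
        linarith
    _ = 56 * (F * (Λ + τ)) + 56 := by ring
    _ ≤ _ := by
        have : 0 ≤ Λ + τ := by linarith
        gcongr

/-- A number that is exponential in the truncation order is polynomial in `(e^τ / ε) ^ exp τ`, which
is the exponential of `exp τ * (log (1 / ε) + τ)`. -/
theorem pow_order_le {G M : ℕ} {ε τ : ℝ} (hG : 1 ≤ G) (hε : 0 < ε) (hε1 : ε < 1) (hτ : 0 ≤ τ)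
    (hM : ((M + 1 : ℕ) : ℝ) ≤ 56 * (Real.exp τ * (Real.log (1 / ε) + τ)) + 56) :
    (G : ℝ) ^ (M + 1) ≤ (G : ℝ) ^ 56 *
      ((1 / ε * Real.exp τ) ^ Real.exp τ) ^ ⌈56 * Real.log G⌉₊ := by
  have hG' : (1 : ℝ) ≤ G := by exact_mod_cast hG
  have hG0 : (0 : ℝ) < G := by linarith
  have hlog : 0 ≤ Real.log G := Real.log_nonneg hG'
  set y := Real.exp τ * (Real.log (1 / ε) + τ) with hy
  have hΛ0 : 0 ≤ Real.log (1 / ε) := Real.log_nonneg (by rw [le_div_iff₀ hε]; linarith)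
  have hy0 : 0 ≤ y := by positivity
  have h1 : (1 / ε * Real.exp τ) ^ Real.exp τ = Real.exp y := by
    rw [Real.rpow_def_of_pos (by positivity), Real.log_mul (by positivity) (by positivity),
      Real.log_exp, mul_comm]
  have h2 : ∀ j : ℕ, (G : ℝ) ^ j = Real.exp (j * Real.log G) := by
    intro j
    rw [mul_comm, Real.exp_mul, Real.exp_log hG0, Real.rpow_natCast]
  rw [h1, h2, h2, ← Real.exp_nat_mul, ← Real.exp_add]
  refine Real.exp_le_exp.2 ?_
  calc ((M + 1 : ℕ) : ℝ) * Real.log G ≤ (56 * y + 56) * Real.log G := by gcongr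
    _ = (56 : ℕ) * Real.log G + (56 * Real.log G) * y := by push_cast; ring
    _ ≤ _ := by
        gcongr
        exact Nat.le_ceil _

end SpinSim

theorem mainTheorem2 (d k deg : ℕ) [NeZero d] (hdeg : 1 ≤ deg) :
    ∃ (P : SpinSim.Program) (p : Polynomial ℝ),
      ∀ (n : ℕ) (H : SpinSim.LocalHamiltonian n d), H.IsLocal k →
        H.interactionGraph.maxDegree ≤ deg →
      ∀ (r : Fin H.numTerms) (A : SpinSim.LocalOperator d (H.sub r)),
        SpinSim.HasSupport (SpinSim.embed (H.sub r) A) (H.sub r) →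
      ∀ ρ : Fin n → Matrix (Fin d) (Fin d) ℂ, (∀ v, SpinSim.IsDensity (ρ v)) →
      ∀ t ε : ℝ, 0 < t → 0 < ε →
      ∃ (s : SpinSim.Memory) (T : ℕ),
        SpinSim.Runs (SpinSim.encode H r A ρ t ε) P SpinSim.Memory.zero s T ∧
        (T : ℝ) ≤ p.eval ((1 / ε * Real.exp (Real.pi * t / SpinSim.tStar deg)) ^
          Real.exp (Real.pi * t / SpinSim.tStar deg)) ∧
        ‖SpinSim.evolvedExpectation H.toOperator (SpinSim.embed (H.sub r) A)
            (SpinSim.productOperator ρ) t - s.num 0 0 0‖ ≤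
          ε * SpinSim.opNorm (SpinSim.embed (H.sub r) A) := by
  set P := SpinSim.simulationProg d deg with hP
  obtain ⟨C, hC⟩ := P.exists_time_le
  -- the running time `C * iterationBound ^ C` is `C * G ^ (M + 1)`
  set G : ℕ := (d + 3) ^ ((k + deg + 1) * (deg + 1) * C) with hG
  refine ⟨P, Polynomial.C (C * (G : ℝ) ^ 56) * Polynomial.X ^ ⌈56 * Real.log G⌉₊ +
    Polynomial.C (P.time 1 : ℝ), fun n H hk hmax r A _ ρ hρ t ε ht hε => ?_⟩
  set τ := Real.pi * t / SpinSim.tStar deg with hτ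
  have hτ0 : 0 ≤ τ := by
    have : 0 ≤ SpinSim.tStar deg := by unfold SpinSim.tStar; positivity
    have := Real.pi_pos
    positivity
  simp only [Polynomial.eval_add, Polynomial.eval_mul, Polynomial.eval_C, Polynomial.eval_pow,
    Polynomial.eval_X]
  rcases le_or_gt 1 ε with h1 | h1
  -- for `1 ≤ ε` the program stops at once with the answer zero, and `P.time 1` covers its steps
  · have hh : SpinSim.Halts (SpinSim.encode H r A ρ t ε) 1 P SpinSim.Memory.zero
        fun s => s = SpinSim.Memory.zero := by
      refine .ite (fun _ => .skip rfl) fun hb => absurd ?_ hb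
      simpa [SpinSim.Test.Holds, SpinSim.NumExpr.eval, SpinSim.NatExpr.eval, SpinSim.errorExpr,
        SpinSim.encode] using h1
    obtain ⟨s, T, hR, hT, rfl⟩ := hh
    refine ⟨_, T, hR, ?_, ?_⟩
    · have h2 : (T : ℝ) ≤ P.time 1 := by exact_mod_cast hT
      have h3 : 0 ≤ C * (G : ℝ) ^ 56 *
          ((1 / ε * Real.exp τ) ^ Real.exp τ) ^ ⌈56 * Real.log G⌉₊ := by positivity
      linarith
    · rw [show SpinSim.Memory.zero.num 0 0 0 = 0 from rfl, sub_zero]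
      refine (H.norm_evolvedExpectation_le _ hρ t).trans (le_mul_of_one_le_left ?_ h1)
      exact norm_nonneg _
  · classical
    have hlex : ∃ l : ℕ, 1 ≤ 2 ^ l * ε := by
      obtain ⟨l, hl⟩ := pow_unbounded_of_one_lt (1 / ε) one_lt_two
      exact ⟨l, by rw [div_lt_iff₀ hε] at hl; exact hl.le⟩
    have hmex : ∃ m : ℕ, 20 * deg * t + 1 ≤ m := exists_nat_ge _
    set l := Nat.find hlex
    set m := Nat.find hmex
    have hl : 1 ≤ 2 ^ l * ε := Nat.find_spec hlex
    have hm : 20 * deg * t + 1 ≤ m := Nat.find_spec hmex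
    have hl' : ∀ i < l, ¬ 1 ≤ 2 ^ i * ε := fun i hi => Nat.find_min hlex hi
    have hm' : ∀ i : ℕ, i < m → ¬ 20 * deg * t + 1 ≤ i := fun i hi => Nat.find_min hmex hi
    obtain ⟨s, T, hR, hT, hs⟩ := SpinSim.halts_simulationProg H r A ρ t ε hk hmax
      (fun v => (hρ v).2) h1 hl hl' hm hm' rfl
    refine ⟨s, T, hR, ?_, ?_⟩
    · set M := 2 ^ (m + 1) * (l + m + 3) with hM
      have h2 : T ≤ C * G ^ (M + 1) := by
        refine (hT.trans (hC _ (Nat.one_le_pow _ _ (by omega)))).trans_eq ?_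
        rw [SpinSim.iterationBound, hG, ← pow_mul, ← pow_mul]
        congr 2
        ring
      have h3 : (T : ℝ) ≤ C * (G : ℝ) ^ (M + 1) := by exact_mod_cast h2
      have h4 := SpinSim.pow_order_le (G := G) (Nat.one_le_pow _ _ (by omega)) hε h1 hτ0
        (SpinSim.order_le hdeg ht hε h1 hl' hm')
      have h5 : (0 : ℝ) ≤ P.time 1 := Nat.cast_nonneg _
      calc (T : ℝ) ≤ C * (G : ℝ) ^ (M + 1) := h3
        _ ≤ C * ((G : ℝ) ^ 56 * ((1 / ε * Real.exp τ) ^ Real.exp τ) ^ ⌈56 * Real.log G⌉₊) := by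
            gcongr
        _ ≤ _ := by linarith
    · rw [hs]
      exact H.norm_evolvedExpectation_sub_le hdeg hmax r A hρ ht hm hl
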